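/- **Setting.** Coefficients are $\mathbb Z_2$. Let $\emptyset=K_0\subset K_1\subset\dots\subset K_n=K$ be a simplex-wise filtration of a finite simplicial complex $K$ ($K_{j}\setminus K_{j-1}=\{\sigma_j\}$) with $n$ simplices, dimension $d$ and totally ordered vertices. Let $H^*(K_i)=\bigoplus_p H^p(K_i)$ with the simplicial cup product $\smile$, and let $H^{>0}(K_i)$ be its part of positive degree. The *persistent $k$-cup module* is the persistence module $V^k_n\to V^k_{n-1}\to\dots\to V^k_0$ in which $V^k_i\subseteq H^*(K_i)$ is the image of the $k$-fold cup product $H^{>0}(K_i)^{\otimes k}\to H^*(K_i)$, i.e. the span of all $\alpha_1\smile\dots\smile\alpha_k$ with $\alpha_j\in H^{>0}(K_i)$, and the maps are the restrictions of $H^*(K_{i+1})\to H^*(K_i)$. The *barcode* of such a module $M$ is the multiset of intervals $(d',b]=\{d'+1,\dots,b\}$ (death index $d'$, birth index $b$, $0\le d'<b\le n$) for which $M$ is isomorphic to the direct sum of the corresponding interval modules. A *persistent cohomology basis* is the barcode of $H^*(K_\bullet)$ with, for each bar $(d',b]$, a homogeneous cocycle $\xi$ of $K_b$, not a cocycle in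 $K_{b+1}$ (if $b<n$), whose restrictions to $K_i$, $i\le d'$, are trivial in cohomology, such that for every $i$ the classes of the restrictions of the representatives of the bars containing $i$ form a basis of $H^*(K_i)$. **Algorithm OrderkCupPers$(K_\bullet,k)$, $k\ge2$**, for a given persistent cohomology basis $\{(d_{r},b_{r}],\xi_{r}\}$. Cochains are stored as vectors indexed by the simplices; restriction to $K_\ell$ zeroes out rows; products are formed in $K_\ell$. If $k\ge 3$, call OrderkCupPers$(K_\bullet,k-1)$ to obtain bars with representatives $\{(d'_{s},b'_{s}],\eta_s\}$. Let $\mathbf H$ be the list of the $\xi_r$ with $b_r=n$, $\deg\xi_r>0$; $\mathbf R$ the list of the $\eta_s$ with $b'_s=n$ (for $k\ge3$); $\mathbf S$ the coboundary matrix. For $\ell=n,n-1,\dots,1$: 1. Restrict the columns of $\mathbf S,\mathbf R,\mathbf H$ to $K_\ell$ ($\mathbf S$ is kept reduced by left-to-right column additions). 2. To *test* a cochain $\zeta$ means: if $\zeta$ is linearly independent of the columns of $\mathbf S$, append it to $\mathbf S$ on the right, annotated with birth index $\ell$ and representative $\zeta$. * If $k=2$: for every $r$ with $b_r=\ell$ and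 $\deg \xi_r>0$, append $\xi_r$ to $\mathbf H$ if $\ell\ne n$, then test $\xi_r\smile\xi$ for every $\xi$ in $\mathbf H$. * If $k\ge3$: for every $r$ with $b_r=\ell\neq n$ and $\deg\xi_r>0$, append $\xi_r$ to $\mathbf H$ and test $\xi_r\smile\eta$ for every $\eta$ in $\mathbf R$; then, for every $s$ with $b'_s=\ell$, append $\eta_s$ to $\mathbf R$ if $\ell\ne n$ and test $\eta_s\smile\xi$ for every $\xi$ in $\mathbf H$. 3. If $\ell=d_r$ for some $r$ with $\deg\xi_r>0$: reduce $\mathbf S$ by left-to-right column additions; for each annotated column that is zeroed out, remove it and output the bar $(\ell,\text{its birth index}]$ with its representative; remove from $\mathbf H$ and $\mathbf R$ the representatives of the bars with death index $\ell$. Time is the number of elementary steps (operations on indices, on entries in $\mathbb Z_2$ and on vertices, and array accesses) on a unit-cost random access machine. **Theorem.** There is a universal constant $C$ such that for all such filtrations: 1. for every persistent cohomology basis of $K_\bullet$ and every $k\ge2$, OrderkCupPers$(K_\bullet,k)$ outputs the barcode of the persistent $k$-cup module, in at most $C\,k\,n^4$ steps; 2. the standard persistent cohomology algorithm (pCoh)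 computes a persistent cohomology basis from $K_\bullet$ in at most $C\,n^3$ steps; 3. if $d\ge1$, then pCoh followed by a single run of the recursion of OrderkCupPers up to order $d$, in which the output of every level is kept, computes the barcodes of the persistent $k$-cup modules for all $k\in\{2,\dots,d\}$, in at most $C\,d\,n^4$ steps in total. -/

import Mathlib

universe u

/-! ## Simplicial cochains and cohomology with coefficients in `ZMod 2` -/

/-- The total cochain space `C^*(K)` (the direct sum of all the `C^p(K)`): functions on the simplices
of `K`.  A cochain is homogeneous of degree `p` if it is supported on the simplices with `p + 1`
vertices. -/
abbrev Cochain {V : Type u} (K : PreAbstractSimplicialComplex V) : Type u :=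
  {s : Finset V // s ∈ K.faces} → ZMod 2

open Classical in
/-- Extension by zero to all finite vertex sets (in particular the value on the empty set is `0`). -/
noncomputable def Cochain.ext {V : Type u} {K : PreAbstractSimplicialComplex V} (f : Cochain K)
    (s : Finset V) : ZMod 2 :=
  if h : s ∈ K.faces then f ⟨s, h⟩ else 0

theorem Cochain.ext_add {V : Type u} {K : PreAbstractSimplicialComplex V} (f g : Cochain K)
    (s : Finset V) : Cochain.ext (f + g) s = Cochain.ext f s + Cochain.ext g s := by
  unfold Cochain.ext; split_ifs <;> simp

theorem Cochain.ext_smul {V : Type u} {K : PreAbstractSimplicialComplex V} (c : ZMod 2)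
    (f : Cochain K) (s : Finset V) : Cochain.ext (c • f) s = c * Cochain.ext f s := by
  unfold Cochain.ext; split_ifs <;> simp

theorem Cochain.ext_coe {V : Type u} {K : PreAbstractSimplicialComplex V} (f : Cochain K)
    {s : Finset V} (h : s ∈ K.faces) : Cochain.ext f s = f ⟨s, h⟩ := by
  simp [Cochain.ext, h]

theorem Cochain.ext_empty {V : Type u} {K : PreAbstractSimplicialComplex V} (f : Cochain K) :
    Cochain.ext f ∅ = 0 := by
  unfold Cochain.ext
  rw [dif_neg]
  intro h
  exact Finset.not_nonempty_empty (K.isRelLowerSet_faces h).1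

/-- The coboundary operator: `(δ f)(s)` is the sum of `f` over the facets of `s`. -/
noncomputable def coboundary {V : Type u} [LinearOrder V] (K : PreAbstractSimplicialComplex V) :
    Cochain K →ₗ[ZMod 2] Cochain K where
  toFun f := fun s => ∑ v ∈ s.1, Cochain.ext f (s.1.erase v)
  map_add' f g := by
    funext s; simp [Cochain.ext_add, Finset.sum_add_distrib]
  map_smul' c f := by
    funext s; simp [Cochain.ext_smul, Finset.mul_sum]

/-- The face of `s` spanned by its vertices up to `v`. -/
def frontFace {V : Type u} [LinearOrder V] (s : Finset V) (v : V) : Finset V := s.filter (· ≤ v)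

/-- The face of `s` spanned by its vertices from `v` on. -/
def backFace {V : Type u} [LinearOrder V] (s : Finset V) (v : V) : Finset V := s.filter (v ≤ ·)

/-- The cup product of cochains, with respect to the vertex order.  On a simplex
`{v₀ < ⋯ < vₘ}` it is the sum over `p` of `f {v₀, …, v_p} * g {v_p, …, v_m}`; for `f` of degree `p`
and `g` of degree `q` only the term of index `p` survives, and only if `m = p + q`. -/
noncomputable def cupCochain {V : Type u} [LinearOrder V] (K : PreAbstractSimplicialComplex V) :
    Cochain K →ₗ[ZMod 2] Cochain K →ₗ[ZMod 2] Cochain K :=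
  LinearMap.mk₂ (ZMod 2)
    (fun f g s => ∑ v ∈ s.1, Cochain.ext f (frontFace s.1 v) * Cochain.ext g (backFace s.1 v))
    (by intro f f' g; funext s; simp [Cochain.ext_add, add_mul, Finset.sum_add_distrib])
    (by intro c f g; funext s; simp [Cochain.ext_smul, mul_assoc, Finset.mul_sum])
    (by intro f g g'; funext s; simp [Cochain.ext_add, mul_add, Finset.sum_add_distrib])
    (by intro c f g; funext s; simp [Cochain.ext_smul, mul_left_comm, Finset.mul_sum])

/-- Cocycles. -/
noncomputable def cocycles {V : Type u} [LinearOrder V] (K : PreAbstractSimplicialComplex V) :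
    Submodule (ZMod 2) (Cochain K) := LinearMap.ker (coboundary K)

/-- Coboundaries, as a subspace of the space of cocycles. -/
noncomputable def coboundaries {V : Type u} [LinearOrder V] (K : PreAbstractSimplicialComplex V) :
    Submodule (ZMod 2) (cocycles K) := (LinearMap.range (coboundary K)).comap (cocycles K).subtype

/-- Total cohomology `H^*(K)`, the direct sum of all the `H^p(K)`. -/
abbrev Cohomology {V : Type u} [LinearOrder V] (K : PreAbstractSimplicialComplex V) : Type u :=
  (cocycles K) ⧸ (coboundaries K)

theorem sum_front_back {V : Type u} [LinearOrder V] (s : Finset V) :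
    ∀ h : Finset V → Finset V → ZMod 2,
      (∑ v ∈ s, h (s.filter (· < v)) (s.filter (v ≤ ·))) + h s ∅ =
        h ∅ s + ∑ v ∈ s, h (s.filter (· ≤ v)) (s.filter (v < ·)) := by
  induction s using Finset.induction_on_max with
  | empty => intro h; simp
  | insert a s ha ih =>
    intro h
    have hna : a ∉ s := fun h' => lt_irrefl _ (ha a h')
    have e := ih (fun A B => h A (insert a B))
    rw [Finset.sum_insert hna, Finset.sum_insert hna]
    have h1 : (insert a s).filter (· < a) = s := by
      ext w; simp only [Finset.mem_filter, Finset.mem_insert]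
      constructor
      · rintro ⟨rfl | h, h'⟩
        · exact absurd h' (lt_irrefl _)
        · exact h
      · intro h; exact ⟨Or.inr h, ha w h⟩
    have h2 : (insert a s).filter (a ≤ ·) = {a} := by
      ext w; simp only [Finset.mem_filter, Finset.mem_insert, Finset.mem_singleton]
      constructor
      · rintro ⟨rfl | h, h'⟩
        · rfl
        · exact absurd h' (not_le.2 (ha w h))
      · rintro rfl; exact ⟨Or.inl rfl, le_rfl⟩
    have h3 : (insert a s).filter (· ≤ a) = insert a s := by
      apply Finset.filter_true_of_mem
      intro w hw
      rcases Finset.mem_insert.1 hw with rfl | h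
      · exact le_rfl
      · exact (ha w h).le
    have h4 : (insert a s).filter (a < ·) = ∅ := by
      apply Finset.filter_false_of_mem
      intro w hw
      rcases Finset.mem_insert.1 hw with rfl | h
      · exact lt_irrefl _
      · exact not_lt.2 (ha w h).le
    have h5 : ∑ v ∈ s, h ((insert a s).filter (· < v)) ((insert a s).filter (v ≤ ·)) =
        ∑ v ∈ s, h (s.filter (· < v)) (insert a (s.filter (v ≤ ·))) := by
      refine Finset.sum_congr rfl fun v hv => ?_
      rw [Finset.filter_insert, Finset.filter_insert, if_neg (not_lt.2 (ha v hv).le),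
        if_pos (ha v hv).le]
    have h6 : ∑ v ∈ s, h ((insert a s).filter (· ≤ v)) ((insert a s).filter (v < ·)) =
        ∑ v ∈ s, h (s.filter (· ≤ v)) (insert a (s.filter (v < ·))) := by
      refine Finset.sum_congr rfl fun v hv => ?_
      rw [Finset.filter_insert, Finset.filter_insert, if_neg (not_le.2 (ha v hv)),
        if_pos (ha v hv)]
    rw [h1, h2, h3, h4, h5, h6]
    have e' : (∑ v ∈ s, h (s.filter (· < v)) (insert a (s.filter (v ≤ ·)))) + h s {a} =
        h ∅ (insert a s) + ∑ v ∈ s, h (s.filter (· ≤ v)) (insert a (s.filter (v < ·))) := e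
    linear_combination e'

/-- The Leibniz rule, which makes the cup product well defined on cohomology. -/
theorem coboundary_cup {V : Type u} [LinearOrder V] (K : PreAbstractSimplicialComplex V)
    (f g : Cochain K) :
    coboundary K (cupCochain K f g) =
      cupCochain K (coboundary K f) g + cupCochain K f (coboundary K g) := by
  funext s
  obtain ⟨s, hs⟩ := s
  have hsub : ∀ t ⊆ s, t.Nonempty → t ∈ K.faces := fun t ht hn => (K.isRelLowerSet_faces hs).2 ht hn
  set A := Cochain.ext f with hA
  set B := Cochain.ext g with hB
  have hA0 : A ∅ = 0 := Cochain.ext_empty f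
  have hB0 : B ∅ = 0 := Cochain.ext_empty g
  have hcup : ∀ t ⊆ s, Cochain.ext (cupCochain K f g) t =
      ∑ v ∈ t, A (t.filter (· ≤ v)) * B (t.filter (v ≤ ·)) := by
    intro t ht
    rcases t.eq_empty_or_nonempty with rfl | hn
    · simp [Cochain.ext_empty]
    · rw [Cochain.ext_coe _ (hsub t ht hn)]; rfl
  have hd : ∀ (e : Cochain K), ∀ t ⊆ s, Cochain.ext (coboundary K e) t =
      ∑ v ∈ t, Cochain.ext e (t.erase v) := by
    intro e t ht
    rcases t.eq_empty_or_nonempty with rfl | hn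
    · simp [Cochain.ext_empty]
    · rw [Cochain.ext_coe _ (hsub t ht hn)]; rfl
  have lhs : coboundary K (cupCochain K f g) ⟨s, hs⟩ =
      ∑ u ∈ s, ∑ v ∈ s.erase u,
        A ((s.erase u).filter (· ≤ v)) * B ((s.erase u).filter (v ≤ ·)) := by
    change ∑ u ∈ s, Cochain.ext (cupCochain K f g) (s.erase u) = _
    exact Finset.sum_congr rfl fun u _ => hcup _ (Finset.erase_subset _ _)
  have rhs1 : cupCochain K (coboundary K f) g ⟨s, hs⟩ =
      ∑ v ∈ s, ∑ u ∈ s.filter (· ≤ v), A ((s.filter (· ≤ v)).erase u) * B (s.filter (v ≤ ·)) := by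
    change ∑ v ∈ s, Cochain.ext (coboundary K f) (s.filter (· ≤ v)) * B (s.filter (v ≤ ·)) = _
    refine Finset.sum_congr rfl fun v _ => ?_
    rw [hd f _ (Finset.filter_subset _ _), Finset.sum_mul]
  have rhs2 : cupCochain K f (coboundary K g) ⟨s, hs⟩ =
      ∑ v ∈ s, ∑ u ∈ s.filter (v ≤ ·), A (s.filter (· ≤ v)) * B ((s.filter (v ≤ ·)).erase u) := by
    change ∑ v ∈ s, A (s.filter (· ≤ v)) * Cochain.ext (coboundary K g) (s.filter (v ≤ ·)) = _
    refine Finset.sum_congr rfl fun v _ => ?_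
    rw [hd g _ (Finset.filter_subset _ _), Finset.mul_sum]
  -- the diagonal terms
  have split1 : ∀ v ∈ s,
      ∑ u ∈ s.filter (· ≤ v), A ((s.filter (· ≤ v)).erase u) * B (s.filter (v ≤ ·)) =
      A (s.filter (· < v)) * B (s.filter (v ≤ ·)) +
      ∑ u ∈ s.filter (· < v), A ((s.filter (· ≤ v)).erase u) * B (s.filter (v ≤ ·)) := by
    intro v hv
    have h1 : s.filter (· ≤ v) = insert v (s.filter (· < v)) := by
      ext w; simp only [Finset.mem_filter, Finset.mem_insert]
      constructor
      · rintro ⟨h, h'⟩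
        rcases h'.eq_or_lt with rfl | h''
        · exact Or.inl rfl
        · exact Or.inr ⟨h, h''⟩
      · rintro (rfl | ⟨h, h'⟩)
        · exact ⟨hv, le_rfl⟩
        · exact ⟨h, h'.le⟩
    have h2 : v ∉ s.filter (· < v) := by simp
    have h3 : (s.filter (· ≤ v)).erase v = s.filter (· < v) := by
      rw [h1, Finset.erase_insert h2]
    conv_lhs => rw [Finset.sum_congr h1 (fun _ _ => rfl)]
    rw [Finset.sum_insert h2, h3]
  have split2 : ∀ v ∈ s,
      ∑ u ∈ s.filter (v ≤ ·), A (s.filter (· ≤ v)) * B ((s.filter (v ≤ ·)).erase u) =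
      A (s.filter (· ≤ v)) * B (s.filter (v < ·)) +
      ∑ u ∈ s.filter (v < ·), A (s.filter (· ≤ v)) * B ((s.filter (v ≤ ·)).erase u) := by
    intro v hv
    have h1 : s.filter (v ≤ ·) = insert v (s.filter (v < ·)) := by
      ext w; simp only [Finset.mem_filter, Finset.mem_insert]
      constructor
      · rintro ⟨h, h'⟩
        rcases h'.eq_or_lt with rfl | h''
        · exact Or.inl rfl
        · exact Or.inr ⟨h, h''⟩
      · rintro (rfl | ⟨h, h'⟩)
        · exact ⟨hv, le_rfl⟩
        · exact ⟨h, h'.le⟩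
    have h2 : v ∉ s.filter (v < ·) := by simp
    have h3 : (s.filter (v ≤ ·)).erase v = s.filter (v < ·) := by
      rw [h1, Finset.erase_insert h2]
    conv_lhs => rw [Finset.sum_congr h1 (fun _ _ => rfl)]
    rw [Finset.sum_insert h2, h3]
  have diag : ∑ v ∈ s, A (s.filter (· < v)) * B (s.filter (v ≤ ·)) =
      ∑ v ∈ s, A (s.filter (· ≤ v)) * B (s.filter (v < ·)) := by
    have := sum_front_back s (fun S T => A S * B T)
    simpa [hA0, hB0] using this
  -- the off-diagonal terms
  have off : ∑ u ∈ s, ∑ v ∈ s.erase u,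
        A ((s.erase u).filter (· ≤ v)) * B ((s.erase u).filter (v ≤ ·)) =
      (∑ v ∈ s, ∑ u ∈ s.filter (· < v),
        A ((s.filter (· ≤ v)).erase u) * B (s.filter (v ≤ ·))) +
      ∑ v ∈ s, ∑ u ∈ s.filter (v < ·),
        A (s.filter (· ≤ v)) * B ((s.filter (v ≤ ·)).erase u) := by
    have e1 : ∑ u ∈ s, ∑ v ∈ s.erase u,
          A ((s.erase u).filter (· ≤ v)) * B ((s.erase u).filter (v ≤ ·)) =
        ∑ v ∈ s, ∑ u ∈ s.erase v,
          A ((s.erase u).filter (· ≤ v)) * B ((s.erase u).filter (v ≤ ·)) := by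
      refine Finset.sum_comm' fun x y => ?_
      simp only [Finset.mem_erase]
      tauto
    rw [e1, ← Finset.sum_add_distrib]
    refine Finset.sum_congr rfl fun v hv => ?_
    have e2 : s.erase v = s.filter (· < v) ∪ s.filter (v < ·) := by
      ext w; simp only [Finset.mem_erase, Finset.mem_union, Finset.mem_filter, ne_iff_lt_or_gt]
      tauto
    have e3 : Disjoint (s.filter (· < v)) (s.filter (v < ·)) := by
      rw [Finset.disjoint_left]
      intro w h1 h2
      exact lt_asymm (Finset.mem_filter.1 h1).2 (Finset.mem_filter.1 h2).2
    rw [e2, Finset.sum_union e3]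
    congr 1
    · refine Finset.sum_congr rfl fun u hu => ?_
      have hu' := (Finset.mem_filter.1 hu).2
      rw [Finset.filter_erase, Finset.filter_erase,
        Finset.erase_eq_of_notMem (s := s.filter (v ≤ ·))]
      simp [hu']
    · refine Finset.sum_congr rfl fun u hu => ?_
      have hu' := (Finset.mem_filter.1 hu).2
      rw [Finset.filter_erase, Finset.filter_erase,
        Finset.erase_eq_of_notMem (s := s.filter (· ≤ v))]
      simp [hu']
  rw [Pi.add_apply, lhs, rhs1, rhs2, off, Finset.sum_congr rfl split1, Finset.sum_congr rfl split2,
    Finset.sum_add_distrib, Finset.sum_add_distrib, diag]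
  have two : ∀ x : ZMod 2, x + x = 0 := by decide
  linear_combination (-1 : ZMod 2) *
    two (∑ v ∈ s, A (s.filter (· ≤ v)) * B (s.filter (v < ·)))

theorem cup_mem_cocycles {V : Type u} [LinearOrder V] {K : PreAbstractSimplicialComplex V}
    {f g : Cochain K} (hf : f ∈ cocycles K) (hg : g ∈ cocycles K) :
    cupCochain K f g ∈ cocycles K := by
  have hf' : coboundary K f = 0 := hf
  have hg' : coboundary K g = 0 := hg
  change coboundary K (cupCochain K f g) = 0
  rw [coboundary_cup, hf', hg']
  simp

/-- The cup product of cocycles. -/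
noncomputable def cupCocycle {V : Type u} [LinearOrder V] (K : PreAbstractSimplicialComplex V) :
    cocycles K →ₗ[ZMod 2] cocycles K →ₗ[ZMod 2] cocycles K :=
  LinearMap.mk₂ (ZMod 2)
    (fun f g => ⟨cupCochain K f.1 g.1, cup_mem_cocycles f.2 g.2⟩)
    (by intro f f' g; ext1; simp)
    (by intro c f g; ext1; simp)
    (by intro f g g'; ext1; simp)
    (by intro c f g; ext1; simp)

theorem cupCocycle_right {V : Type u} [LinearOrder V] (K : PreAbstractSimplicialComplex V)
    (f : cocycles K) : coboundaries K ≤ (coboundaries K).comap (cupCocycle K f) := by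
  rintro g ⟨e, he⟩
  refine ⟨cupCochain K f.1 e, ?_⟩
  have hf : coboundary K f.1 = 0 := f.2
  rw [coboundary_cup, hf, he]
  simp [cupCocycle]

theorem cupCocycle_left {V : Type u} [LinearOrder V] (K : PreAbstractSimplicialComplex V)
    (f g : cocycles K) (hf : f ∈ coboundaries K) : cupCocycle K f g ∈ coboundaries K := by
  obtain ⟨e, he⟩ := hf
  refine ⟨cupCochain K e g.1, ?_⟩
  have hg : coboundary K g.1 = 0 := g.2
  rw [coboundary_cup, hg, he]
  simp [cupCocycle]

/-- The cup product `H^*(K) × H^*(K) → H^*(K)`. -/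
noncomputable def cup {V : Type u} [LinearOrder V] (K : PreAbstractSimplicialComplex V) :
    Cohomology K →ₗ[ZMod 2] Cohomology K →ₗ[ZMod 2] Cohomology K :=
  (coboundaries K).liftQ
    ((Submodule.mapQLinear (coboundaries K) (coboundaries K)).comp
      ((cupCocycle K).codRestrict (Submodule.compatibleMaps (coboundaries K) (coboundaries K))
        (cupCocycle_right K)))
    (by
      intro f hf
      rw [LinearMap.mem_ker]
      apply LinearMap.ext
      intro y
      obtain ⟨g, rfl⟩ := Submodule.Quotient.mk_surjective _ y
      exact (Submodule.Quotient.mk_eq_zero _).2 (cupCocycle_left K f g hf))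

theorem cup_mk {V : Type u} [LinearOrder V] (K : PreAbstractSimplicialComplex V)
    (f g : cocycles K) :
    cup K (Submodule.Quotient.mk f) (Submodule.Quotient.mk g) =
      Submodule.Quotient.mk (cupCocycle K f g) := rfl

/-- The positive-degree part `H^{>0}(K)` of the cohomology: the classes of the cocycles that vanish
on all vertices. -/
noncomputable def positivePart {V : Type u} [LinearOrder V] (K : PreAbstractSimplicialComplex V) :
    Submodule (ZMod 2) (Cohomology K) :=
  Submodule.span (ZMod 2)
    {x | ∃ z : cocycles K, (∀ s, s.1.card = 1 → z.1 s = 0) ∧ x = Submodule.Quotient.mk z}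

/-- Iterated cup product `α₁ ⌣ (α₂ ⌣ (⋯ ⌣ α_k))` of a list of classes (`0` for the empty list). -/
noncomputable def cupList {V : Type u} [LinearOrder V] (K : PreAbstractSimplicialComplex V) :
    List (Cohomology K) → Cohomology K
  | [] => 0
  | [a] => a
  | a :: b :: l => cup K a (cupList K (b :: l))

/-- The space of order-`k` products: the span of all `k`-fold cup products of classes of positive
degree, that is, the image of `H^{>0}(K)^{⊗ k} → H^*(K)`. -/
noncomputable def kCupSpace {V : Type u} [LinearOrder V] (K : PreAbstractSimplicialComplex V)
    (k : ℕ) : Submodule (ZMod 2) (Cohomology K) :=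
  Submodule.span (ZMod 2)
    {x | ∃ l : List (Cohomology K), l.length = k ∧ (∀ a ∈ l, a ∈ positivePart K) ∧
      x = cupList K l}

/-! ## Restriction to a subcomplex -/

/-- Restriction of cochains to a subcomplex. -/
def restrictCochain {V : Type u} {K L : PreAbstractSimplicialComplex V} (h : L ≤ K) :
    Cochain K →ₗ[ZMod 2] Cochain L where
  toFun f := fun s => f ⟨s.1, h s.2⟩
  map_add' _ _ := rfl
  map_smul' _ _ := rfl

theorem ext_restrict {V : Type u} {K L : PreAbstractSimplicialComplex V} (h : L ≤ K)
    (f : Cochain K) {s t : Finset V} (hs : s ∈ L.faces) (ht : t ⊆ s) :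
    Cochain.ext (restrictCochain h f) t = Cochain.ext f t := by
  rcases t.eq_empty_or_nonempty with rfl | hn
  · simp [Cochain.ext_empty]
  · have hL : t ∈ L.faces := (L.isRelLowerSet_faces hs).2 ht hn
    rw [Cochain.ext_coe _ hL, Cochain.ext_coe _ (h hL)]
    rfl

theorem coboundary_restrict {V : Type u} [LinearOrder V] {K L : PreAbstractSimplicialComplex V}
    (h : L ≤ K) (f : Cochain K) :
    coboundary L (restrictCochain h f) = restrictCochain h (coboundary K f) := by
  funext s
  change ∑ v ∈ s.1, _ = ∑ v ∈ s.1, _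
  exact Finset.sum_congr rfl fun v _ => ext_restrict h f s.2 (Finset.erase_subset _ _)

theorem cup_restrict {V : Type u} [LinearOrder V] {K L : PreAbstractSimplicialComplex V}
    (h : L ≤ K) (f g : Cochain K) :
    cupCochain L (restrictCochain h f) (restrictCochain h g) =
      restrictCochain h (cupCochain K f g) := by
  funext s
  change ∑ v ∈ s.1, _ = ∑ v ∈ s.1, _
  refine Finset.sum_congr rfl fun v _ => ?_
  exact congrArg₂ (· * ·) (ext_restrict h f s.2 (Finset.filter_subset _ _))
    (ext_restrict h g s.2 (Finset.filter_subset _ _))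

/-- Restriction of cocycles to a subcomplex. -/
noncomputable def restrictCocycle {V : Type u} [LinearOrder V]
    {K L : PreAbstractSimplicialComplex V} (h : L ≤ K) :
    cocycles K →ₗ[ZMod 2] cocycles L :=
  (restrictCochain h).restrict (by
    intro f hf
    have hf' : coboundary K f = 0 := hf
    change coboundary L (restrictCochain h f) = 0
    rw [coboundary_restrict, hf', map_zero])

/-- The map `H^*(K) → H^*(L)` induced by the inclusion of a subcomplex `L` of `K`. -/
noncomputable def restrictCohomology {V : Type u} [LinearOrder V]
    {K L : PreAbstractSimplicialComplex V} (h : L ≤ K) :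
    Cohomology K →ₗ[ZMod 2] Cohomology L :=
  (coboundaries K).mapQ (coboundaries L) (restrictCocycle h) (by
    rintro f ⟨e, he⟩
    exact ⟨restrictCochain h e, by rw [coboundary_restrict, he]; rfl⟩)

theorem restrictCohomology_cup {V : Type u} [LinearOrder V]
    {K L : PreAbstractSimplicialComplex V} (h : L ≤ K) (x y : Cohomology K) :
    restrictCohomology h (cup K x y) =
      cup L (restrictCohomology h x) (restrictCohomology h y) := by
  obtain ⟨f, rfl⟩ := Submodule.Quotient.mk_surjective _ x
  obtain ⟨g, rfl⟩ := Submodule.Quotient.mk_surjective _ y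
  refine congrArg Submodule.Quotient.mk (Subtype.ext ?_)
  exact (cup_restrict h f.1 g.1).symm

theorem restrictCohomology_positivePart {V : Type u} [LinearOrder V]
    {K L : PreAbstractSimplicialComplex V} (h : L ≤ K) {x : Cohomology K}
    (hx : x ∈ positivePart K) : restrictCohomology h x ∈ positivePart L := by
  have key : positivePart K ≤ (positivePart L).comap (restrictCohomology h) := by
    refine Submodule.span_le.2 ?_
    rintro _ ⟨z, hz, rfl⟩
    exact Submodule.subset_span ⟨restrictCocycle h z, fun s hs => hz ⟨s.1, h s.2⟩ hs, rfl⟩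
  exact key hx

theorem restrictCohomology_cupList {V : Type u} [LinearOrder V]
    {K L : PreAbstractSimplicialComplex V} (h : L ≤ K) (l : List (Cohomology K)) :
    restrictCohomology h (cupList K l) = cupList L (l.map (restrictCohomology h)) := by
  induction l with
  | nil => simp [cupList]
  | cons a l ih =>
    cases l with
    | nil => simp [cupList]
    | cons b l =>
      simp only [cupList, List.map_cons] at ih ⊢
      rw [restrictCohomology_cup, ih]

theorem restrictCohomology_kCupSpace {V : Type u} [LinearOrder V]
    {K L : PreAbstractSimplicialComplex V} (h : L ≤ K) (k : ℕ) {x : Cohomology K}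
    (hx : x ∈ kCupSpace K k) : restrictCohomology h x ∈ kCupSpace L k := by
  have key : kCupSpace K k ≤ (kCupSpace L k).comap (restrictCohomology h) := by
    refine Submodule.span_le.2 ?_
    rintro _ ⟨l, hl, hp, rfl⟩
    refine Submodule.subset_span ⟨l.map (restrictCohomology h), by simp [hl], ?_,
      restrictCohomology_cupList h l⟩
    intro a ha
    obtain ⟨b, hb, rfl⟩ := List.mem_map.1 ha
    exact restrictCohomology_positivePart h (hp b hb)
  exact key hx

/-! ## Persistence modules and barcodes -/

/-- A persistence module indexed by the opposite of `{0, …, n}`: vector spaces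
`M_n → M_{n-1} → ⋯ → M_0` over `ZMod 2`. -/
structure PersistenceModule (n : ℕ) where
  space : Fin (n + 1) → Type u
  [addCommGroup : ∀ i, AddCommGroup (space i)]
  [module : ∀ i, Module (ZMod 2) (space i)]
  map : ∀ i : Fin n, space i.succ →ₗ[ZMod 2] space i.castSucc

attribute [instance] PersistenceModule.addCommGroup PersistenceModule.module

/-- The bar `(d, b]`, given as the pair `(d, b)`, is alive at the indices `i` with `d < i ≤ b`. -/
def Alive (bar : ℕ × ℕ) (i : ℕ) : Prop := bar.1 < i ∧ i ≤ bar.2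

instance (bar : ℕ × ℕ) (i : ℕ) : Decidable (Alive bar i) :=
  inferInstanceAs (Decidable (_ ∧ _))

/-- The direct sum of the interval modules of a finite list of bars: at index `i` there is one copy
of `ZMod 2` for each bar that is alive at `i`, and the structure map is the identity on a copy
whose bar is alive at both indices, and zero otherwise. -/
def intervalSum (n : ℕ) (L : List (ℕ × ℕ)) : PersistenceModule.{0} n where
  space i := {j : Fin L.length // Alive (L.get j) i.val} → ZMod 2
  map i :=
    { toFun := fun c j =>
        if h : Alive (L.get j.1) i.succ.val then c ⟨j.1, h⟩ else 0
      map_add' := by intro c c'; funext j; dsimp only [Pi.add_apply]; split_ifs <;> simp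
      map_smul' := by
        intro r c; funext j; dsimp only [Pi.smul_apply, RingHom.id_apply]; split_ifs <;> simp }

/-- `L` lists the barcode of `M` (with multiplicities, in some order): `M` is isomorphic to the
direct sum of the interval modules of the nonempty intervals `(d, b]` in `L`. -/
def IsBarcode {n : ℕ} (M : PersistenceModule.{u} n) (L : List (ℕ × ℕ)) : Prop :=
  (∀ bar ∈ L, bar.1 < bar.2 ∧ bar.2 ≤ n) ∧
  ∃ e : ∀ i : Fin (n + 1), M.space i ≃ₗ[ZMod 2] (intervalSum n L).space i,
    ∀ (i : Fin n) (x : M.space i.succ),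
      e i.castSucc (M.map i x) = (intervalSum n L).map i (e i.succ x)

/-! ## Simplex-wise filtrations -/

/-- A simplex-wise filtration `∅ = K_0 ⊂ K_1 ⊂ ⋯ ⊂ K_n` of a complex with `n` simplices, given by the
order in which the simplices arrive: `simplex j` is the simplex of `K_{j+1}` that is not in
`K_j`. -/
structure SimplexwiseFiltration (V : Type u) (n : ℕ) where
  simplex : Fin n → Finset V
  nonempty : ∀ j, (simplex j).Nonempty
  injective : Function.Injective simplex
  face : ∀ j, ∀ t ⊆ simplex j, t.Nonempty → ∃ i ≤ j, simplex i = t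

namespace SimplexwiseFiltration

/-- The complex `K_i`. -/
def complex {V : Type u} {n : ℕ} (F : SimplexwiseFiltration V n) (i : ℕ) :
    PreAbstractSimplicialComplex V where
  faces := {s | ∃ j : Fin n, j.val < i ∧ F.simplex j = s}
  isRelLowerSet_faces := by
    rintro s ⟨j, hj, rfl⟩
    refine ⟨F.nonempty j, fun t ht hn => ?_⟩
    obtain ⟨i', hi, rfl⟩ := F.face j t ht hn
    exact ⟨i', lt_of_le_of_lt hi hj, rfl⟩

theorem complex_mono {V : Type u} {n : ℕ} (F : SimplexwiseFiltration V n) {i j : ℕ}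
    (h : i ≤ j) : F.complex i ≤ F.complex j := by
  rintro s ⟨l, hl, rfl⟩
  exact ⟨l, hl.trans_le h, rfl⟩

/-- The dimension of the final complex. -/
def dim {V : Type u} {n : ℕ} (F : SimplexwiseFiltration V n) : ℕ :=
  Finset.univ.sup fun j => (F.simplex j).card - 1

/-- The persistent `k`-cup module: the submodule of `H^*(K_•)` formed by the spaces of order-`k`
products, with the restrictions of the structure maps of `H^*(K_•)`. -/
noncomputable def kCupModule {V : Type u} [LinearOrder V] {n : ℕ} (F : SimplexwiseFiltration V n)
    (k : ℕ) : PersistenceModule.{u} n where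
  space i := kCupSpace (F.complex i.val) k
  addCommGroup i := inferInstanceAs (AddCommGroup (kCupSpace (F.complex i.val) k))
  module i := inferInstanceAs (Module (ZMod 2) (kCupSpace (F.complex i.val) k))
  map i := (restrictCohomology (F.complex_mono (Nat.le_succ i.val))).restrict
    (fun _ hx => restrictCohomology_kCupSpace _ k hx)

end SimplexwiseFiltration

/-! ## A step-counting model

Programs are written in a monad that carries a step counter.  One step is one elementary operation of
a unit-cost random access machine: an arithmetic operation or a comparison on indices, on entries in
`ZMod 2` or on vertices, or an access to an entry of an array.  Storing a second copy of an array of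
length `n`, so that rows of the copy can be zeroed out later, is charged `n` steps. -/

structure Timed (α : Type) where
  val : α
  time : ℕ

instance : Monad Timed where
  pure a := ⟨a, 0⟩
  bind x f := ⟨(f x.val).val, x.time + (f x.val).time⟩

/-- Spend `t` steps. -/
def tick (t : ℕ) : Timed Unit := ⟨(), t⟩

/-- A loop over a list that updates an accumulator; one step per round for the loop itself. -/
def foldT {α : Type u} {β : Type} (f : β → α → Timed β) : β → List α → Timed β
  | b, [] => pure b
  | b, a :: l => do
    tick 1
    let b' ← f b a
    foldT f b' l

/-- A loop over a list that collects results. -/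
def mapT {α : Type u} {β : Type} (f : α → Timed β) : List α → Timed (List β)
  | [] => pure []
  | a :: l => do
    tick 1
    let b ← f a
    let bs ← mapT f l
    pure (b :: bs)

/-- A loop over a list that keeps the entries that pass a constant-time test. -/
def filterT {α : Type} (p : α → Bool) : List α → Timed (List α)
  | [] => pure []
  | a :: l => do
    tick 3
    let bs ← filterT p l
    pure (if p a then a :: bs else bs)

/-- Fill an array of length `n`, entry by entry. -/
def tabulateT {n : ℕ} {α : Type} (f : Fin n → Timed α) : Timed (Fin n → α) :=
  ⟨fun i => (f i).val, ∑ i, ((f i).time + 1)⟩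

/-- An array with one entry for each of the `n` simplices (a cochain given by its support). -/
abbrev Vec (n : ℕ) := Fin n → ZMod 2

def addVec {n : ℕ} (x y : Vec n) : Timed (Vec n) :=
  tabulateT fun i => do
    tick 1
    pure (x i + y i)

/-- The largest index of a nonzero entry. -/
def lowVec {n : ℕ} (x : Vec n) : Timed (Option (Fin n)) :=
  foldT (fun acc i => do
    tick 1
    pure (if x i = 0 then acc else some i)) none (List.finRange n)

/-- Zero out row `l`: the restriction to `K_l` of a cochain of `K_{l+1}`. -/
def zeroRow {n : ℕ} (l : ℕ) (x : Vec n) : Timed (Vec n) := do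
  tick 1
  pure (fun j => if j.val = l then 0 else x j)

/-! ## Representatives -/

/-- A bar `(death, birth]` with a representative cocycle of degree `deg`. -/
structure BarRep (n : ℕ) where
  death : ℕ
  birth : ℕ
  deg : ℕ
  rep : Vec n

/-- The bars of a list of bar-representative pairs. -/
def barsOf {n : ℕ} (P : List (BarRep n)) : List (ℕ × ℕ) := P.map fun x => (x.death, x.birth)

namespace SimplexwiseFiltration

/-- The restriction to `K_i` of the cochain with support vector `x`. -/
def toCochain {V : Type u} [LinearOrder V] {n : ℕ} (F : SimplexwiseFiltration V n) (i : ℕ)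
    (x : Vec n) : Cochain (F.complex i) :=
  fun s => ∑ j, if F.simplex j = s.1 then x j else 0

open Classical in
/-- The class in `H^*(K_i)` of the restriction to `K_i` of a cochain (`0` unless this restriction is
a cocycle). -/
noncomputable def classAt {V : Type u} [LinearOrder V] {n : ℕ} (F : SimplexwiseFiltration V n)
    (i : ℕ) (x : Vec n) : Cohomology (F.complex i) :=
  if h : F.toCochain i x ∈ cocycles (F.complex i) then Submodule.Quotient.mk ⟨_, h⟩ else 0

/-- `P` is the barcode of `H^*(K_•)` together with a persistent cohomology basis: each bar `(d, b]`
comes with a homogeneous cocycle of `K_b` that is no longer a cocycle in `K_{b+1}`, its restrictions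
are trivial at the indices up to `d`, and at every index the classes of the restricted
representatives of the bars alive form a basis of the cohomology. -/
structure IsPersistentCohomologyBasis {V : Type u} [LinearOrder V] {n : ℕ}
    (F : SimplexwiseFiltration V n) (P : List (BarRep n)) : Prop where
  bar : ∀ x ∈ P, x.death < x.birth ∧ x.birth ≤ n
  support : ∀ x ∈ P, ∀ j : Fin n, x.rep j ≠ 0 → j.val < x.birth
  homogeneous : ∀ x ∈ P, ∀ j : Fin n, x.rep j ≠ 0 → (F.simplex j).card = x.deg + 1
  cocycle : ∀ x ∈ P, F.toCochain x.birth x.rep ∈ cocycles (F.complex x.birth)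
  not_cocycle : ∀ x ∈ P, x.birth < n →
    F.toCochain (x.birth + 1) x.rep ∉ cocycles (F.complex (x.birth + 1))
  trivial : ∀ x ∈ P, ∀ i ≤ x.death, F.classAt i x.rep = 0
  independent : ∀ i ≤ n, LinearIndependent (ZMod 2)
    fun j : {j : Fin P.length // Alive ((P.get j).death, (P.get j).birth) i} =>
      F.classAt i (P.get j.1).rep
  spanning : ∀ i ≤ n, Submodule.span (ZMod 2)
    {c | ∃ x ∈ P, Alive (x.death, x.birth) i ∧ c = F.classAt i x.rep} = ⊤

/-! ## Preprocessing of the input -/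

/-- The position of the simplex with vertex set `t` in the filtration, by linear search.  Vertex sets
are stored as sorted arrays; comparing two of them takes time linear in their sizes.  (The value
`j` is returned if there is no such simplex.) -/
def findSimplex {V : Type u} [LinearOrder V] {n : ℕ} (F : SimplexwiseFiltration V n) (j : Fin n)
    (t : Finset V) : Timed (Fin n) :=
  foldT (fun acc i => do
    tick ((F.simplex i).card + t.card + 1)
    pure (if F.simplex i = t then i else acc)) j (List.finRange n)

/-- For each simplex, the positions of the pairs (front face, back face) at its vertices. -/
def faceTable {V : Type u} [LinearOrder V] {n : ℕ} (F : SimplexwiseFiltration V n) :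
    Timed (Fin n → List (Fin n × Fin n)) :=
  tabulateT fun j => mapT (fun v => do
    tick (2 * (F.simplex j).card)
    let a ← F.findSimplex j (frontFace (F.simplex j) v)
    let b ← F.findSimplex j (backFace (F.simplex j) v)
    pure (a, b)) ((F.simplex j).sort (· ≤ ·))

/-- The coboundary matrix: column `j` is the coboundary of the indicator of simplex `j`. -/
def coboundaryMatrix {V : Type u} [LinearOrder V] {n : ℕ} (F : SimplexwiseFiltration V n) :
    Timed (Fin n → Vec n) :=
  tabulateT fun j => tabulateT fun i => do
    tick ((F.simplex i).card + (F.simplex j).card + 1)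
    pure (if F.simplex j ⊆ F.simplex i ∧ (F.simplex i).card = (F.simplex j).card + 1
      then 1 else 0)

/-! ## The barcode of ordinary cohomology -/

/-- The value on simplex `i` of the coboundary of `x`. -/
def evalCoboundary {n : ℕ} (D : Fin n → Vec n) (i : Fin n) (x : Vec n) : Timed (ZMod 2) :=
  foldT (fun acc j => do
    tick 2
    pure (acc + D j i * x j)) 0 (List.finRange n)

/-- One round of the persistent cohomology algorithm: simplex `i` arrives.  The state consists of the
live cocycles (their field `birth` is provisionally set to `n`), oldest first, and of the finished
bars.  If all live cocycles remain cocycles, the indicator of simplex `i` is a new one; otherwise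
the youngest one that does not is finished, and added to all the others that do not. -/
def pCohRound {V : Type u} [LinearOrder V] {n : ℕ} (F : SimplexwiseFiltration V n)
    (D : Fin n → Vec n) (st : List (BarRep n) × List (BarRep n)) (i : Fin n) :
    Timed (List (BarRep n) × List (BarRep n)) := do
  let live ← mapT (fun x => do
    let c ← evalCoboundary D i x.rep
    pure (x, c)) st.1
  let pivot ← foldT (fun acc p => do
    tick 1
    pure (if p.2 = 0 then acc else some p.1)) (none : Option (BarRep n)) live
  match pivot with
  | none => do
    let e ← tabulateT fun j => do
      tick 1
      pure (if j = i then (1 : ZMod 2) else 0)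
    tick 1
    pure (st.1 ++ [⟨i.val, n, (F.simplex i).card - 1, e⟩], st.2)
  | some y => do
    let live' ← foldT (fun acc p => do
      tick 2
      if p.2 = 0 then pure (acc ++ [p.1])
      else if p.1.death = y.death then pure acc
      else do
        let z ← addVec p.1.rep y.rep
        pure (acc ++ [{ p.1 with rep := z }])) [] live
    tick 1
    pure (live', st.2 ++ [{ y with birth := i.val }])

/-- The persistent cohomology algorithm: the barcode of `H^*(K_•)` with representatives. -/
def pCoh {V : Type u} [LinearOrder V] {n : ℕ} (F : SimplexwiseFiltration V n) :
    Timed (List (BarRep n)) := do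
  let D ← F.coboundaryMatrix
  let st ← foldT (F.pCohRound D) ([], []) (List.finRange n)
  tick n
  pure (st.2 ++ st.1)

end SimplexwiseFiltration

/-! ## Column operations on the matrix `S` -/

/-- A column of `S`: the current vector with the largest index `low` of a nonzero entry, and, for a
column that holds a product cocycle (as opposed to a coboundary), the annotation with its birth index
and its representative at birth.  The field `death` of the annotation is filled in when it dies. -/
structure Col (n : ℕ) where
  vec : Vec n
  low : Option (Fin n)
  tag : Option (BarRep n)

/-- Reduce `x` against the columns of `S`, from left to right: whenever the entry of `x` at the `low`
of a column is nonzero, that column is added to `x`. -/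
def reduceVec {n : ℕ} (S : List (Col n)) (x : Vec n) : Timed (Vec n) :=
  foldT (fun w c => do
    tick 1
    match c.low with
    | none => pure w
    | some r => if w r = 0 then pure w else addVec w c.vec) x S

/-- Reduce `S` with left-to-right column additions. -/
def reduceMatrix {n : ℕ} (S : List (Col n)) : Timed (List (Col n)) :=
  foldT (fun T c => do
    let w ← reduceVec T c.vec
    let r ← lowVec w
    pure (T ++ [⟨w, r, c.tag⟩])) [] S

/-- The cup product in `K_l` of two cochains of `K_l` given by their support vectors. -/
def cupVec {n : ℕ} (T : Fin n → List (Fin n × Fin n)) (l : ℕ) (x y : Vec n) : Timed (Vec n) :=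
  tabulateT fun j => do
    tick 1
    if j.val < l then
      foldT (fun acc p => do
        tick 2
        pure (acc + x p.1 * y p.2)) 0 (T j)
    else pure 0

/-- Form the cup product of two representatives at index `l`; if it is independent in the (reduced)
matrix `S`, append it, annotated with its birth index `l` and with itself as representative. -/
def tryProduct {n : ℕ} (T : Fin n → List (Fin n × Fin n)) (l : ℕ) (S : List (Col n))
    (x y : BarRep n) : Timed (List (Col n)) := do
  let z ← cupVec T l x.rep y.rep
  let w ← reduceVec S z
  let r ← lowVec w
  tick (n + 1)
  match r with
  | none => pure S
  | some r => pure (S ++ [⟨w, some r, some ⟨0, l, x.deg + y.deg, z⟩⟩])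

/-- The state of the main loop: the current representatives `H` for ordinary cohomology, those (`R`)
for the previous cup module (unused in `cupPers`), the matrix `S`, and the output so far. -/
structure CupState (n : ℕ) where
  H : List (BarRep n)
  R : List (BarRep n)
  S : List (Col n)
  out : List (BarRep n)

/-- Restrict everything to index `l` and reduce `S` again, so that `S` is reduced all the time. -/
def restrictState {n : ℕ} (l : ℕ) (st : CupState n) : Timed (CupState n) := do
  let H ← mapT (fun x => do
    let v ← zeroRow l x.rep
    pure { x with rep := v }) st.H
  let R ← mapT (fun x => do
    let v ← zeroRow l x.rep
    pure { x with rep := v }) st.R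
  let S ← mapT (fun c => do
    let v ← zeroRow l c.vec
    pure { c with vec := v }) st.S
  let S ← reduceMatrix S
  pure { st with H := H, R := R, S := S }

/-- The step for a death index: if `l` is the death index of a bar of `P` of positive degree, reduce
`S`, output a bar for each annotated column that is zeroed out and remove that column, and remove the
representatives from `H` and `R` whose bars die at `l`. -/
def deathStep {n : ℕ} (P : List (BarRep n)) (l : ℕ) (st : CupState n) : Timed (CupState n) := do
  let dying ← filterT (fun x => x.death = l ∧ 0 < x.deg) P
  if dying.isEmpty then pure st
  else do
    let S ← reduceMatrix st.S
    let zeroed ← filterT (fun c => c.low.isNone && c.tag.isSome) S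
    let S' ← filterT (fun c => !(c.low.isNone && c.tag.isSome)) S
    let out ← foldT (fun acc c => do
      tick 1
      match c.tag with
      | none => pure acc
      | some x => pure (acc ++ [{ x with death := l }])) st.out zeroed
    let H ← filterT (fun x => x.death ≠ l) st.H
    let R ← filterT (fun x => x.death ≠ l) st.R
    pure ⟨H, R, S', out⟩

/-- The indices `n, n - 1, …, 1`. -/
def descending (n : ℕ) : List ℕ := (List.range' 1 n).reverse

/-- The initial matrix `S`: the columns of the coboundary matrix. -/
def initialMatrix {n : ℕ} (D : Fin n → Vec n) : Timed (List (Col n)) :=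
  mapT (fun j => do
    let r ← lowVec (D j)
    pure ⟨D j, r, none⟩) (List.finRange n)

/-- CupPers: the barcode with representatives of the persistent (2-)cup module, from the face table
`T`, the coboundary matrix `D` and the barcode with representatives `P` of ordinary cohomology. -/
def cupPers {n : ℕ} (T : Fin n → List (Fin n × Fin n)) (D : Fin n → Vec n)
    (P : List (BarRep n)) : Timed (List (BarRep n)) := do
  let H ← filterT (fun x => x.birth = n ∧ 0 < x.deg) P
  tick (n * H.length)
  let S ← initialMatrix D
  let fin ← foldT (fun st l => do
    let st ← restrictState l st
    let born ← filterT (fun x => x.birth = l ∧ 0 < x.deg) P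
    let st ← foldT (fun (st : CupState n) x => do
      let H := if l = n then st.H else st.H ++ [x]
      tick (n + 1)
      let S ← foldT (fun S y => tryProduct T l S x y) st.S H
      pure { st with H := H, S := S }) st born
    deathStep P l st) (⟨H, [], S, []⟩ : CupState n) (descending n)
  pure fin.out

/-- The main loop of OrderkCupPers: from the barcode with representatives `Q` of the persistent
`(k-1)`-cup module, that of the persistent `k`-cup module. -/
def nextCupPers {n : ℕ} (T : Fin n → List (Fin n × Fin n)) (D : Fin n → Vec n)
    (P Q : List (BarRep n)) : Timed (List (BarRep n)) := do
  let H ← filterT (fun x => x.birth = n ∧ 0 < x.deg) P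
  let R ← filterT (fun x => x.birth = n) Q
  tick (n * (H.length + R.length))
  let S ← initialMatrix D
  let fin ← foldT (fun st l => do
    let st ← restrictState l st
    let born ← filterT (fun x => x.birth = l ∧ l ≠ n ∧ 0 < x.deg) P
    let st ← foldT (fun (st : CupState n) x => do
      tick (n + 1)
      let S ← foldT (fun S y => tryProduct T l S x y) st.S st.R
      pure { st with H := st.H ++ [x], S := S }) st born
    let born' ← filterT (fun x => x.birth = l) Q
    let st ← foldT (fun (st : CupState n) y => do
      tick (n + 1)
      let R := if l = n then st.R else st.R ++ [y]
      let S ← foldT (fun S x => tryProduct T l S y x) st.S st.H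
      pure { st with R := R, S := S }) st born'
    deathStep P l st) (⟨H, R, S, []⟩ : CupState n) (descending n)
  pure fin.out

/-- The recursion of OrderkCupPers (for `k = 1` the given barcode of ordinary cohomology is returned,
`k = 0` is not used). -/
def orderkRec {n : ℕ} (T : Fin n → List (Fin n × Fin n)) (D : Fin n → Vec n)
    (P : List (BarRep n)) : ℕ → Timed (List (BarRep n))
  | 0 => pure []
  | 1 => pure P
  | 2 => cupPers T D P
  | k + 3 => do
    let Q ← orderkRec T D P (k + 2)
    nextCupPers T D P Q

/-- The same recursion, in which the outputs of the recursive calls, for the orders `2, …, k`, are all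
kept. -/
def orderkRecAll {n : ℕ} (T : Fin n → List (Fin n × Fin n)) (D : Fin n → Vec n)
    (P : List (BarRep n)) : ℕ → Timed (List (List (BarRep n)))
  | 0 => pure []
  | 1 => pure []
  | 2 => do
    let B ← cupPers T D P
    pure [B]
  | k + 3 => do
    let Bs ← orderkRecAll T D P (k + 2)
    let B ← nextCupPers T D P (Bs.getLastD [])
    tick 1
    pure (Bs ++ [B])

namespace SimplexwiseFiltration

/-- The algorithm OrderkCupPers, with the barcode with representatives `P` of ordinary cohomology
given. -/
def orderkCupPers {V : Type u} [LinearOrder V] {n : ℕ} (F : SimplexwiseFiltration V n)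
    (P : List (BarRep n)) (k : ℕ) : Timed (List (BarRep n)) := do
  let T ← F.faceTable
  let D ← F.coboundaryMatrix
  orderkRec T D P k

/-- The computation, from the filtration alone, of the barcodes of all the persistent `k`-cup modules
for `k = 2, …, d`, where `d` is the dimension. -/
def allCupBarcodes {V : Type u} [LinearOrder V] {n : ℕ} (F : SimplexwiseFiltration V n) :
    Timed (List (List (BarRep n))) := do
  let P ← F.pCoh
  let T ← F.faceTable
  let D ← F.coboundaryMatrix
  let d ← foldT (fun d j => do
    tick 2
    pure (max d ((F.simplex j).card - 1))) 0 (List.finRange n)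
  orderkRecAll T D P d

end SimplexwiseFiltration

/-!
All computations are carried out in the space `Vec n` of support vectors. For each index `i` it has
the subspaces `Bc i ≤ Wc k i ≤ Zc i` of the vectors whose restriction to `K_i` is a coboundary, a
cocycle whose class is a sum of `k`-fold products, and a cocycle. All three shrink as `i` grows, and
the persistent `k`-cup module is `i ↦ Wc k i ⧸ Bc i`, with the maps induced by the inclusions.

*Certificates.* A list of bars with representatives is an `IsElderBasis` of `W` if at each index the
representatives alive form a basis of `W i ⧸ Bc i` and if every representative becomes, at its death,
a sum of representatives that are born at larger or equal indices and still alive. Subtracting this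
sum turns the representative into a generator of an interval summand; the change of basis is
triangular, so that the bars are the barcode (`IsElderBasis.isBarcode`). A persistent cohomology basis
is the special case in which the sums are empty, and its bars of positive degree form an elder basis
of `Wc 1` (`IsPersistentCohomologyBasis.isElderBasis_positiveBars`).

*The matrix.* Before index `l` is treated, the unannotated columns of `S` generate `Bc (l + 1)`, up
to entries outside `K_{l+1}`, and the annotated ones, modulo these, `Wc k (l + 1)`. After
restriction to `K_l` new products have to be added. By bilinearity only products of representatives of bars alive at `l` matter, and if both bars
are alive at `l + 1`, the product is one from `K_{l+1}`; so one factor is born at `l` (`Wc_succ_le`).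
As each product is tested in one order only, commutativity of the cup product up to a coboundary is
needed; it comes from Steenrod's cup-1 product (`coboundary_cupOne`). Left-to-right column additions
add older columns to younger ones, so that a column that is zeroed out shows its representative to be
a sum of older representatives that survive: this is the elder rule (`Represents.elder`,
`Certified.step`). Columns are looked at only at death indices of bars of positive degree; at all
other indices no class of positive degree dies, and hence no product either (`Wc_one_inf_Bc_le`). At
index `1` the complex is a point, so all bars have been output.

*The number of steps.* An elder basis has at most `n` bars, because each death index `d` contributes
at most `dim Bc d - dim Bc (d + 1)` of them (`IsElderBasis.length_le`). The matrix is kept reduced and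
has at most `3 n` columns: `n` coboundaries, at most `n` older annotated columns, and at most `n`
new ones, which are linearly independent. Hence a product is tested in `O(n²)` steps and the matrix
is reduced in `O(n³)` steps. Every bar is born once and then tested against at most `n` others, so
that each order `k` costs `O(n⁴)`.

*Ordinary cohomology.* When simplex `i` arrives, either all live cocycles extend and the indicator of
`i` is a new class (`PCohInv.push`), or the youngest one that does not is added to the others that do
not and is finished (`PCohInv.pivot`); its coboundary is the indicator of `i`, so no class is born.
-/

/-! ### The step-counting monad -/

namespace Timed

variable {α β : Type}

@[simp] theorem val_pure (a : α) : (pure a : Timed α).val = a := rfl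
@[simp] theorem time_pure (a : α) : (pure a : Timed α).time = 0 := rfl
@[simp] theorem val_bind (x : Timed α) (f : α → Timed β) : (x >>= f).val = (f x.val).val := rfl
@[simp] theorem time_bind (x : Timed α) (f : α → Timed β) :
    (x >>= f).time = x.time + (f x.val).time := rfl

end Timed

@[simp] theorem time_tick (t : ℕ) : (tick t).time = t := rfl

section Loops

variable {α β : Type}

theorem foldT_val {α : Type u} (f : β → α → Timed β) (b : β) (l : List α) :
    (foldT f b l).val = l.foldl (fun b a => (f b a).val) b := by
  induction l generalizing b with
  | nil => rfl
  | cons a l ih => exact ih _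

/-- Invariants of a loop, indexed by the part of the list that has been processed, together with a
bound on the number of steps. -/
theorem foldT_induction {α : Type u} {f : β → α → Timed β} {l : List α} {b : β}
    (I : List α → β → Prop) (t : α → ℕ) (h0 : I [] b)
    (hs : ∀ done a rest, l = done ++ a :: rest → ∀ b, I done b →
      I (done ++ [a]) (f b a).val ∧ (f b a).time ≤ t a) :
    I l (foldT f b l).val ∧ (foldT f b l).time ≤ (l.map fun a => t a + 1).sum := by
  suffices H : ∀ rest done b, l = done ++ rest → I done b →
      I l (foldT f b rest).val ∧ (foldT f b rest).time ≤ (rest.map fun a => t a + 1).sum from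
    H l [] b rfl h0
  intro rest
  induction rest with
  | nil =>
    intro done b h hb
    rw [List.append_nil] at h
    exact ⟨h ▸ hb, Nat.zero_le _⟩
  | cons a rest ih =>
    intro done b h hb
    obtain ⟨h1, h2⟩ := hs done a rest h b hb
    obtain ⟨h3, h4⟩ := ih (done ++ [a]) _ (by simp [h]) h1
    refine ⟨h3, ?_⟩
    have e : (foldT f b (a :: rest)).time =
        1 + ((f b a).time + (foldT f (f b a).val rest).time) := rfl
    rw [e, List.map_cons, List.sum_cons]
    omega

theorem foldT_time_le {α : Type u} {f : β → α → Timed β} {l : List α} (b : β) (t : ℕ)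
    (h : ∀ b, ∀ a ∈ l, (f b a).time ≤ t) : (foldT f b l).time ≤ l.length * (t + 1) := by
  have := (foldT_induction (f := f) (l := l) (b := b) (fun _ _ => True) (fun _ => t) trivial
    (fun done a rest e b _ => ⟨trivial, h b a (by simp [e])⟩)).2
  simpa using this

theorem descending_succ (n : ℕ) : descending (n + 1) = (n + 1) :: descending n := by
  unfold descending
  rw [List.range'_concat, List.reverse_append]
  simp [Nat.add_comm]

/-- Invariants of a loop over `n, n - 1, …, 1`; `I l` holds when the indices above `l` have been
processed. -/
theorem foldT_descending {f : β → ℕ → Timed β} (I : ℕ → β → Prop) (t : ℕ → ℕ) (n : ℕ) (b : β)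
    (h0 : I n b)
    (hs : ∀ l < n, ∀ b, I (l + 1) b → I l (f b (l + 1)).val ∧ (f b (l + 1)).time ≤ t (l + 1)) :
    I 0 (foldT f b (descending n)).val ∧
      (foldT f b (descending n)).time ≤ ((descending n).map fun l => t l + 1).sum := by
  induction n generalizing b with
  | zero => exact ⟨h0, Nat.zero_le _⟩
  | succ n ih =>
    obtain ⟨h1, h2⟩ := hs n (Nat.lt_succ_self n) b h0
    obtain ⟨h3, h4⟩ := ih _ h1 fun l hl => hs l (hl.trans (Nat.lt_succ_self n))
    rw [descending_succ]
    refine ⟨h3, ?_⟩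
    have e : (foldT f b ((n + 1) :: descending n)).time =
        1 + ((f b (n + 1)).time + (foldT f (f b (n + 1)).val (descending n)).time) := rfl
    rw [e, List.map_cons, List.sum_cons]
    omega

theorem mapT_val {α : Type u} (f : α → Timed β) (l : List α) :
    (mapT f l).val = l.map fun a => (f a).val := by
  induction l with
  | nil => rfl
  | cons a l ih => exact congrArg _ ih

theorem mapT_time_le {α : Type u} {f : α → Timed β} {l : List α} (t : ℕ) (h : ∀ a ∈ l, (f a).time ≤ t) :
    (mapT f l).time ≤ l.length * (t + 1) := by
  induction l with
  | nil => exact Nat.zero_le _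
  | cons a l ih =>
    have e : (mapT f (a :: l)).time = 1 + ((f a).time + ((mapT f l).time + 0)) := rfl
    have h1 := h a (by simp)
    have h2 := ih fun a ha => h a (by simp [ha])
    rw [e, List.length_cons, Nat.add_mul]
    omega

theorem filterT_val (p : α → Bool) (l : List α) : (filterT p l).val = l.filter p := by
  induction l with
  | nil => rfl
  | cons a l ih =>
    have e : (filterT p (a :: l)).val =
      if p a then a :: (filterT p l).val else (filterT p l).val := rfl
    rw [e, ih, List.filter_cons]

theorem filterT_time (p : α → Bool) (l : List α) : (filterT p l).time = 3 * l.length := by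
  induction l with
  | nil => rfl
  | cons a l ih =>
    have e : (filterT p (a :: l)).time = 3 + ((filterT p l).time + 0) := rfl
    rw [e, ih, List.length_cons]
    omega

theorem tabulateT_val {n : ℕ} (f : Fin n → Timed α) :
    (tabulateT f).val = fun i => (f i).val := rfl

theorem tabulateT_time_le {n : ℕ} {f : Fin n → Timed α} (t : ℕ) (h : ∀ i, (f i).time ≤ t) :
    (tabulateT f).time ≤ n * (t + 1) := by
  change ∑ i, ((f i).time + 1) ≤ _
  refine (Finset.sum_le_card_nsmul _ _ (t + 1) fun i _ => Nat.succ_le_succ (h i)).trans ?_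
  simp

end Loops

/-! ### Elementary operations on arrays -/

section Vectors

variable {n : ℕ}

theorem addVec_val (x y : Vec n) : (addVec x y).val = x + y := rfl

theorem addVec_time_le (x y : Vec n) : (addVec x y).time ≤ 2 * n :=
  (tabulateT_time_le 1 fun _ => le_rfl).trans (by omega)

theorem zeroRow_val (l : ℕ) (x : Vec n) :
    (zeroRow l x).val = fun j => if j.val = l then 0 else x j := rfl

theorem lowVec_time_le (x : Vec n) : (lowVec x).time ≤ 2 * n := by
  have := foldT_time_le (f := fun (acc : Option (Fin n)) i => do
    tick 1
    pure (if x i = 0 then acc else some i)) (l := List.finRange n) none 1 (fun _ _ _ => le_rfl)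
  rw [List.length_finRange] at this
  unfold lowVec
  omega

theorem foldl_last_eq {α : Type} (p : α → Prop) [DecidablePred p] (l : List α)
    (b : Option α) :
    l.foldl (fun acc i => if p i then acc else some i) b =
      (l.reverse.find? fun i => ¬ p i).or b := by
  induction l generalizing b with
  | nil => simp
  | cons a l ih =>
    rw [List.foldl_cons, ih, List.reverse_cons, List.find?_append]
    by_cases h : p a <;> cases (l.reverse.find? fun i => ¬ p i) <;> simp [h]

theorem lowVec_eq_none {x : Vec n} : (lowVec x).val = none ↔ x = 0 := by
  unfold lowVec
  rw [foldT_val]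
  change (List.finRange n).foldl (fun acc i => if x i = 0 then acc else some i) none = none ↔ _
  rw [foldl_last_eq (fun i => x i = 0)]
  simp [funext_iff]

theorem lowVec_eq_some {x : Vec n} {r : Fin n} (h : (lowVec x).val = some r) : x r ≠ 0 := by
  unfold lowVec at h
  rw [foldT_val] at h
  change (List.finRange n).foldl (fun acc i => if x i = 0 then acc else some i) none = some r at h
  rw [foldl_last_eq (fun i => x i = 0)] at h
  simp only [Option.or_none] at h
  simpa using List.find?_some h

end Vectors

/-! ### Linear independence of a list modulo a subspace -/

section ListSpan

variable {K E : Type*} [Field K] [AddCommGroup E] [Module K E]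

/-- The span of the entries of a list. -/
def spanL (K : Type*) {E : Type*} [Field K] [AddCommGroup E] [Module K E] (l : List E) :
    Submodule K E := Submodule.span K {x | x ∈ l}

theorem mem_spanL {l : List E} {x : E} (h : x ∈ l) : x ∈ spanL K l := Submodule.subset_span h

theorem spanL_le {l : List E} {W : Submodule K E} : spanL K l ≤ W ↔ ∀ x ∈ l, x ∈ W :=
  Submodule.span_le

theorem spanL_mono {l l' : List E} (h : ∀ x ∈ l, x ∈ l') : spanL K l ≤ spanL K l' :=
  Submodule.span_mono h

@[simp] theorem spanL_nil : spanL K ([] : List E) = ⊥ := by simp [spanL]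

theorem spanL_append (l l' : List E) : spanL K (l ++ l') = spanL K l ⊔ spanL K l' := by
  unfold spanL
  rw [← Submodule.span_union]
  congr 1
  ext x; simp

theorem spanL_cons (x : E) (l : List E) : spanL K (x :: l) = K ∙ x ⊔ spanL K l := by
  unfold spanL
  rw [← Submodule.span_union]
  congr 1
  ext y; simp

theorem spanL_perm {l l' : List E} (h : l.Perm l') : spanL K l = spanL K l' := by
  unfold spanL
  congr 1
  ext x; exact h.mem_iff

theorem sup_span_congr {X : Submodule K E} {x y : E} (h : x - y ∈ X) :
    X ⊔ K ∙ x = X ⊔ K ∙ y := by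
  apply le_antisymm
  · refine sup_le le_sup_left ((Submodule.span_singleton_le_iff_mem _ _).2 ?_)
    rw [← sub_add_cancel x y]
    exact add_mem (Submodule.mem_sup_left h)
      (Submodule.mem_sup_right (Submodule.mem_span_singleton_self y))
  · refine sup_le le_sup_left ((Submodule.span_singleton_le_iff_mem _ _).2 ?_)
    rw [← sub_sub_cancel x y]
    exact sub_mem (Submodule.mem_sup_right (Submodule.mem_span_singleton_self x))
      (Submodule.mem_sup_left h)

/-- The entries of the list `l` are linearly independent modulo `B` (with multiplicity). The
dimension count makes it evident that only `l.length` and `B ⊔ spanL K l` matter. -/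
def IndepMod (B : Submodule K E) (l : List E) : Prop :=
  Module.finrank K ↥(B ⊔ spanL K l) = Module.finrank K B + l.length

theorem indepMod_congr {B : Submodule K E} {l l' : List E} (h : B ⊔ spanL K l = B ⊔ spanL K l')
    (hl : l.length = l'.length) : IndepMod B l ↔ IndepMod B l' := by
  unfold IndepMod
  rw [h, hl]

theorem indepMod_perm {B : Submodule K E} {l l' : List E} (h : l.Perm l') :
    IndepMod B l ↔ IndepMod B l' :=
  indepMod_congr (by rw [spanL_perm h]) h.length_eq

@[simp] theorem indepMod_nil (B : Submodule K E) : IndepMod B ([] : List E) := by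
  rw [IndepMod, spanL_nil, sup_bot_eq, List.length_nil, Nat.add_zero]

variable [FiniteDimensional K E]

theorem finrank_sup_span_singleton_le (W : Submodule K E) (x : E) :
    Module.finrank K ↥(W ⊔ K ∙ x) ≤ Module.finrank K W + 1 :=
  (Submodule.finrank_add_le_finrank_add_finrank W (K ∙ x)).trans
    (Nat.add_le_add_left ((finrank_span_le_card {x}).trans (by simp)) _)

theorem finrank_sup_spanL_le (B : Submodule K E) (l : List E) :
    Module.finrank K ↥(B ⊔ spanL K l) ≤ Module.finrank K B + l.length := by
  induction l with
  | nil => rw [spanL_nil, sup_bot_eq, List.length_nil, Nat.add_zero]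
  | cons x l ih =>
    have e : B ⊔ spanL K (x :: l) = (B ⊔ spanL K l) ⊔ K ∙ x := by
      rw [spanL_cons, sup_comm (K ∙ x), sup_assoc]
    rw [e, List.length_cons]
    have := finrank_sup_span_singleton_le (B ⊔ spanL K l) x
    omega

theorem indepMod_cons {B : Submodule K E} {x : E} {l : List E} :
    IndepMod B (x :: l) ↔ x ∉ B ⊔ spanL K l ∧ IndepMod B l := by
  have e : B ⊔ spanL K (x :: l) = (B ⊔ spanL K l) ⊔ K ∙ x := by
    rw [spanL_cons, sup_comm (K ∙ x), sup_assoc]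
  have h1 := finrank_sup_span_singleton_le (B ⊔ spanL K l) x
  have h2 := finrank_sup_spanL_le B l
  unfold IndepMod
  rw [e, List.length_cons]
  constructor
  · intro h
    refine ⟨fun hx => ?_, by omega⟩
    rw [sup_eq_left.2 ((Submodule.span_singleton_le_iff_mem _ _).2 hx)] at h
    omega
  · rintro ⟨hx, h⟩
    have h3 : B ⊔ spanL K l < (B ⊔ spanL K l) ⊔ K ∙ x := by
      refine lt_of_le_of_ne le_sup_left fun h' => hx ?_
      rw [h']
      exact Submodule.mem_sup_right (Submodule.mem_span_singleton_self x)
    have := Submodule.finrank_lt_finrank_of_lt h3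
    omega

theorem indepMod_append_singleton {B : Submodule K E} {x : E} {l : List E} :
    IndepMod B (l ++ [x]) ↔ x ∉ B ⊔ spanL K l ∧ IndepMod B l := by
  rw [← indepMod_cons]
  exact indepMod_perm (List.perm_append_singleton x l)

theorem IndepMod.of_append_left {B : Submodule K E} {l l' : List E} (h : IndepMod B (l' ++ l)) :
    IndepMod B l := by
  induction l' with
  | nil => exact h
  | cons x l' ih => exact ih (indepMod_cons.1 h).2

theorem IndepMod.of_append_right {B : Submodule K E} {l l' : List E}
    (h : IndepMod B (l ++ l')) : IndepMod B l :=
  IndepMod.of_append_left ((indepMod_perm List.perm_append_comm).1 h)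

theorem IndepMod.sublist {B : Submodule K E} {l l' : List E} (h : IndepMod B l)
    (hl : l'.Sublist l) : IndepMod B l' := by
  obtain ⟨l'', hl''⟩ := hl.exists_perm_append
  exact ((indepMod_perm hl'').1 h).of_append_right

theorem IndepMod.mono {B B' : Submodule K E} {l : List E} (hB : B ≤ B') (h : IndepMod B' l) :
    IndepMod B l := by
  induction l with
  | nil => simp
  | cons x l ih =>
    obtain ⟨h1, h2⟩ := indepMod_cons.1 h
    exact indepMod_cons.2 ⟨fun hx => h1 (sup_le_sup_right hB _ hx), ih h2⟩

theorem IndepMod.disjoint {B : Submodule K E} {l : List E} (h : IndepMod B l) :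
    Disjoint B (spanL K l) := by
  have h1 := Submodule.finrank_sup_add_finrank_inf_eq B (spanL K l)
  have h2 := finrank_sup_spanL_le (⊥ : Submodule K E) l
  rw [bot_sup_eq, finrank_bot] at h2
  unfold IndepMod at h
  rw [disjoint_iff, ← Submodule.finrank_eq_zero (R := K)]
  omega

/-- Enlarging the subspace keeps a list independent as long as no new relation appears in a
subspace `W` that contains the list. -/
theorem IndepMod.of_inf_le {B B' W : Submodule K E} {l : List E} (h : IndepMod B l)
    (hl : ∀ x ∈ l, x ∈ W) (hW : W ⊓ B' ≤ B) : IndepMod B' l := by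
  induction l with
  | nil => simp
  | cons x l ih =>
    obtain ⟨h1, h2⟩ := indepMod_cons.1 h
    refine indepMod_cons.2 ⟨fun hx => h1 ?_, ih h2 fun y hy => hl y (by simp [hy])⟩
    obtain ⟨b, hb, s, hs, rfl⟩ := Submodule.mem_sup.1 hx
    refine Submodule.add_mem_sup (hW ⟨?_, hb⟩) hs
    have hs' : s ∈ W := spanL_le.2 (fun y hy => hl y (by simp [hy])) hs
    simpa using sub_mem (hl (b + s) (by simp)) hs'

theorem IndepMod.length_le {B : Submodule K E} {l : List E} (h : IndepMod B l) :
    l.length ≤ Module.finrank K E := by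
  have := Submodule.finrank_le (B ⊔ spanL K l)
  unfold IndepMod at h
  omega

theorem IndepMod.eq_nil {B : Submodule K E} {l : List E} (h : IndepMod B l)
    (hl : ∀ x ∈ l, x ∈ B) : l = [] := by
  cases l with
  | nil => rfl
  | cons x l => exact absurd (Submodule.mem_sup_left (hl x (by simp))) (indepMod_cons.1 h).1

end ListSpan

/-! ### Commutativity of the cup product on cohomology -/

section CupOne

variable {V : Type u} [LinearOrder V]

/-- Steenrod's cup-1 product.  On a simplex `{v₀ < ⋯ < vₘ}` it is the sum over `i < j` of
`f {v₀, …, v_i, v_j, …, v_m} * g {v_i, …, v_j}`. -/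
noncomputable def cupOne (K : PreAbstractSimplicialComplex V) (f g : Cochain K) : Cochain K :=
  fun s => ∑ u ∈ s.1, ∑ v ∈ s.1.filter (u < ·),
    Cochain.ext f (s.1.filter fun w => w ≤ u ∨ v ≤ w) *
      Cochain.ext g (s.1.filter fun w => u ≤ w ∧ w ≤ v)

theorem sum_sum_filter_lt_comm {M : Type*} [AddCommMonoid M] (s : Finset V) (G : V → V → M) :
    ∑ u ∈ s, ∑ v ∈ s.filter (u < ·), G u v = ∑ v ∈ s, ∑ u ∈ s.filter (· < v), G u v := by
  refine Finset.sum_comm' fun u v => ?_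
  simp only [Finset.mem_filter]
  tauto

theorem zmod2_eq_of_add_eq_zero {x y : ZMod 2} (h : x + y = 0) : x = y := by
  revert x y; decide

/-- Pairs of terms in the coboundary of the cup-1 product in which the lower vertex moves. -/
theorem sum_cupOne_lower (s : Finset V) (A B : Finset V → ZMod 2) (v : V) (hv : v ∈ s) :
    (∑ u ∈ s.filter (· < v), A (s.filter fun w => w < u ∨ v ≤ w) *
        B (s.filter fun w => u ≤ w ∧ w ≤ v)) + A s * B {v} =
      A (s.filter (v ≤ ·)) * B (s.filter (· ≤ v)) +
        ∑ u ∈ s.filter (· < v), A (s.filter fun w => w ≤ u ∨ v ≤ w) *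
          B (s.filter fun w => u < w ∧ w ≤ v) := by
  have h := sum_front_back (s.filter (· < v))
    (fun P Q => A (P ∪ s.filter (v ≤ ·)) * B (insert v Q))
  have e1 : (s.filter (· < v)) ∪ s.filter (v ≤ ·) = s := by
    ext w; simp only [Finset.mem_union, Finset.mem_filter]
    have := lt_or_ge w v
    tauto
  have e2 : insert v (s.filter (· < v)) = s.filter (· ≤ v) := by
    ext w; simp only [Finset.mem_insert, Finset.mem_filter, le_iff_lt_or_eq]
    constructor
    · rintro (rfl | h)
      · exact ⟨hv, Or.inr rfl⟩
      · exact ⟨h.1, Or.inl h.2⟩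
    · rintro ⟨h, h' | rfl⟩
      · exact Or.inr ⟨h, h'⟩
      · exact Or.inl rfl
  rw [e1, e2, Finset.empty_union, LawfulSingleton.insert_empty_eq] at h
  rw [← Finset.sum_congr rfl fun u hu => ?_, h]
  · congr 1
    refine Finset.sum_congr rfl fun u hu => ?_
    obtain ⟨hus, huv⟩ := Finset.mem_filter.1 hu
    congr 2
    · ext w; simp only [Finset.mem_union, Finset.mem_filter]
      have : w ≤ u → w < v := fun h => h.trans_lt huv
      tauto
    · ext w; simp only [Finset.mem_insert, Finset.mem_filter]
      constructor
      · rintro (rfl | h)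
        · exact ⟨hv, huv, le_rfl⟩
        · exact ⟨h.1.1, h.2, h.1.2.le⟩
      · rintro ⟨h1, h2, h3⟩
        rcases h3.eq_or_lt with rfl | h3
        · exact Or.inl rfl
        · exact Or.inr ⟨⟨h1, h3⟩, h2⟩
  · obtain ⟨hus, huv⟩ := Finset.mem_filter.1 hu
    congr 2
    · ext w; simp only [Finset.mem_union, Finset.mem_filter]
      have : w < u → w < v := fun h => h.trans huv
      tauto
    · ext w; simp only [Finset.mem_insert, Finset.mem_filter]
      constructor
      · rintro (rfl | h)
        · exact ⟨hv, huv.le, le_rfl⟩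
        · exact ⟨h.1.1, h.2, h.1.2.le⟩
      · rintro ⟨h1, h2, h3⟩
        rcases h3.eq_or_lt with rfl | h3
        · exact Or.inl rfl
        · exact Or.inr ⟨⟨h1, h3⟩, h2⟩

/-- Pairs of terms in the coboundary of the cup-1 product in which the upper vertex moves. -/
theorem sum_cupOne_upper (s : Finset V) (A B : Finset V → ZMod 2) (u : V) (hu : u ∈ s) :
    (∑ v ∈ s.filter (u < ·), A (s.filter fun w => w ≤ u ∨ v ≤ w) *
        B (s.filter fun w => u ≤ w ∧ w < v)) + A (s.filter (· ≤ u)) * B (s.filter (u ≤ ·)) =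
      A s * B {u} +
        ∑ v ∈ s.filter (u < ·), A (s.filter fun w => w ≤ u ∨ v < w) *
          B (s.filter fun w => u ≤ w ∧ w ≤ v) := by
  have h := sum_front_back (s.filter (u < ·))
    (fun P Q => A (s.filter (· ≤ u) ∪ Q) * B (insert u P))
  have e1 : (s.filter (· ≤ u)) ∪ s.filter (u < ·) = s := by
    ext w; simp only [Finset.mem_union, Finset.mem_filter]
    have := le_or_gt w u
    tauto
  have e2 : insert u (s.filter (u < ·)) = s.filter (u ≤ ·) := by
    ext w; simp only [Finset.mem_insert, Finset.mem_filter, le_iff_lt_or_eq]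
    constructor
    · rintro (rfl | h)
      · exact ⟨hu, Or.inr rfl⟩
      · exact ⟨h.1, Or.inl h.2⟩
    · rintro ⟨h, h' | rfl⟩
      · exact Or.inr ⟨h, h'⟩
      · exact Or.inl rfl
  rw [e1, e2, Finset.union_empty, LawfulSingleton.insert_empty_eq] at h
  rw [← Finset.sum_congr rfl fun v hv => ?_, h]
  · congr 1
    refine Finset.sum_congr rfl fun v hv => ?_
    obtain ⟨hvs, huv⟩ := Finset.mem_filter.1 hv
    congr 2
    · ext w; simp only [Finset.mem_union, Finset.mem_filter]
      have : v < w → u < w := fun h => huv.trans h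
      tauto
    · ext w; simp only [Finset.mem_insert, Finset.mem_filter]
      constructor
      · rintro (rfl | h)
        · exact ⟨hu, le_rfl, huv.le⟩
        · exact ⟨h.1.1, h.1.2.le, h.2⟩
      · rintro ⟨h1, h2, h3⟩
        rcases h2.eq_or_lt with rfl | h2
        · exact Or.inl rfl
        · exact Or.inr ⟨⟨h1, h2⟩, h3⟩
  · obtain ⟨hvs, huv⟩ := Finset.mem_filter.1 hv
    congr 2
    · ext w; simp only [Finset.mem_union, Finset.mem_filter]
      have : v ≤ w → u < w := fun h => huv.trans_le h
      tauto
    · ext w; simp only [Finset.mem_insert, Finset.mem_filter]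
      constructor
      · rintro (rfl | h)
        · exact ⟨hu, le_rfl, huv⟩
        · exact ⟨h.1.1, h.1.2.le, h.2⟩
      · rintro ⟨h1, h2, h3⟩
        rcases h2.eq_or_lt with rfl | h2
        · exact Or.inl rfl
        · exact Or.inr ⟨⟨h1, h2⟩, h3⟩

/-- If the sum of `A` over the facets of `t` vanishes, then the facets opposite to two chosen
vertices account for all the others. -/
theorem sum_erase_eq {A : Finset V → ZMod 2} {t : Finset V} {u v : V} (hu : u ∈ t) (hv : v ∈ t)
    (huv : u ≠ v) (h : ∑ w ∈ t, A (t.erase w) = 0) :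
    ∑ w ∈ (t.erase u).erase v, A (t.erase w) = A (t.erase u) + A (t.erase v) := by
  rw [← Finset.add_sum_erase _ _ hu,
    ← Finset.add_sum_erase _ _ (Finset.mem_erase.2 ⟨huv.symm, hv⟩), ← add_assoc] at h
  exact (zmod2_eq_of_add_eq_zero h).symm

/-- The cup product of two cocycles commutes up to a coboundary. -/
theorem coboundary_cupOne (K : PreAbstractSimplicialComplex V) {f g : Cochain K}
    (hf : f ∈ cocycles K) (hg : g ∈ cocycles K) :
    coboundary K (cupOne K f g) = cupCochain K f g + cupCochain K g f := by
  funext s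
  obtain ⟨s, hs⟩ := s
  have hsub : ∀ t ⊆ s, t.Nonempty → t ∈ K.faces := fun t ht hn => (K.isRelLowerSet_faces hs).2 ht hn
  set A := Cochain.ext f with hA
  set B := Cochain.ext g with hB
  have hd : ∀ e ∈ cocycles K, ∀ t ⊆ s, t.Nonempty → ∑ w ∈ t, Cochain.ext e (t.erase w) = 0 :=
    fun e he t ht hn => congrFun (LinearMap.mem_ker.1 he) ⟨t, hsub t ht hn⟩
  have lhs : coboundary K (cupOne K f g) ⟨s, hs⟩ =
      ∑ w ∈ s, ∑ u ∈ s.erase w, ∑ v ∈ (s.erase w).filter (u < ·),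
        A ((s.erase w).filter fun x => x ≤ u ∨ v ≤ x) *
          B ((s.erase w).filter fun x => u ≤ x ∧ x ≤ v) := by
    change ∑ w ∈ s, Cochain.ext (cupOne K f g) (s.erase w) = _
    refine Finset.sum_congr rfl fun w _ => ?_
    rcases (s.erase w).eq_empty_or_nonempty with h | h
    · rw [h]; simp [Cochain.ext_empty]
    · rw [Cochain.ext_coe _ (hsub _ (Finset.erase_subset _ _) h)]; rfl
  have swap : ∀ G : V → V → V → ZMod 2,
      ∑ w ∈ s, ∑ u ∈ s.erase w, ∑ v ∈ (s.erase w).filter (u < ·), G w u v =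
        ∑ u ∈ s, ∑ v ∈ s.filter (u < ·), ∑ w ∈ (s.erase u).erase v, G w u v := by
    intro G
    have e1 : ∑ w ∈ s, ∑ u ∈ s.erase w, ∑ v ∈ (s.erase w).filter (u < ·), G w u v =
        ∑ u ∈ s, ∑ w ∈ s.erase u, ∑ v ∈ (s.erase w).filter (u < ·), G w u v := by
      refine Finset.sum_comm' fun x y => ?_
      simp only [Finset.mem_erase]
      tauto
    rw [e1]
    refine Finset.sum_congr rfl fun u _ => ?_
    refine Finset.sum_comm' fun x y => ?_
    simp only [Finset.mem_erase, Finset.mem_filter]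
    have : x ≠ y ↔ y ≠ x := ne_comm
    tauto
  -- For fixed `u < v`, removing a vertex outside `[u, v]` affects only the factor `A`, removing
  -- one strictly between `u` and `v` only the factor `B`.
  have inner : ∀ u ∈ s, ∀ v ∈ s.filter (u < ·), ∑ w ∈ (s.erase u).erase v,
        A ((s.erase w).filter fun x => x ≤ u ∨ v ≤ x) *
          B ((s.erase w).filter fun x => u ≤ x ∧ x ≤ v) =
      (A (s.filter fun x => x < u ∨ v ≤ x) * B (s.filter fun x => u ≤ x ∧ x ≤ v) +
        A (s.filter fun x => x ≤ u ∨ v < x) * B (s.filter fun x => u ≤ x ∧ x ≤ v)) +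
      (A (s.filter fun x => x ≤ u ∨ v ≤ x) * B (s.filter fun x => u < x ∧ x ≤ v) +
        A (s.filter fun x => x ≤ u ∨ v ≤ x) * B (s.filter fun x => u ≤ x ∧ x < v)) := by
    intro u hu v hv
    obtain ⟨hv, huv⟩ := Finset.mem_filter.1 hv
    set a := s.filter fun x => x ≤ u ∨ v ≤ x with ha
    set b := s.filter fun x => u ≤ x ∧ x ≤ v with hb
    have hua : u ∈ a := Finset.mem_filter.2 ⟨hu, Or.inl le_rfl⟩
    have hva : v ∈ a := Finset.mem_filter.2 ⟨hv, Or.inr le_rfl⟩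
    have hub : u ∈ b := Finset.mem_filter.2 ⟨hu, le_rfl, huv.le⟩
    have hvb : v ∈ b := Finset.mem_filter.2 ⟨hv, huv.le, le_rfl⟩
    have sa := sum_erase_eq hua hva huv.ne (hd f hf a (Finset.filter_subset _ _) ⟨u, hua⟩)
    have sb := sum_erase_eq hub hvb huv.ne (hd g hg b (Finset.filter_subset _ _) ⟨u, hub⟩)
    have split : (s.erase u).erase v = (a.erase u).erase v ∪ (b.erase u).erase v := by
      ext w; simp only [Finset.mem_erase, Finset.mem_union, ha, hb, Finset.mem_filter]
      have h1 := le_total w u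
      have h2 := le_total w v
      tauto
    have disj : Disjoint ((a.erase u).erase v) ((b.erase u).erase v) := by
      rw [Finset.disjoint_left]
      intro w h1 h2
      simp only [Finset.mem_erase, ha, hb, Finset.mem_filter] at h1 h2
      rcases h1.2.2.2 with h | h
      · exact h1.2.1 (le_antisymm h h2.2.2.2.1)
      · exact h1.1 (le_antisymm h2.2.2.2.2 h)
    rw [split, Finset.sum_union disj]
    congr 1
    · rw [show (A (s.filter fun x => x < u ∨ v ≤ x)) = A (a.erase u) from congrArg A ?_,
        show (A (s.filter fun x => x ≤ u ∨ v < x)) = A (a.erase v) from congrArg A ?_,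
        ← add_mul, ← sa, Finset.sum_mul]
      · refine Finset.sum_congr rfl fun w hw => ?_
        simp only [Finset.mem_erase, ha, Finset.mem_filter] at hw
        rw [Finset.filter_erase, Finset.filter_erase, Finset.erase_eq_of_notMem (s := b)]
        rw [hb, Finset.mem_filter]
        rintro ⟨_, h1, h2⟩
        rcases hw.2.2.2 with h | h
        · exact hw.2.1 (le_antisymm h h1)
        · exact hw.1 (le_antisymm h2 h)
      · ext w; simp only [Finset.mem_erase, ha, Finset.mem_filter, lt_iff_le_and_ne]
        have : v ≤ w → w ≠ v ∨ w = v := fun _ => ne_or_eq w v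
        constructor
        · rintro ⟨h, h' | ⟨h', h''⟩⟩
          · refine ⟨?_, h, Or.inl h'⟩
            rintro rfl; exact absurd (lt_of_lt_of_le huv h') (lt_irrefl _)
          · exact ⟨h''.symm, h, Or.inr h'⟩
        · rintro ⟨h1, h, h' | h'⟩
          · exact ⟨h, Or.inl h'⟩
          · exact ⟨h, Or.inr ⟨h', Ne.symm h1⟩⟩
      · ext w; simp only [Finset.mem_erase, ha, Finset.mem_filter, lt_iff_le_and_ne]
        constructor
        · rintro ⟨h, ⟨h', h''⟩ | h'⟩
          · exact ⟨h'', h, Or.inl h'⟩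
          · refine ⟨?_, h, Or.inr h'⟩
            rintro rfl; exact absurd (lt_of_lt_of_le huv h') (lt_irrefl _)
        · rintro ⟨h1, h, h' | h'⟩
          · exact ⟨h, Or.inl ⟨h', h1⟩⟩
          · exact ⟨h, Or.inr h'⟩
    · rw [show (B (s.filter fun x => u < x ∧ x ≤ v)) = B (b.erase u) from congrArg B ?_,
        show (B (s.filter fun x => u ≤ x ∧ x < v)) = B (b.erase v) from congrArg B ?_,
        ← mul_add, ← sb, Finset.mul_sum]
      · refine Finset.sum_congr rfl fun w hw => ?_
        simp only [Finset.mem_erase, hb, Finset.mem_filter] at hw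
        rw [Finset.filter_erase, Finset.filter_erase, Finset.erase_eq_of_notMem (s := a)]
        rw [ha, Finset.mem_filter]
        rintro ⟨_, h | h⟩
        · exact hw.2.1 (le_antisymm h hw.2.2.2.1)
        · exact hw.1 (le_antisymm hw.2.2.2.2 h)
      · ext w; simp only [Finset.mem_erase, hb, Finset.mem_filter, lt_iff_le_and_ne]
        tauto
      · ext w; simp only [Finset.mem_erase, hb, Finset.mem_filter, lt_iff_le_and_ne, ne_comm]
        tauto
  have rhs : (cupCochain K f g + cupCochain K g f) ⟨s, hs⟩ =
      (∑ v ∈ s, A (s.filter (· ≤ v)) * B (s.filter (v ≤ ·))) +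
        ∑ v ∈ s, B (s.filter (· ≤ v)) * A (s.filter (v ≤ ·)) := rfl
  rw [lhs, swap, rhs, Finset.sum_congr rfl fun u hu => Finset.sum_congr rfl (inner u hu)]
  simp only [Finset.sum_add_distrib]
  have h1 := Finset.sum_congr (rfl : s = s) (sum_cupOne_lower s A B)
  have h2 := Finset.sum_congr (rfl : s = s) (sum_cupOne_upper s A B)
  simp only [Finset.sum_add_distrib] at h1 h2
  rw [← sum_sum_filter_lt_comm, ← sum_sum_filter_lt_comm] at h1
  have h3 : ∑ v ∈ s, B (s.filter (· ≤ v)) * A (s.filter (v ≤ ·)) =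
      ∑ v ∈ s, A (s.filter (v ≤ ·)) * B (s.filter (· ≤ v)) :=
    Finset.sum_congr rfl fun v _ => mul_comm _ _
  rw [h3]
  have two : ∀ a b c d x y z : ZMod 2, a + x = y + b → c + z = x + d → a + d + (b + c) = z + y := by
    decide
  exact two _ _ _ _ _ _ _ h1 h2

end CupOne

/-! ### Cochains of the filtration as vectors -/

namespace SimplexwiseFiltration

variable {V : Type u} {n : ℕ} (F : SimplexwiseFiltration V n)

theorem simplex_mem {i : ℕ} {j : Fin n} (h : j.val < i) : F.simplex j ∈ (F.complex i).faces :=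
  ⟨j, h, rfl⟩

theorem card_simplex_le (j : Fin n) : (F.simplex j).card ≤ n := by
  have h : ∀ v : F.simplex j, ∃ i, F.simplex i = {v.1} := fun v => by
    obtain ⟨i, _, hi⟩ := F.face j {v.1} (by simp) (Finset.singleton_nonempty _)
    exact ⟨i, hi⟩
  choose f hf using h
  have hinj : Function.Injective f := by
    intro a b hab
    have := (hf a).symm.trans ((congrArg F.simplex hab).trans (hf b))
    exact Subtype.ext (Finset.singleton_injective this)
  simpa using Fintype.card_le_of_injective f hinj

theorem cochain_ext {i : ℕ} {f g : Cochain (F.complex i)}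
    (h : ∀ (j : Fin n) (hj : j.val < i), f ⟨F.simplex j, F.simplex_mem hj⟩ =
      g ⟨F.simplex j, F.simplex_mem hj⟩) : f = g := by
  funext ⟨s, j, hj, hs⟩
  subst hs
  exact h j hj

variable [LinearOrder V]

theorem toCochain_simplex (i : ℕ) (x : Vec n) {j : Fin n} (h : F.simplex j ∈ (F.complex i).faces) :
    F.toCochain i x ⟨F.simplex j, h⟩ = x j := by
  change ∑ k, (if F.simplex k = F.simplex j then x k else 0) = x j
  simp [F.injective.eq_iff]

/-- `toCochain` as a linear map. -/
def toCochainL (i : ℕ) : Vec n →ₗ[ZMod 2] Cochain (F.complex i) where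
  toFun := F.toCochain i
  map_add' x y := by
    refine F.cochain_ext fun j hj => ?_
    rw [Pi.add_apply, toCochain_simplex, toCochain_simplex, toCochain_simplex, Pi.add_apply]
  map_smul' c x := by
    refine F.cochain_ext fun j hj => ?_
    rw [RingHom.id_apply, Pi.smul_apply, toCochain_simplex, toCochain_simplex, Pi.smul_apply]

theorem toCochainL_apply (i : ℕ) (x : Vec n) : F.toCochainL i x = F.toCochain i x := rfl

theorem toCochain_eq_iff {i : ℕ} {x y : Vec n} :
    F.toCochain i x = F.toCochain i y ↔ ∀ j : Fin n, j.val < i → x j = y j := by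
  constructor
  · intro h j hj
    rw [← F.toCochain_simplex i x (F.simplex_mem hj), h, toCochain_simplex]
  · intro h
    refine F.cochain_ext fun j hj => ?_
    rw [toCochain_simplex, toCochain_simplex, h j hj]

theorem toCochainL_surjective (i : ℕ) : Function.Surjective (F.toCochainL i) := by
  intro f
  refine ⟨fun j => Cochain.ext f (F.simplex j), ?_⟩
  refine F.cochain_ext fun j hj => ?_
  rw [toCochainL_apply, toCochain_simplex, Cochain.ext_coe]

instance (i : ℕ) : FiniteDimensional (ZMod 2) (Cochain (F.complex i)) :=
  Module.Finite.of_surjective (F.toCochainL i) (F.toCochainL_surjective i)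

/-- The vectors that vanish on the simplices of `K_i`. -/
def tail (n i : ℕ) : Submodule (ZMod 2) (Vec n) where
  carrier := {x | ∀ j : Fin n, j.val < i → x j = 0}
  add_mem' hx hy j hj := by rw [Pi.add_apply, hx j hj, hy j hj, add_zero]
  zero_mem' _ _ := rfl
  smul_mem' c x hx j hj := by rw [Pi.smul_apply, hx j hj, smul_zero]

theorem mem_tail {i : ℕ} {x : Vec n} : x ∈ tail n i ↔ ∀ j : Fin n, j.val < i → x j = 0 := Iff.rfl

theorem tail_anti {i j : ℕ} (h : i ≤ j) : tail n j ≤ tail n i :=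
  fun _ hx k hk => hx k (hk.trans_le h)

theorem sub_mem_tail {i : ℕ} {x y : Vec n} :
    x - y ∈ tail n i ↔ ∀ j : Fin n, j.val < i → x j = y j := by
  simp only [mem_tail, Pi.sub_apply, sub_eq_zero]

theorem toCochain_congr {i : ℕ} {x y : Vec n} (h : x - y ∈ tail n i) :
    F.toCochain i x = F.toCochain i y := F.toCochain_eq_iff.2 (sub_mem_tail.1 h)

/-- The coboundary operator on vectors: multiplication by the coboundary matrix. -/
noncomputable def dl : Vec n →ₗ[ZMod 2] Vec n where
  toFun x := fun i => ∑ j, F.coboundaryMatrix.val j i * x j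
  map_add' x y := by funext i; simp [mul_add, Finset.sum_add_distrib]
  map_smul' c x := by funext i; simp [Finset.mul_sum, mul_left_comm]

theorem dl_apply (x : Vec n) (i : Fin n) :
    F.dl x i = ∑ j, F.coboundaryMatrix.val j i * x j := rfl

theorem coboundaryMatrix_val (j i : Fin n) : F.coboundaryMatrix.val j i =
    if F.simplex j ⊆ F.simplex i ∧ (F.simplex i).card = (F.simplex j).card + 1 then 1 else 0 := rfl

theorem coboundaryMatrix_eq_zero {j i : Fin n} (h : i ≤ j) : F.coboundaryMatrix.val j i = 0 := by
  rw [coboundaryMatrix_val, if_neg]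
  rintro ⟨h1, h2⟩
  obtain ⟨k, hk, he⟩ := F.face i _ h1 (F.nonempty j)
  have : k = j := F.injective he
  subst this
  rw [le_antisymm h hk] at h2
  omega

theorem ext_toCochain {i : ℕ} (x : Vec n) {t s : Finset V} (hs : s ∈ (F.complex i).faces)
    (ht : t ⊆ s) :
    Cochain.ext (F.toCochain i x) t = ∑ k, if F.simplex k = t then x k else 0 := by
  rcases t.eq_empty_or_nonempty with rfl | hn
  · rw [Cochain.ext_empty]
    exact (Finset.sum_eq_zero fun k _ => if_neg (F.nonempty k).ne_empty).symm
  · rw [Cochain.ext_coe _ (((F.complex i).isRelLowerSet_faces hs).2 ht hn)]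
    rfl

theorem sum_facets (s t : Finset V) (c : ZMod 2) :
    ∑ v ∈ s, (if t = s.erase v then c else 0) =
      if t ⊆ s ∧ s.card = t.card + 1 then c else 0 := by
  split_ifs with h
  · obtain ⟨v, hv, rfl⟩ := Finset.exists_eq_insert_iff.2 ⟨h.1, h.2.symm⟩
    rw [Finset.sum_eq_single v]
    · rw [Finset.erase_insert hv, if_pos rfl]
    · intro w _ hwv
      rw [if_neg]
      intro he
      apply hv
      rw [he]
      exact Finset.mem_erase.2 ⟨hwv.symm, Finset.mem_insert_self _ _⟩
    · exact fun h => absurd (Finset.mem_insert_self _ _) h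
  · refine Finset.sum_eq_zero fun v hv => if_neg ?_
    rintro rfl
    exact h ⟨Finset.erase_subset _ _, (Finset.card_erase_add_one hv).symm⟩

theorem toCochain_dl (i : ℕ) (x : Vec n) :
    F.toCochain i (F.dl x) = coboundary (F.complex i) (F.toCochain i x) := by
  refine F.cochain_ext fun j hj => ?_
  rw [toCochain_simplex]
  change _ = ∑ v ∈ F.simplex j, Cochain.ext (F.toCochain i x) ((F.simplex j).erase v)
  rw [Finset.sum_congr rfl fun v _ =>
    F.ext_toCochain x (F.simplex_mem hj) (Finset.erase_subset v (F.simplex j)),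
    Finset.sum_comm, dl_apply]
  refine Finset.sum_congr rfl fun k _ => ?_
  rw [sum_facets, coboundaryMatrix_val]
  split_ifs <;> simp

theorem dl_eq_of_tail {x : Vec n} {i : Fin n} (h : x ∈ tail n i) : F.dl x i = 0 := by
  rw [dl_apply]
  refine Finset.sum_eq_zero fun j _ => ?_
  rcases lt_or_ge j i with hj | hj
  · rw [h j hj, mul_zero]
  · rw [F.coboundaryMatrix_eq_zero hj, zero_mul]

/-- The vectors whose restriction to `K_i` is a cocycle. -/
noncomputable def Zc (i : ℕ) : Submodule (ZMod 2) (Vec n) :=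
  (cocycles (F.complex i)).comap (F.toCochainL i)

/-- The vectors whose restriction to `K_i` is a coboundary. -/
noncomputable def Bc (i : ℕ) : Submodule (ZMod 2) (Vec n) :=
  (LinearMap.range (coboundary (F.complex i))).comap (F.toCochainL i)

theorem mem_Zc {i : ℕ} {x : Vec n} :
    x ∈ F.Zc i ↔ ∀ j : Fin n, j.val < i → F.dl x j = 0 := by
  change coboundary _ (F.toCochain i x) = 0 ↔ _
  rw [← toCochain_dl, ← map_zero (F.toCochainL i), toCochainL_apply, toCochain_eq_iff]
  rfl

theorem mem_Zc_iff_toCochain {i : ℕ} {x : Vec n} :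
    x ∈ F.Zc i ↔ F.toCochain i x ∈ cocycles (F.complex i) := Iff.rfl

theorem mem_Bc {i : ℕ} {x : Vec n} : x ∈ F.Bc i ↔ ∃ e, x - F.dl e ∈ tail n i := by
  constructor
  · rintro ⟨f, hf⟩
    obtain ⟨e, rfl⟩ := F.toCochainL_surjective i f
    refine ⟨e, sub_mem_tail.2 (F.toCochain_eq_iff.1 ?_)⟩
    rw [toCochain_dl]
    exact hf.symm
  · rintro ⟨e, he⟩
    refine ⟨F.toCochain i e, ?_⟩
    rw [← toCochain_dl]
    exact (F.toCochain_congr he).symm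

theorem Bc_eq (i : ℕ) : F.Bc i = LinearMap.range F.dl ⊔ tail n i := by
  ext x
  rw [mem_Bc, Submodule.mem_sup]
  constructor
  · rintro ⟨e, he⟩
    exact ⟨F.dl e, ⟨e, rfl⟩, _, he, by abel⟩
  · rintro ⟨_, ⟨e, rfl⟩, t, ht, rfl⟩
    exact ⟨e, by simpa using ht⟩

theorem tail_le_Bc (i : ℕ) : tail n i ≤ F.Bc i := by
  rw [Bc_eq]; exact le_sup_right

theorem Bc_anti {i j : ℕ} (h : i ≤ j) : F.Bc j ≤ F.Bc i := by
  rw [Bc_eq, Bc_eq]; exact sup_le_sup_left (tail_anti h) _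

theorem Bc_sup_tail {i j : ℕ} (h : i ≤ j) : F.Bc j ⊔ tail n i = F.Bc i := by
  rw [Bc_eq, Bc_eq, sup_assoc, sup_eq_right.2 (tail_anti h)]

theorem coboundary_comp (K : PreAbstractSimplicialComplex V) (f : Cochain K) :
    coboundary K (coboundary K f) = 0 := by
  funext ⟨s, hs⟩
  have h1 : coboundary K (coboundary K f) ⟨s, hs⟩ =
      ∑ v ∈ s, ∑ w ∈ s.erase v, Cochain.ext f ((s.erase v).erase w) := by
    change ∑ v ∈ s, Cochain.ext (coboundary K f) (s.erase v) = _
    refine Finset.sum_congr rfl fun v _ => ?_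
    rcases (s.erase v).eq_empty_or_nonempty with h | h
    · rw [h]; simp [Cochain.ext_empty]
    · rw [Cochain.ext_coe _ ((K.isRelLowerSet_faces hs).2 (Finset.erase_subset _ _) h)]; rfl
  rw [h1, Finset.sum_sigma']
  refine Finset.sum_involution (fun p _ => ⟨p.2, p.1⟩) ?_ ?_ ?_ ?_
  · rintro ⟨v, w⟩ _
    dsimp only
    rw [Finset.erase_right_comm]
    exact CharTwo.add_self_eq_zero _
  · rintro ⟨v, w⟩ h _ he
    simp only [Finset.mem_sigma, Finset.mem_erase] at h
    exact h.2.1 (congrArg Sigma.fst he)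
  · rintro ⟨v, w⟩ h
    simp only [Finset.mem_sigma, Finset.mem_erase] at h ⊢
    exact ⟨h.2.2, h.2.1.symm, h.1⟩
  · rintro ⟨v, w⟩ _
    rfl

theorem Bc_le_Zc (i : ℕ) : F.Bc i ≤ F.Zc i := by
  rintro x ⟨f, hf⟩
  change coboundary _ (F.toCochainL i x) = 0
  rw [← hf, coboundary_comp]

theorem Zc_anti {i j : ℕ} (h : i ≤ j) : F.Zc j ≤ F.Zc i := by
  intro x hx
  rw [mem_Zc] at hx ⊢
  exact fun k hk => hx k (hk.trans_le h)

theorem Bc_zero : F.Bc 0 = ⊤ :=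
  eq_top_iff.2 fun _ _ => F.tail_le_Bc 0 fun _ hj => absurd hj (Nat.not_lt_zero _)

/-- The cohomology class in `K_i` of a vector that restricts to a cocycle of `K_i`. -/
noncomputable def cls (i : ℕ) : F.Zc i →ₗ[ZMod 2] Cohomology (F.complex i) :=
  (coboundaries (F.complex i)).mkQ ∘ₗ (F.toCochainL i).submoduleComap (cocycles (F.complex i))

theorem classAt_eq_cls {i : ℕ} {x : Vec n} (h : x ∈ F.Zc i) :
    F.classAt i x = F.cls i ⟨x, h⟩ := dif_pos h

theorem classAt_eq_mk {i : ℕ} {x : Vec n} (h : F.toCochain i x ∈ cocycles (F.complex i)) :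
    F.classAt i x = Submodule.Quotient.mk ⟨F.toCochain i x, h⟩ := dif_pos h

theorem cls_surjective (i : ℕ) : Function.Surjective (F.cls i) := by
  intro c
  obtain ⟨⟨f, hf⟩, rfl⟩ := Submodule.Quotient.mk_surjective _ c
  obtain ⟨x, rfl⟩ := F.toCochainL_surjective i f
  exact ⟨⟨x, hf⟩, rfl⟩

theorem exists_classAt_eq {i : ℕ} (c : Cohomology (F.complex i)) :
    ∃ x ∈ F.Zc i, F.classAt i x = c := by
  obtain ⟨x, rfl⟩ := F.cls_surjective i c
  exact ⟨x.1, x.2, F.classAt_eq_cls x.2⟩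

theorem classAt_eq_zero {i : ℕ} {x : Vec n} (h : x ∈ F.Zc i) :
    F.classAt i x = 0 ↔ x ∈ F.Bc i := by
  rw [classAt_eq_mk F h, Submodule.Quotient.mk_eq_zero]
  exact Iff.rfl

theorem classAt_of_mem_Bc {i : ℕ} {x : Vec n} (h : x ∈ F.Bc i) : F.classAt i x = 0 :=
  (F.classAt_eq_zero (F.Bc_le_Zc i h)).2 h

theorem classAt_eq_classAt {i : ℕ} {x y : Vec n} (hx : x ∈ F.Zc i) (hy : y ∈ F.Zc i) :
    F.classAt i x = F.classAt i y ↔ x - y ∈ F.Bc i := by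
  rw [← F.classAt_eq_zero (sub_mem hx hy), F.classAt_eq_cls hx, F.classAt_eq_cls hy,
    F.classAt_eq_cls (sub_mem hx hy), ← sub_eq_zero, ← map_sub]
  rfl

theorem restrict_classAt {i j : ℕ} (hij : i ≤ j) {x : Vec n} (hx : x ∈ F.Zc j) :
    restrictCohomology (F.complex_mono hij) (F.classAt j x) = F.classAt i x := by
  rw [F.classAt_eq_mk hx, F.classAt_eq_mk (F.Zc_anti hij hx)]
  rfl

/-- The vectors that restrict to a cocycle of `K_i` with class in `X`. -/
noncomputable def liftSub (i : ℕ) (X : Submodule (ZMod 2) (Cohomology (F.complex i))) :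
    Submodule (ZMod 2) (Vec n) := (X.comap (F.cls i)).map (F.Zc i).subtype

theorem mem_liftSub {i : ℕ} {X : Submodule (ZMod 2) (Cohomology (F.complex i))} {x : Vec n} :
    x ∈ F.liftSub i X ↔ x ∈ F.Zc i ∧ F.classAt i x ∈ X := by
  constructor
  · rintro ⟨⟨x, hx⟩, h, rfl⟩
    exact ⟨hx, (F.classAt_eq_cls hx).symm ▸ h⟩
  · rintro ⟨hx, h⟩
    exact ⟨⟨x, hx⟩, by rwa [F.classAt_eq_cls hx] at h, rfl⟩

theorem Bc_le_liftSub (i : ℕ) (X : Submodule (ZMod 2) (Cohomology (F.complex i))) :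
    F.Bc i ≤ F.liftSub i X := fun _ hx =>
  F.mem_liftSub.2 ⟨F.Bc_le_Zc i hx, by rw [F.classAt_of_mem_Bc hx]; exact zero_mem _⟩

theorem liftSub_top (i : ℕ) : F.liftSub i ⊤ = F.Zc i := by
  ext x; simp [mem_liftSub]

theorem finrank_liftSub (i : ℕ) (X : Submodule (ZMod 2) (Cohomology (F.complex i))) :
    Module.finrank (ZMod 2) (F.liftSub i X) =
      Module.finrank (ZMod 2) (F.Bc i) + Module.finrank (ZMod 2) X := by
  have h1 := LinearMap.finrank_range_add_finrank_ker ((F.cls i).submoduleComap X)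
  have h2 : LinearMap.range ((F.cls i).submoduleComap X) = ⊤ := by
    rw [LinearMap.range_eq_top]
    rintro ⟨c, hc⟩
    obtain ⟨x, rfl⟩ := F.cls_surjective i c
    exact ⟨⟨x, hc⟩, rfl⟩
  have h3 : Module.finrank (ZMod 2) (LinearMap.ker ((F.cls i).submoduleComap X)) =
      Module.finrank (ZMod 2) (F.Bc i) := by
    let g : LinearMap.ker ((F.cls i).submoduleComap X) →ₗ[ZMod 2] Vec n :=
      (F.Zc i).subtype ∘ₗ (X.comap (F.cls i)).subtype ∘ₗ
        (LinearMap.ker ((F.cls i).submoduleComap X)).subtype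
    have hg : Function.Injective g := by
      intro a b h
      exact Subtype.ext (Subtype.ext (Subtype.ext h))
    have hr : LinearMap.range g = F.Bc i := by
      ext x
      constructor
      · rintro ⟨⟨⟨⟨y, hy⟩, h1⟩, h2⟩, rfl⟩
        have h4 : F.cls i ⟨y, hy⟩ = 0 := congrArg Subtype.val h2
        rw [← F.classAt_eq_cls, F.classAt_eq_zero hy] at h4
        exact h4
      · intro hx
        have h4 : F.cls i ⟨x, F.Bc_le_Zc i hx⟩ = 0 := by
          rw [← F.classAt_eq_cls, F.classAt_of_mem_Bc hx]
        exact ⟨⟨⟨⟨x, F.Bc_le_Zc i hx⟩, by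
          rw [Submodule.mem_comap, h4]; exact zero_mem _⟩, Subtype.ext h4⟩, rfl⟩
    rw [← hr, LinearMap.finrank_range_of_inj hg]
  have h4 : Module.finrank (ZMod 2) (F.liftSub i X) =
      Module.finrank (ZMod 2) (X.comap (F.cls i)) :=
    (LinearEquiv.finrank_eq (Submodule.equivMapOfInjective _ (F.Zc i).subtype_injective _)).symm
  rw [h2, finrank_top, h3] at h1
  rw [h4, ← h1, Nat.add_comm]

/-! ### Cup products of vectors -/

/-- The cup product in `K_i` on vectors. -/
noncomputable def cupE (i : ℕ) : Vec n →ₗ[ZMod 2] Vec n →ₗ[ZMod 2] Vec n :=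
  LinearMap.mk₂ (ZMod 2)
    (fun x y j => Cochain.ext (cupCochain (F.complex i) (F.toCochainL i x) (F.toCochainL i y))
      (F.simplex j))
    (by intro x x' y; funext j; simp [Cochain.ext_add])
    (by intro c x y; funext j; simp [Cochain.ext_smul])
    (by intro x y y'; funext j; simp [Cochain.ext_add])
    (by intro c x y; funext j; simp [Cochain.ext_smul])

theorem cupE_apply (i : ℕ) (x y : Vec n) (j : Fin n) : F.cupE i x y j =
    Cochain.ext (cupCochain (F.complex i) (F.toCochain i x) (F.toCochain i y)) (F.simplex j) := rfl

theorem toCochain_cupE (i : ℕ) (x y : Vec n) : F.toCochain i (F.cupE i x y) =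
    cupCochain (F.complex i) (F.toCochain i x) (F.toCochain i y) := by
  refine F.cochain_ext fun j hj => ?_
  rw [toCochain_simplex, cupE_apply, Cochain.ext_coe]

theorem cupE_support {i : ℕ} (x y : Vec n) {j : Fin n} (h : i ≤ j.val) : F.cupE i x y j = 0 := by
  rw [cupE_apply]
  unfold Cochain.ext
  rw [dif_neg]
  rintro ⟨k, hk, he⟩
  have := F.injective he
  subst this
  omega

theorem cupE_congr {i : ℕ} {x x' y y' : Vec n} (hx : x - x' ∈ tail n i) (hy : y - y' ∈ tail n i) :
    F.cupE i x y = F.cupE i x' y' := by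
  funext j
  rw [cupE_apply, cupE_apply, F.toCochain_congr hx, F.toCochain_congr hy]

theorem cupE_restrict {i j : ℕ} (hij : i ≤ j) (x y : Vec n) :
    F.cupE j x y - F.cupE i x y ∈ tail n i := by
  rw [sub_mem_tail, ← F.toCochain_eq_iff, toCochain_cupE]
  have h : ∀ z, F.toCochain i z = restrictCochain (F.complex_mono hij) (F.toCochain j z) :=
    fun z => rfl
  rw [h, h, h, toCochain_cupE, cup_restrict]

theorem cupE_mem_Zc {i : ℕ} {x y : Vec n} (hx : x ∈ F.Zc i) (hy : y ∈ F.Zc i) :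
    F.cupE i x y ∈ F.Zc i := by
  rw [mem_Zc_iff_toCochain, toCochain_cupE]
  exact cup_mem_cocycles hx hy

theorem classAt_cupE {i : ℕ} {x y : Vec n} (hx : x ∈ F.Zc i) (hy : y ∈ F.Zc i) :
    F.classAt i (F.cupE i x y) = cup (F.complex i) (F.classAt i x) (F.classAt i y) := by
  rw [F.classAt_eq_mk hx, F.classAt_eq_mk hy, cup_mk, F.classAt_eq_mk (F.cupE_mem_Zc hx hy)]
  exact congrArg Submodule.Quotient.mk (Subtype.ext (F.toCochain_cupE i x y))

theorem cupE_comm {i : ℕ} {x y : Vec n} (hx : x ∈ F.Zc i) (hy : y ∈ F.Zc i) :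
    F.cupE i x y - F.cupE i y x ∈ F.Bc i := by
  refine ⟨cupOne _ (F.toCochain i x) (F.toCochain i y), ?_⟩
  rw [coboundary_cupOne (F.complex i) (f := F.toCochain i x) (g := F.toCochain i y) hx hy, map_sub,
    toCochainL_apply, toCochainL_apply, toCochain_cupE, toCochain_cupE]
  exact F.cochain_ext fun j hj => (CharTwo.sub_eq_add _ _).symm

theorem cupE_mem_Bc_left {i : ℕ} {x y : Vec n} (hx : x ∈ F.Bc i) (hy : y ∈ F.Zc i) :
    F.cupE i x y ∈ F.Bc i := by
  rw [← F.classAt_eq_zero (F.cupE_mem_Zc (F.Bc_le_Zc i hx) hy),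
    F.classAt_cupE (F.Bc_le_Zc i hx) hy, F.classAt_of_mem_Bc hx, map_zero, LinearMap.zero_apply]

theorem cupE_mem_Bc_right {i : ℕ} {x y : Vec n} (hx : x ∈ F.Zc i) (hy : y ∈ F.Bc i) :
    F.cupE i x y ∈ F.Bc i := by
  rw [← F.classAt_eq_zero (F.cupE_mem_Zc hx (F.Bc_le_Zc i hy)),
    F.classAt_cupE hx (F.Bc_le_Zc i hy), F.classAt_of_mem_Bc hy, map_zero]

/-! ### The spaces of products -/

theorem kCupSpace_one (K : PreAbstractSimplicialComplex V) : kCupSpace K 1 = positivePart K := by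
  unfold kCupSpace
  rw [← Submodule.span_eq (positivePart K)]
  congr 1
  ext x
  constructor
  · rintro ⟨l, hl, hp, rfl⟩
    obtain ⟨a, rfl⟩ := List.length_eq_one_iff.1 hl
    have := hp a (by simp)
    rwa [Submodule.span_eq] at this
  · intro hx
    exact ⟨[x], rfl, by simpa [Submodule.span_eq] using hx, rfl⟩

theorem kCupSpace_succ (K : PreAbstractSimplicialComplex V) {k : ℕ} (hk : 1 ≤ k) :
    kCupSpace K (k + 1) = Submodule.map₂ (cup K) (positivePart K) (kCupSpace K k) := by
  conv_rhs => rw [← Submodule.span_eq (positivePart K)]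
  unfold kCupSpace
  rw [Submodule.map₂_span_span]
  congr 1
  ext x
  constructor
  · rintro ⟨l, hl, hp, rfl⟩
    match l, hl with
    | a :: b :: l, hl =>
      refine ⟨a, by simpa using hp a (by simp), cupList K (b :: l), ⟨b :: l, ?_, ?_, rfl⟩, rfl⟩
      · simpa using hl
      · exact fun c hc => hp c (by simp_all)
    | [_], hl => simp at hl; omega
  · rintro ⟨a, ha, _, ⟨l, hl, hp, rfl⟩, rfl⟩
    refine ⟨a :: l, by simp [hl], ?_, ?_⟩
    · intro c hc
      rcases List.mem_cons.1 hc with rfl | hc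
      · simpa using ha
      · exact hp c hc
    · cases l with
      | nil => simp at hl; omega
      | cons b l => rfl

theorem cup_mem_positivePart (K : PreAbstractSimplicialComplex V) {a b : Cohomology K}
    (ha : a ∈ positivePart K) (hb : b ∈ positivePart K) : cup K a b ∈ positivePart K := by
  have : Submodule.map₂ (cup K) (positivePart K) (positivePart K) ≤ positivePart K := by
    unfold positivePart
    rw [Submodule.map₂_span_span, Submodule.span_le]
    rintro _ ⟨_, ⟨z, hz, rfl⟩, _, ⟨w, hw, rfl⟩, rfl⟩
    refine Submodule.subset_span ⟨cupCocycle K z w, ?_, cup_mk K z w⟩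
    rintro ⟨s, hs⟩ hc
    obtain ⟨v, rfl⟩ := Finset.card_eq_one.1 hc
    change ∑ u ∈ {v}, Cochain.ext z.1 (frontFace {v} u) * Cochain.ext w.1 (backFace {v} u) = 0
    have h1 : frontFace {v} v = {v} := Finset.filter_true_of_mem (by simp)
    rw [Finset.sum_singleton, h1, Cochain.ext_coe _ hs, hz ⟨{v}, hs⟩ hc, zero_mul]
  exact this (Submodule.apply_mem_map₂ _ ha hb)

theorem kCupSpace_le_positivePart (K : PreAbstractSimplicialComplex V) {k : ℕ} (hk : 1 ≤ k) :
    kCupSpace K k ≤ positivePart K := by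
  induction k, hk using Nat.le_induction with
  | base => rw [kCupSpace_one]
  | succ k hk ih =>
    rw [kCupSpace_succ K hk]
    exact Submodule.map₂_le.2 fun a ha b hb => cup_mem_positivePart K ha (ih hb)

/-- The vectors that restrict to a cocycle of `K_i` whose class is a sum of `k`-fold products of
classes of positive degree. -/
noncomputable def Wc (k i : ℕ) : Submodule (ZMod 2) (Vec n) :=
  F.liftSub i (kCupSpace (F.complex i) k)

theorem mem_Wc {k i : ℕ} {x : Vec n} :
    x ∈ F.Wc k i ↔ x ∈ F.Zc i ∧ F.classAt i x ∈ kCupSpace (F.complex i) k := F.mem_liftSub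

theorem Bc_le_Wc (k i : ℕ) : F.Bc i ≤ F.Wc k i := F.Bc_le_liftSub i _

theorem Wc_le_Zc (k i : ℕ) : F.Wc k i ≤ F.Zc i := fun _ hx => (F.mem_Wc.1 hx).1

theorem Wc_anti (k : ℕ) {i j : ℕ} (h : i ≤ j) : F.Wc k j ≤ F.Wc k i := by
  intro x hx
  obtain ⟨h1, h2⟩ := F.mem_Wc.1 hx
  refine F.mem_Wc.2 ⟨F.Zc_anti h h1, ?_⟩
  rw [← F.restrict_classAt h h1]
  exact restrictCohomology_kCupSpace _ k h2

theorem Wc_le_Wc_one {k : ℕ} (hk : 1 ≤ k) (i : ℕ) : F.Wc k i ≤ F.Wc 1 i := by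
  intro x hx
  obtain ⟨h1, h2⟩ := F.mem_Wc.1 hx
  refine F.mem_Wc.2 ⟨h1, ?_⟩
  rw [kCupSpace_one]
  exact kCupSpace_le_positivePart _ hk h2

theorem Wc_succ {k : ℕ} (hk : 1 ≤ k) (i : ℕ) :
    F.Wc (k + 1) i = F.Bc i ⊔ Submodule.map₂ (F.cupE i) (F.Wc 1 i) (F.Wc k i) := by
  apply le_antisymm
  · have key : kCupSpace (F.complex i) (k + 1) ≤
        ((F.Bc i ⊔ Submodule.map₂ (F.cupE i) (F.Wc 1 i) (F.Wc k i)).comap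
          (F.Zc i).subtype).map (F.cls i) := by
      rw [kCupSpace_succ _ hk]
      refine Submodule.map₂_le.2 fun a ha b hb => ?_
      obtain ⟨x, hx, rfl⟩ := F.exists_classAt_eq a
      obtain ⟨y, hy, rfl⟩ := F.exists_classAt_eq b
      refine ⟨⟨F.cupE i x y, F.cupE_mem_Zc hx hy⟩, Submodule.mem_sup_right
        (Submodule.apply_mem_map₂ _ (F.mem_Wc.2 ⟨hx, ?_⟩) (F.mem_Wc.2 ⟨hy, hb⟩)), ?_⟩
      · rwa [kCupSpace_one]
      · rw [← F.classAt_eq_cls, F.classAt_cupE hx hy]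
    intro x hx
    obtain ⟨h1, h2⟩ := F.mem_Wc.1 hx
    obtain ⟨⟨y, hy⟩, h3, h4⟩ := key h2
    rw [← F.classAt_eq_cls] at h4
    have h5 := (F.classAt_eq_classAt h1 hy).1 h4.symm
    rw [← sub_add_cancel x y]
    exact add_mem (Submodule.mem_sup_left h5) h3
  · refine sup_le (F.Bc_le_Wc _ i) (Submodule.map₂_le.2 fun x hx y hy => ?_)
    have hx' := F.mem_Wc.1 hx
    have hy' := F.mem_Wc.1 hy
    refine F.mem_Wc.2 ⟨F.cupE_mem_Zc hx'.1 hy'.1, ?_⟩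
    rw [F.classAt_cupE hx'.1 hy'.1, kCupSpace_succ _ hk]
    rw [kCupSpace_one] at hx'
    exact Submodule.apply_mem_map₂ _ hx'.2 hy'.2

theorem cupE_mem_Wc {k i : ℕ} (hk : 1 ≤ k) {x y : Vec n} (hx : x ∈ F.Wc 1 i) (hy : y ∈ F.Wc k i) :
    F.cupE i x y ∈ F.Wc (k + 1) i := by
  rw [F.Wc_succ hk]
  exact Submodule.mem_sup_right (Submodule.apply_mem_map₂ _ hx hy)

/-- Products of generators generate the space of products. -/
theorem Wc_succ_eq_span {k i : ℕ} (hk : 1 ≤ k) {X Y : Set (Vec n)}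
    (hX : F.Bc i ⊔ Submodule.span (ZMod 2) X = F.Wc 1 i)
    (hY : F.Bc i ⊔ Submodule.span (ZMod 2) Y = F.Wc k i) :
    F.Wc (k + 1) i =
      F.Bc i ⊔ Submodule.span (ZMod 2) (Set.image2 (fun x y => F.cupE i x y) X Y) := by
  rw [F.Wc_succ hk]
  have hXZ : Submodule.span (ZMod 2) X ≤ F.Zc i :=
    (le_sup_right.trans hX.le).trans (F.Wc_le_Zc 1 i)
  apply le_antisymm
  · refine sup_le le_sup_left ?_
    rw [← hX, Submodule.map₂_sup_left]
    refine sup_le (Submodule.map₂_le.2 fun x hx y hy =>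
      Submodule.mem_sup_left (F.cupE_mem_Bc_left hx (F.Wc_le_Zc _ _ hy))) ?_
    rw [← hY, Submodule.map₂_sup_right]
    refine sup_le (Submodule.map₂_le.2 fun x hx y hy =>
      Submodule.mem_sup_left (F.cupE_mem_Bc_right (hXZ hx) hy)) ?_
    rw [Submodule.map₂_span_span]
    exact le_sup_right
  · refine sup_le_sup_left ?_ _
    rw [← Submodule.map₂_span_span]
    exact Submodule.map₂_le_map₂ (le_sup_right.trans hX.le) (le_sup_right.trans hY.le)

/-- The complex `K_1` is a point, so it has no cohomology of positive degree. -/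
theorem Wc_one_one_le : F.Wc 1 1 ≤ F.Bc 1 := by
  intro x hx
  obtain ⟨h1, h2⟩ := F.mem_Wc.1 hx
  rw [← F.classAt_eq_zero h1]
  have h3 : positivePart (F.complex 1) = ⊥ := by
    unfold positivePart
    rw [Submodule.span_eq_bot]
    rintro _ ⟨z, hz, rfl⟩
    have : z = 0 := by
      refine Subtype.ext (funext ?_)
      rintro ⟨s, j, hj, hs⟩
      refine hz _ ?_
      subst hs
      obtain ⟨v, hv⟩ := F.nonempty j
      obtain ⟨i, hi, he⟩ := F.face j {v} (by simpa using hv) (Finset.singleton_nonempty v)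
      have : i = j := Fin.ext (by have : i.val ≤ j.val := hi; omega)
      subst this
      dsimp only
      rw [he, Finset.card_singleton]
    rw [this]
    rfl
  rw [kCupSpace_one, h3] at h2
  exact h2

/-! ### The face table -/

theorem findSimplex_val (j : Fin n) {t : Finset V} {k : Fin n} (h : F.simplex k = t) :
    (F.findSimplex j t).val = k := by
  unfold findSimplex
  rw [foldT_val]
  change (List.finRange n).foldl (fun acc i => if F.simplex i = t then i else acc) j = k
  have : ∀ (l : List (Fin n)) (a : Fin n), k ∈ l ∨ a = k →
      l.foldl (fun acc i => if F.simplex i = t then i else acc) a = k := by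
    intro l
    induction l with
    | nil => intro a ha; simpa using ha
    | cons b l ih =>
      intro a ha
      rw [List.foldl_cons]
      apply ih
      by_cases hb : F.simplex b = t
      · rw [if_pos hb]
        exact Or.inr (F.injective (hb.trans h.symm))
      · rw [if_neg hb]
        rcases ha with ha | ha
        · rcases List.mem_cons.1 ha with rfl | ha
          · exact absurd h hb
          · exact Or.inl ha
        · exact Or.inr ha
  exact this _ _ (Or.inl (List.mem_finRange k))

theorem foldl_add_eq {α : Type} (f : α → ZMod 2) (l : List α) (b : ZMod 2) :
    l.foldl (fun acc p => acc + f p) b = b + (l.map f).sum := by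
  induction l generalizing b with
  | nil => simp
  | cons a l ih => rw [List.foldl_cons, ih, List.map_cons, List.sum_cons, add_assoc]

theorem faceTable_val (j : Fin n) : F.faceTable.val j = ((F.simplex j).sort (· ≤ ·)).map fun v =>
    ((F.findSimplex j (frontFace (F.simplex j) v)).val,
      (F.findSimplex j (backFace (F.simplex j) v)).val) := by
  unfold faceTable
  rw [tabulateT_val]
  change (mapT _ _).val = _
  rw [mapT_val]
  rfl

theorem cupVec_val (l : ℕ) (x y : Vec n) :
    (cupVec F.faceTable.val l x y).val = F.cupE l x y := by
  funext j
  unfold cupVec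
  rw [tabulateT_val]
  change (if j.val < l then _ else _ : Timed (ZMod 2)).val = _
  split_ifs with hj
  · rw [foldT_val, faceTable_val]
    change List.foldl (fun acc (p : Fin n × Fin n) => acc + x p.1 * y p.2) 0 _ = _
    rw [foldl_add_eq (fun p : Fin n × Fin n => x p.1 * y p.2), zero_add, List.map_map, cupE_apply, Cochain.ext_coe _ (F.simplex_mem hj)]
    change _ = ∑ v ∈ F.simplex j, Cochain.ext (F.toCochain l x) (frontFace (F.simplex j) v) *
      Cochain.ext (F.toCochain l y) (backFace (F.simplex j) v)
    have e : ∑ v ∈ F.simplex j, Cochain.ext (F.toCochain l x) (frontFace (F.simplex j) v) *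
        Cochain.ext (F.toCochain l y) (backFace (F.simplex j) v) =
        (((F.simplex j).sort (· ≤ ·)).map fun v =>
          Cochain.ext (F.toCochain l x) (frontFace (F.simplex j) v) *
            Cochain.ext (F.toCochain l y) (backFace (F.simplex j) v)).sum := by
      rw [← Multiset.sum_coe, ← Multiset.map_coe, Finset.sort_eq]
      rfl
    rw [e]
    congr 1
    refine List.map_congr_left fun v hv => ?_
    have hv' : v ∈ F.simplex j := (Finset.mem_sort _).1 hv
    have face : ∀ (z : Vec n) (t : Finset V), t ⊆ F.simplex j → t.Nonempty →
        Cochain.ext (F.toCochain l z) t = z (F.findSimplex j t).val := by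
      intro z t ht hn
      obtain ⟨k, hk, rfl⟩ := F.face j t ht hn
      rw [F.findSimplex_val j rfl, Cochain.ext_coe _ (F.simplex_mem (lt_of_le_of_lt hk hj)),
        toCochain_simplex]
    rw [face x (frontFace (F.simplex j) v) (Finset.filter_subset _ _)
        ⟨v, Finset.mem_filter.2 ⟨hv', le_rfl⟩⟩,
      face y (backFace (F.simplex j) v) (Finset.filter_subset _ _)
        ⟨v, Finset.mem_filter.2 ⟨hv', le_rfl⟩⟩]
    rfl
  · rw [F.cupE_support x y (not_lt.1 hj)]
    rfl

/-! ### Step counts of the preprocessing -/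

theorem findSimplex_time_le (j : Fin n) {t : Finset V} (ht : t.card ≤ n) :
    (F.findSimplex j t).time ≤ n * (2 * n + 2) := by
  have := foldT_time_le (f := fun acc i => do
    tick ((F.simplex i).card + t.card + 1)
    pure (if F.simplex i = t then i else acc)) (l := List.finRange n) j (2 * n + 1) (by
      intro b i _
      have := F.card_simplex_le i
      change (F.simplex i).card + t.card + 1 + 0 ≤ _
      omega)
  rwa [List.length_finRange] at this

theorem faceTable_length (j : Fin n) : (F.faceTable.val j).length ≤ n := by
  rw [faceTable_val, List.length_map, Finset.length_sort]
  exact F.card_simplex_le j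

theorem faceTable_time_le : F.faceTable.time ≤ 12 * n ^ 4 := by
  have h : ∀ j : Fin n, (mapT (fun v => do
      tick (2 * (F.simplex j).card)
      let a ← F.findSimplex j (frontFace (F.simplex j) v)
      let b ← F.findSimplex j (backFace (F.simplex j) v)
      pure (a, b)) ((F.simplex j).sort (· ≤ ·))).time ≤ n * (2 * n + 2 * (n * (2 * n + 2)) + 1) := by
    intro j
    have hj := F.card_simplex_le j
    refine (mapT_time_le (2 * n + 2 * (n * (2 * n + 2))) ?_).trans
      (Nat.mul_le_mul_right _ ((Finset.length_sort (· ≤ ·)).trans_le hj))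
    intro v _
    have h1 := F.findSimplex_time_le j (t := frontFace (F.simplex j) v)
      ((Finset.card_filter_le _ _).trans hj)
    have h2 := F.findSimplex_time_le j (t := backFace (F.simplex j) v)
      ((Finset.card_filter_le _ _).trans hj)
    change 2 * (F.simplex j).card + ((F.findSimplex j _).time + ((F.findSimplex j _).time + 0)) ≤ _
    omega
  have := tabulateT_time_le _ h
  refine this.trans ?_
  rcases Nat.eq_zero_or_pos n with h | h
  · simp [h]
  · obtain ⟨m, rfl⟩ := Nat.exists_eq_add_of_le' h
    ring_nf
    nlinarith [Nat.zero_le m]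

theorem coboundaryMatrix_time_le : F.coboundaryMatrix.time ≤ 5 * n ^ 3 := by
  have h : ∀ j : Fin n, (tabulateT fun i => do
      tick ((F.simplex i).card + (F.simplex j).card + 1)
      pure (if F.simplex j ⊆ F.simplex i ∧ (F.simplex i).card = (F.simplex j).card + 1
        then (1 : ZMod 2) else 0)).time ≤ n * (2 * n + 1 + 1) := by
    intro j
    refine tabulateT_time_le _ fun i => ?_
    have h1 := F.card_simplex_le i
    have h2 := F.card_simplex_le j
    change (F.simplex i).card + (F.simplex j).card + 1 + 0 ≤ _
    omega
  refine (tabulateT_time_le _ h).trans ?_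
  rcases Nat.eq_zero_or_pos n with h | h
  · simp [h]
  · obtain ⟨m, rfl⟩ := Nat.exists_eq_add_of_le' h
    ring_nf
    nlinarith [Nat.zero_le m]

theorem cupVec_time_le (l : ℕ) (x y : Vec n) :
    (cupVec F.faceTable.val l x y).time ≤ n * (3 * n + 2) := by
  refine tabulateT_time_le _ fun j => ?_
  have h1 := foldT_time_le (f := fun acc (p : Fin n × Fin n) => do
    tick 2
    pure (acc + x p.1 * y p.2)) (l := F.faceTable.val j) (0 : ZMod 2) 2 (fun _ _ _ => le_rfl)
  have h2 := F.faceTable_length j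
  change 1 + (if j.val < l then _ else _ : Timed (ZMod 2)).time ≤ _
  split_ifs
  · refine (Nat.add_le_add_left h1 1).trans ?_
    omega
  · change 1 + 0 ≤ _
    omega

end SimplexwiseFiltration

/-! ### Column reduction -/

section Reduction

variable {n : ℕ}

/-- The vectors of the columns of a matrix. -/
def vecs (S : List (Col n)) : List (Vec n) := S.map Col.vec

/-- The annotations of the columns of a matrix. -/
def tags (S : List (Col n)) : List (BarRep n) := S.filterMap Col.tag

/-- The representatives of a list of bars. -/
def reps (P : List (BarRep n)) : List (Vec n) := P.map BarRep.rep

@[simp] theorem vecs_nil : vecs ([] : List (Col n)) = [] := rfl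
@[simp] theorem vecs_cons (c : Col n) (S : List (Col n)) : vecs (c :: S) = c.vec :: vecs S := rfl
@[simp] theorem vecs_append (S T : List (Col n)) : vecs (S ++ T) = vecs S ++ vecs T :=
  List.map_append

theorem mem_vecs {S : List (Col n)} {x : Vec n} : x ∈ vecs S ↔ ∃ c ∈ S, c.vec = x := List.mem_map

theorem vec_mem_vecs {S : List (Col n)} {c : Col n} (h : c ∈ S) : c.vec ∈ vecs S :=
  mem_vecs.2 ⟨c, h, rfl⟩

@[simp] theorem tags_append (S T : List (Col n)) : tags (S ++ T) = tags S ++ tags T :=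
  List.filterMap_append

theorem mem_tags {S : List (Col n)} {x : BarRep n} : x ∈ tags S ↔ ∃ c ∈ S, c.tag = some x :=
  List.mem_filterMap

/-- A reduced matrix: every nonzero column has a pivot, and the columns to its right vanish there.
The columns to its left need not, and the pivots need not be ordered; this is still enough for a
single pass from left to right to reduce a vector completely. -/
structure Reduced (S : List (Col n)) : Prop where
  low : ∀ c ∈ S, c.low = (lowVec c.vec).val
  clear : S.Pairwise fun c c' => ∀ r, c.low = some r → c'.vec r = 0

theorem Reduced.zero {S : List (Col n)} (h : Reduced S) {c : Col n} (hc : c ∈ S)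
    (hl : c.low = none) : c.vec = 0 :=
  lowVec_eq_none.1 ((h.low c hc).symm.trans hl)

theorem Reduced.pivot {S : List (Col n)} (h : Reduced S) {c : Col n} (hc : c ∈ S) {r : Fin n}
    (hl : c.low = some r) : c.vec r ≠ 0 :=
  lowVec_eq_some ((h.low c hc).symm.trans hl)

theorem Reduced.sublist {S S' : List (Col n)} (h : Reduced S) (hS : S'.Sublist S) : Reduced S' :=
  ⟨fun c hc => h.low c (hS.subset hc), h.clear.sublist hS⟩

theorem Reduced.of_cons {c : Col n} {S : List (Col n)} (h : Reduced (c :: S)) : Reduced S :=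
  h.sublist (List.sublist_cons_self c S)

theorem Reduced.low_eq_none_iff {S : List (Col n)} (h : Reduced S) {c : Col n} (hc : c ∈ S) :
    c.low = none ↔ c.vec = 0 := by
  rw [h.low c hc, lowVec_eq_none]

/-- One step of the reduction of a vector. -/
def reduceStep (w : Vec n) (c : Col n) : Vec n :=
  match c.low with
  | none => w
  | some r => if w r = 0 then w else w + c.vec

theorem reduceVec_val (S : List (Col n)) (x : Vec n) :
    (reduceVec S x).val = S.foldl reduceStep x := by
  unfold reduceVec
  rw [foldT_val]
  congr 1
  funext w c
  change (match c.low with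
    | none => pure w
    | some r => if w r = 0 then pure w else addVec w c.vec : Timed (Vec n)).val = _
  unfold reduceStep
  cases c.low with
  | none => rfl
  | some r =>
    dsimp only
    split_ifs <;> rfl

theorem reduceVec_time_le (S : List (Col n)) (x : Vec n) :
    (reduceVec S x).time ≤ S.length * (2 * n + 2) := by
  refine foldT_time_le _ (2 * n + 1) fun w c _ => ?_
  change 1 + (match c.low with
    | none => pure w
    | some r => if w r = 0 then pure w else addVec w c.vec : Timed (Vec n)).time ≤ _
  cases c.low with
  | none => change 1 + 0 ≤ _; omega
  | some r =>
    dsimp only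
    split_ifs
    · change 1 + 0 ≤ _; omega
    · have := addVec_time_le w c.vec
      omega

theorem reduceStep_sub_mem (w : Vec n) (c : Col n) : reduceStep w c - w ∈ (ZMod 2) ∙ c.vec := by
  unfold reduceStep
  split
  · simp
  · split_ifs
    · simp
    · rw [add_sub_cancel_left]
      exact Submodule.mem_span_singleton_self _

theorem foldl_reduceStep_sub_mem (S : List (Col n)) (x : Vec n) :
    S.foldl reduceStep x - x ∈ spanL (ZMod 2) (vecs S) := by
  induction S generalizing x with
  | nil => simp
  | cons c S ih =>
    rw [List.foldl_cons, vecs_cons, spanL_cons, ← sub_add_sub_cancel _ (reduceStep x c) x, add_comm]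
    exact Submodule.add_mem_sup (reduceStep_sub_mem x c) (ih _)

theorem foldl_reduceStep_apply {S : List (Col n)} {r : Fin n} (h : ∀ c ∈ S, c.vec r = 0)
    (x : Vec n) : S.foldl reduceStep x r = x r := by
  have h1 : spanL (ZMod 2) (vecs S) ≤ LinearMap.ker (LinearMap.proj (R := ZMod 2) r) := by
    rw [spanL_le]
    intro y hy
    obtain ⟨c, hc, rfl⟩ := mem_vecs.1 hy
    exact h c hc
  exact sub_eq_zero.1 (h1 (foldl_reduceStep_sub_mem S x))

theorem reduceStep_pivot {w : Vec n} {c : Col n} {r : Fin n} (hl : c.low = some r)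
    (hc : c.vec r ≠ 0) : reduceStep w c r = 0 := by
  unfold reduceStep
  rw [hl]
  dsimp only
  split_ifs with hw
  · exact hw
  · rw [Pi.add_apply]
    have : ∀ a b : ZMod 2, a ≠ 0 → b ≠ 0 → a + b = 0 := by decide
    exact this _ _ hw hc

theorem Reduced.foldl_pivot {S : List (Col n)} (hS : Reduced S) (x : Vec n) {c : Col n}
    (hc : c ∈ S) {r : Fin n} (hl : c.low = some r) : S.foldl reduceStep x r = 0 := by
  induction S generalizing x with
  | nil => simp at hc
  | cons d S ih =>
    rw [List.foldl_cons]
    rcases List.mem_cons.1 hc with rfl | hc'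
    · rw [foldl_reduceStep_apply fun e he => (List.pairwise_cons.1 hS.clear).1 e he r hl]
      exact reduceStep_pivot hl (hS.pivot hc hl)
    · exact ih hS.of_cons _ hc'

theorem Reduced.append {S : List (Col n)} (hS : Reduced S) {c : Col n}
    (hl : c.low = (lowVec c.vec).val)
    (hc : ∀ d ∈ S, ∀ r, d.low = some r → c.vec r = 0) : Reduced (S ++ [c]) := by
  refine ⟨fun d hd => ?_, ?_⟩
  · rcases List.mem_append.1 hd with h | h
    · exact hS.low d h
    · rw [List.mem_singleton.1 h]; exact hl
  · rw [List.pairwise_append]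
    refine ⟨hS.clear, List.pairwise_singleton _ _, fun d hd e he => ?_⟩
    rw [List.mem_singleton.1 he]
    exact hc d hd

theorem Reduced.append_reduceVec {S : List (Col n)} (hS : Reduced S) (x : Vec n)
    (t : Option (BarRep n)) :
    Reduced (S ++ [⟨(reduceVec S x).val, (lowVec (reduceVec S x).val).val, t⟩]) := by
  refine hS.append rfl ?_
  intro d hd r hr
  dsimp only
  rw [reduceVec_val]
  exact hS.foldl_pivot x hd hr

theorem Reduced.eq_zero_of_mem_span {S : List (Col n)} (hS : Reduced S) {w : Vec n}
    (hw : w ∈ spanL (ZMod 2) (vecs S)) (h : ∀ c ∈ S, ∀ r, c.low = some r → w r = 0) : w = 0 := by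
  induction S with
  | nil => simpa using hw
  | cons c S ih =>
    refine ih hS.of_cons ?_ fun d hd => h d (by simp [hd])
    rw [vecs_cons, spanL_cons] at hw
    obtain ⟨y, hy, s, hs, rfl⟩ := Submodule.mem_sup.1 hw
    obtain ⟨a, rfl⟩ := Submodule.mem_span_singleton.1 hy
    cases hl : c.low with
    | none => rw [hS.zero (by simp) hl]; simpa using hs
    | some r =>
      have h1 := h c (by simp) r hl
      have h2 : s r = 0 := by
        have : spanL (ZMod 2) (vecs S) ≤ LinearMap.ker (LinearMap.proj (R := ZMod 2) r) := by
          rw [spanL_le]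
          intro y hy
          obtain ⟨d, hd, rfl⟩ := mem_vecs.1 hy
          exact (List.pairwise_cons.1 hS.clear).1 d hd r hl
        exact this hs
      rw [Pi.add_apply, h2, add_zero, Pi.smul_apply, smul_eq_mul] at h1
      rcases mul_eq_zero.1 h1 with h1 | h1
      · rw [h1, zero_smul, zero_add]; exact hs
      · exact absurd h1 (hS.pivot (by simp) hl)

/-- The nonzero columns of a reduced matrix are linearly independent of the columns to their
left. -/
theorem Reduced.indepMod {U T : List (Col n)} (h : Reduced (U ++ T)) (hT : ∀ c ∈ T, c.low ≠ none) :
    IndepMod (spanL (ZMod 2) (vecs U)) (vecs T) := by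
  induction T using List.reverseRecOn with
  | nil => simp
  | append_singleton T c ih =>
    rw [← List.append_assoc] at h
    have h1 : Reduced (U ++ T) := h.sublist (List.sublist_append_left _ _)
    rw [vecs_append, vecs_cons, vecs_nil, indepMod_append_singleton, ← spanL_append, ← vecs_append]
    refine ⟨fun hc => hT c (by simp) ?_, ih h1 fun d hd => hT d (by simp [hd])⟩
    rw [h.low_eq_none_iff (by simp)]
    exact h1.eq_zero_of_mem_span hc fun d hd r hr =>
      (List.pairwise_append.1 h.clear).2.2 d hd c (by simp) r hr

/-- The matrix `S'` arises from `S` by left-to-right column additions, up to additions of vectors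
of `X`. -/
def ColEquiv : Submodule (ZMod 2) (Vec n) → List (Col n) → List (Col n) → Prop
  | _, [], S' => S' = []
  | X, c :: S, S' => ∃ c' S'', S' = c' :: S'' ∧ c'.tag = c.tag ∧ c'.vec - c.vec ∈ X ∧
      ColEquiv (X ⊔ (ZMod 2) ∙ c.vec) S S''

theorem ColEquiv.split {X : Submodule (ZMod 2) (Vec n)} {U T S' : List (Col n)}
    (h : ColEquiv X (U ++ T) S') : ∃ U' T', S' = U' ++ T' ∧ ColEquiv X U U' ∧
      ColEquiv (X ⊔ spanL (ZMod 2) (vecs U)) T T' := by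
  induction U generalizing X S' with
  | nil => exact ⟨[], S', rfl, rfl, by simpa using h⟩
  | cons c U ih =>
    obtain ⟨c', S'', rfl, h1, h2, h3⟩ := h
    obtain ⟨U', T', rfl, h4, h5⟩ := ih h3
    refine ⟨c' :: U', T', rfl, ⟨c', U', rfl, h1, h2, h4⟩, ?_⟩
    rwa [vecs_cons, spanL_cons, ← sup_assoc]

theorem ColEquiv.span_eq {X : Submodule (ZMod 2) (Vec n)} {S S' : List (Col n)}
    (h : ColEquiv X S S') : X ⊔ spanL (ZMod 2) (vecs S') = X ⊔ spanL (ZMod 2) (vecs S) := by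
  induction S generalizing X S' with
  | nil => rw [show S' = [] from h]
  | cons c S ih =>
    obtain ⟨c', S'', rfl, h1, h2, h3⟩ := h
    rw [vecs_cons, vecs_cons, spanL_cons, spanL_cons, ← sup_assoc, ← sup_assoc,
      sup_span_congr h2, ih h3]

theorem ColEquiv.tag_eq {X : Submodule (ZMod 2) (Vec n)} {S S' : List (Col n)}
    (h : ColEquiv X S S') : S'.map Col.tag = S.map Col.tag := by
  induction S generalizing X S' with
  | nil => rw [show S' = [] from h]
  | cons c S ih =>
    obtain ⟨c', S'', rfl, h1, h2, h3⟩ := h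
    rw [List.map_cons, List.map_cons, h1, ih h3]

theorem ColEquiv.length_eq {X : Submodule (ZMod 2) (Vec n)} {S S' : List (Col n)}
    (h : ColEquiv X S S') : S'.length = S.length := by
  simpa using congrArg List.length h.tag_eq

theorem ColEquiv.tags_eq {X : Submodule (ZMod 2) (Vec n)} {S S' : List (Col n)}
    (h : ColEquiv X S S') : tags S' = tags S := by
  have h1 : ∀ S : List (Col n), tags S = (S.map Col.tag).filterMap id := fun S => by
    rw [List.filterMap_map]; rfl
  rw [h1, h1, h.tag_eq]

theorem ColEquiv.mono {X Y : Submodule (ZMod 2) (Vec n)} (hXY : X ≤ Y) {S S' : List (Col n)}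
    (h : ColEquiv X S S') : ColEquiv Y S S' := by
  induction S generalizing X Y S' with
  | nil => exact h
  | cons c S ih =>
    obtain ⟨c', S'', rfl, h1, h2, h3⟩ := h
    exact ⟨c', S'', rfl, h1, hXY h2, ih (sup_le_sup_right hXY _) h3⟩

theorem ColEquiv.map {X : Submodule (ZMod 2) (Vec n)} {f : Col n → Col n} {S : List (Col n)}
    (h1 : ∀ c, (f c).tag = c.tag) (h2 : ∀ c ∈ S, (f c).vec - c.vec ∈ X) :
    ColEquiv X S (S.map f) := by
  induction S generalizing X with
  | nil => rfl
  | cons c S ih =>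
    exact ⟨f c, S.map f, rfl, h1 c, h2 c (by simp),
      ih fun d hd => Submodule.mem_sup_left (h2 d (by simp [hd]))⟩

/-- One step of the reduction of a matrix. -/
def reduceMatrixStep (T : List (Col n)) (c : Col n) : List (Col n) :=
  T ++ [⟨(reduceVec T c.vec).val, (lowVec (reduceVec T c.vec).val).val, c.tag⟩]

theorem reduceMatrix_val (S : List (Col n)) :
    (reduceMatrix S).val = S.foldl reduceMatrixStep [] := by
  unfold reduceMatrix
  rw [foldT_val]
  rfl

theorem foldl_reduceMatrixStep (S T : List (Col n)) (hT : Reduced T) :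
    ∃ S', S.foldl reduceMatrixStep T = T ++ S' ∧ Reduced (T ++ S') ∧
      ColEquiv (spanL (ZMod 2) (vecs T)) S S' := by
  induction S generalizing T with
  | nil => exact ⟨[], by simp, by simpa using hT, rfl⟩
  | cons c S ih =>
    have h1 := hT.append_reduceVec c.vec c.tag
    obtain ⟨S', h2, h3, h4⟩ := ih _ h1
    have h5 : (reduceVec T c.vec).val - c.vec ∈ spanL (ZMod 2) (vecs T) := by
      rw [reduceVec_val]; exact foldl_reduceStep_sub_mem T c.vec
    refine ⟨⟨(reduceVec T c.vec).val, (lowVec (reduceVec T c.vec).val).val, c.tag⟩ :: S',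
      by rw [List.foldl_cons, reduceMatrixStep, h2, List.append_assoc]; rfl,
      by rw [List.append_assoc] at h3; exact h3, _, _, rfl, rfl, h5, ?_⟩
    rw [vecs_append, spanL_append, vecs_cons, vecs_nil, spanL_cons, spanL_nil, sup_bot_eq,
      sup_span_congr h5] at h4
    exact h4

theorem reduceMatrix_reduced (S : List (Col n)) : Reduced (reduceMatrix S).val := by
  obtain ⟨S', h1, h2, -⟩ := foldl_reduceMatrixStep S [] ⟨by simp, by simp⟩
  rw [reduceMatrix_val, h1]
  exact h2

theorem reduceMatrix_colEquiv (S : List (Col n)) : ColEquiv ⊥ S (reduceMatrix S).val := by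
  obtain ⟨S', h1, -, h3⟩ := foldl_reduceMatrixStep S [] ⟨by simp, by simp⟩
  rw [reduceMatrix_val, h1]
  simpa using h3

theorem Reduced.foldl_reduceStep {S : List (Col n)} {w : Vec n}
    (h : ∀ c ∈ S, ∀ r, c.low = some r → w r = 0) : S.foldl reduceStep w = w := by
  induction S with
  | nil => rfl
  | cons c S ih =>
    have e : reduceStep w c = w := by
      unfold reduceStep
      cases hl : c.low with
      | none => rfl
      | some r => exact if_pos (h c (by simp) r hl)
    rw [List.foldl_cons, e]
    exact ih fun d hd => h d (by simp [hd])

/-- A reduced matrix is not changed by a further reduction. -/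
theorem Reduced.reduceMatrix_val {S : List (Col n)} (h : Reduced S) :
    (reduceMatrix S).val = S := by
  rw [_root_.reduceMatrix_val]
  induction S using List.reverseRecOn with
  | nil => rfl
  | append_singleton S c ih =>
    have hw : (reduceVec S c.vec).val = c.vec := by
      rw [reduceVec_val]
      exact Reduced.foldl_reduceStep fun d hd r hr =>
        (List.pairwise_append.1 h.clear).2.2 d hd c (by simp) r hr
    rw [List.foldl_append, ih (h.sublist (List.sublist_append_left _ _)), List.foldl_cons,
      List.foldl_nil, reduceMatrixStep, hw, ← h.low c (by simp)]

theorem reduceMatrix_time_le {m : ℕ} {S : List (Col n)} (h : S.length ≤ m) :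
    (reduceMatrix S).time ≤ m * (m * (2 * n + 2) + 2 * n + 1) := by
  have key := (foldT_induction (f := fun (T : List (Col n)) (c : Col n) => do
      let w ← reduceVec T c.vec
      let r ← lowVec w
      pure (T ++ [⟨w, r, c.tag⟩])) (l := S) (b := [])
    (fun done T => T.length = done.length) (fun _ => m * (2 * n + 2) + 2 * n) rfl (by
      intro done a rest hS T hT
      refine ⟨by simp [hT], ?_⟩
      have h1 := reduceVec_time_le T a.vec
      have h2 := lowVec_time_le (reduceVec T a.vec).val
      have h3 : T.length ≤ m := by
        rw [hT]; rw [hS, List.length_append] at h; omega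
      have h4 := Nat.mul_le_mul_right (2 * n + 2) h3
      change (reduceVec T a.vec).time + ((lowVec (reduceVec T a.vec).val).time + 0) ≤ _
      omega)).2
  refine key.trans ?_
  rw [List.map_const', List.sum_replicate, smul_eq_mul]
  exact Nat.mul_le_mul_right _ h

/-- The annotated columns of `T` agree with their representatives up to vectors of `X` and
additions of columns from the left. -/
def Represents : Submodule (ZMod 2) (Vec n) → List (Col n) → Prop
  | _, [] => True
  | X, c :: T => (∃ x, c.tag = some x ∧ c.vec - x.rep ∈ X) ∧ Represents (X ⊔ (ZMod 2) ∙ c.vec) T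

theorem Represents.mono {X Y : Submodule (ZMod 2) (Vec n)} (hXY : X ≤ Y) {T : List (Col n)}
    (h : Represents X T) : Represents Y T := by
  induction T generalizing X Y with
  | nil => trivial
  | cons c T ih =>
    obtain ⟨⟨x, h1, h2⟩, h3⟩ := h
    exact ⟨⟨x, h1, hXY h2⟩, ih (sup_le_sup_right hXY _) h3⟩

theorem Represents.append {X : Submodule (ZMod 2) (Vec n)} {T : List (Col n)} {c : Col n}
    {x : BarRep n} (h : Represents X T) (hc : c.tag = some x)
    (hx : c.vec - x.rep ∈ X ⊔ spanL (ZMod 2) (vecs T)) : Represents X (T ++ [c]) := by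
  induction T generalizing X with
  | nil => exact ⟨⟨x, hc, by simpa using hx⟩, trivial⟩
  | cons d T ih =>
    obtain ⟨h1, h2⟩ := h
    refine ⟨h1, ih h2 ?_⟩
    rwa [vecs_cons, spanL_cons, ← sup_assoc] at hx

theorem Represents.colEquiv {X : Submodule (ZMod 2) (Vec n)} {T T' : List (Col n)}
    (h : Represents X T) (hT : ColEquiv X T T') : Represents X T' := by
  induction T generalizing X T' with
  | nil => rw [show T' = [] from hT]; trivial
  | cons c T ih =>
    obtain ⟨⟨x, h1, h2⟩, h3⟩ := h
    obtain ⟨c', T'', rfl, h4, h5, h6⟩ := hT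
    refine ⟨⟨x, h4.trans h1, ?_⟩, ?_⟩
    · rw [← sub_add_sub_cancel _ c.vec]; exact add_mem h5 h2
    · rw [sup_span_congr h5]; exact ih h3 h6

theorem Represents.filter {X : Submodule (ZMod 2) (Vec n)} {T : List (Col n)}
    (h : Represents X T) {p : Col n → Bool} (hp : ∀ c ∈ T, p c = false → c.vec = 0) :
    Represents X (T.filter p) := by
  induction T generalizing X with
  | nil => trivial
  | cons c T ih =>
    obtain ⟨h1, h3⟩ := h
    have ih' := ih h3 fun d hd => hp d (by simp [hd])
    cases hc : p c with
    | true => rw [List.filter_cons_of_pos hc]; exact ⟨h1, ih'⟩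
    | false =>
      rw [List.filter_cons_of_neg (by simp [hc])]
      rwa [hp c (by simp) hc, Submodule.span_zero_singleton, sup_bot_eq] at ih'

theorem Represents.tag_isSome {X : Submodule (ZMod 2) (Vec n)} {T : List (Col n)}
    (h : Represents X T) {c : Col n} (hc : c ∈ T) : ∃ x, c.tag = some x := by
  induction T generalizing X with
  | nil => simp at hc
  | cons d T ih =>
    obtain ⟨⟨x, h1, h2⟩, h3⟩ := h
    rcases List.mem_cons.1 hc with rfl | hc
    · exact ⟨x, h1⟩
    · exact ih h3 hc

theorem Represents.length_tags {X : Submodule (ZMod 2) (Vec n)} {T : List (Col n)}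
    (h : Represents X T) : (tags T).length = T.length := by
  induction T generalizing X with
  | nil => rfl
  | cons d T ih =>
    obtain ⟨⟨x, h1, h2⟩, h3⟩ := h
    unfold tags at ih ⊢
    rw [List.filterMap_cons_some h1, List.length_cons, List.length_cons, ih h3]

theorem Represents.span_eq {X : Submodule (ZMod 2) (Vec n)} {T : List (Col n)}
    (h : Represents X T) :
    X ⊔ spanL (ZMod 2) (reps (tags T)) = X ⊔ spanL (ZMod 2) (vecs T) := by
  induction T generalizing X with
  | nil => rfl
  | cons d T ih =>
    obtain ⟨⟨x, h1, h2⟩, h3⟩ := h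
    have e : reps (tags (d :: T)) = x.rep :: reps (tags T) := by
      unfold tags reps
      rw [List.filterMap_cons_some h1, List.map_cons]
    rw [e, vecs_cons, spanL_cons, spanL_cons, ← sup_assoc, ← sup_assoc, ← ih h3,
      sup_span_congr h2]

theorem Represents.indepMod_iff {X : Submodule (ZMod 2) (Vec n)} {T : List (Col n)}
    (h : Represents X T) : IndepMod X (reps (tags T)) ↔ IndepMod X (vecs T) :=
  indepMod_congr h.span_eq (by simp [reps, vecs, h.length_tags])

/-- The elder rule: a column that is zeroed out is a sum of columns that are older. -/
theorem Represents.elder {X : Submodule (ZMod 2) (Vec n)} {T : List (Col n)}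
    (h : Represents X T)
    (hb : (tags T).Pairwise fun x y => y.birth ≤ x.birth) {c : Col n} (hc : c ∈ T)
    (h0 : c.vec = 0) {x : BarRep n} (hx : c.tag = some x) :
    x.rep ∈ X ⊔ Submodule.span (ZMod 2)
      {v | ∃ d ∈ T, d.vec ≠ 0 ∧ ∃ y, d.tag = some y ∧ x.birth ≤ y.birth ∧ v = y.rep} := by
  induction T generalizing X with
  | nil => simp at hc
  | cons d T ih =>
    obtain ⟨⟨y, h1, h2⟩, h3⟩ := h
    have e : tags (d :: T) = y :: tags T := List.filterMap_cons_some h1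
    rw [e, List.pairwise_cons] at hb
    rcases List.mem_cons.1 hc with rfl | hc
    · obtain rfl : x = y := Option.some_injective _ (hx.symm.trans h1)
      rw [h0, zero_sub, neg_mem_iff] at h2
      exact Submodule.mem_sup_left h2
    · have h4 := ih h3 hb.2 hc
      revert h4
      refine fun h4 => (sup_le ?_ ?_ : X ⊔ (ZMod 2) ∙ d.vec ⊔ Submodule.span (ZMod 2) _ ≤ _) h4
      · rw [sup_span_congr h2]
        refine sup_le le_sup_left ((Submodule.span_singleton_le_iff_mem _ _).2 ?_)
        by_cases hd : d.vec = 0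
        · rw [hd, zero_sub, neg_mem_iff] at h2
          exact Submodule.mem_sup_left h2
        · exact Submodule.mem_sup_right (Submodule.subset_span
            ⟨d, by simp, hd, y, h1, hb.1 x (mem_tags.2 ⟨c, hc, hx⟩), rfl⟩)
      · refine le_sup_of_le_right (Submodule.span_mono ?_)
        rintro v ⟨d', hd', hv⟩
        exact ⟨d', by simp [hd'], hv⟩

end Reduction

/-! ### Certificates for barcodes -/

section Alive

variable {n : ℕ}

/-- The bars of a list that are alive at index `i`. -/
def aliveAt (Q : List (BarRep n)) (i : ℕ) : List (BarRep n) :=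
  Q.filter fun x => decide (Alive (x.death, x.birth) i)

theorem mem_aliveAt {Q : List (BarRep n)} {i : ℕ} {x : BarRep n} :
    x ∈ aliveAt Q i ↔ x ∈ Q ∧ x.death < i ∧ i ≤ x.birth := by
  unfold aliveAt
  rw [List.mem_filter, decide_eq_true_iff]
  exact Iff.rfl

theorem aliveAt_append (Q Q' : List (BarRep n)) (i : ℕ) :
    aliveAt (Q ++ Q') i = aliveAt Q i ++ aliveAt Q' i := List.filter_append _ _

theorem mem_reps {Q : List (BarRep n)} {v : Vec n} : v ∈ reps Q ↔ ∃ x ∈ Q, x.rep = v :=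
  List.mem_map

theorem rep_mem_reps {Q : List (BarRep n)} {x : BarRep n} (h : x ∈ Q) : x.rep ∈ reps Q :=
  mem_reps.2 ⟨x, h, rfl⟩

@[simp] theorem reps_append (Q Q' : List (BarRep n)) : reps (Q ++ Q') = reps Q ++ reps Q' :=
  List.map_append

@[simp] theorem length_reps (Q : List (BarRep n)) : (reps Q).length = Q.length :=
  List.length_map _

theorem length_filter_lt_succ {α : Type*} (f : α → ℕ) (l : List α) (m : ℕ) :
    (l.filter fun x => f x < m + 1).length =
      (l.filter fun x => f x < m).length + (l.filter fun x => f x = m).length := by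
  simp only [← List.countP_eq_length_filter]
  induction l with
  | nil => rfl
  | cons x l ih =>
    simp only [List.countP_cons, ih, decide_eq_true_eq]
    split_ifs <;> omega

theorem card_subtype_get {α : Type*} (l : List α) (p : α → Prop) [DecidablePred p] :
    Fintype.card {j : Fin l.length // p (l.get j)} = (l.filter fun x => decide (p x)).length := by
  have h : (l.filter fun x => decide (p x)).length =
      ((List.finRange l.length).filter fun j => decide (p (l.get j))).length := by
    conv_lhs => rw [← List.map_get_finRange l, List.filter_map, List.length_map]
    rfl
  rw [h, ← List.toFinset_card_of_nodup ((List.nodup_finRange _).filter _), Fintype.card_subtype]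
  congr 1
  ext j; simp

theorem range_subtype_get {α β : Type*} (l : List α) (p : α → Prop) (f : α → β) :
    Set.range (fun j : {j : Fin l.length // p (l.get j)} => f (l.get j.1)) =
      {c | ∃ x ∈ l, p x ∧ c = f x} := by
  ext c
  constructor
  · rintro ⟨j, rfl⟩
    exact ⟨_, List.get_mem _ _, j.2, rfl⟩
  · rintro ⟨x, hx, hp, rfl⟩
    obtain ⟨j, rfl⟩ := List.get_of_mem hx
    exact ⟨⟨j, hp⟩, rfl⟩

theorem sum_subtype_eq_sum_dite {ι M : Type*} [Fintype ι] [AddCommMonoid M] (p : ι → Prop)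
    [DecidablePred p] (f : {j // p j} → M) :
    ∑ j, f j = ∑ j, if h : p j then f ⟨j, h⟩ else 0 := by
  have h1 : ∑ j, f j = ∑ j : {j // p j}, (fun j => if h : p j then f ⟨j, h⟩ else 0) j.1 :=
    Finset.sum_congr rfl fun j _ => by simp [j.2]
  rw [h1, ← Finset.sum_subtype (Finset.univ.filter p) (by simp)
    (fun j => if h : p j then f ⟨j, h⟩ else 0), Finset.sum_filter]
  refine Finset.sum_congr rfl fun j _ => ?_
  split_ifs <;> rfl

end Alive

namespace SimplexwiseFiltration

variable {V : Type u} [LinearOrder V] {n : ℕ} (F : SimplexwiseFiltration V n)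

/-- A list of bars with representatives that certifies a barcode of the persistence module
`i ↦ W i ⧸ Bc i` (with the maps induced by the inclusions): at each index the representatives
alive form a basis, and each representative becomes, at its death, a sum of representatives born
no later in the run of the algorithm (that is, at larger or equal indices). -/
structure IsElderBasis (W : ℕ → Submodule (ZMod 2) (Vec n)) (Q : List (BarRep n)) : Prop where
  bar : ∀ x ∈ Q, x.death < x.birth ∧ x.birth ≤ n
  span_eq : ∀ i ≤ n, F.Bc i ⊔ spanL (ZMod 2) (reps (aliveAt Q i)) = W i
  indep : ∀ i ≤ n, IndepMod (F.Bc i) (reps (aliveAt Q i))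
  elder : ∀ x ∈ Q, x.rep ∈ F.Bc x.death ⊔ Submodule.span (ZMod 2)
    {v | ∃ y ∈ aliveAt Q x.death, x.birth ≤ y.birth ∧ v = y.rep}

variable {F}

namespace IsElderBasis

variable {W : ℕ → Submodule (ZMod 2) (Vec n)} {Q : List (BarRep n)}

theorem mem (h : F.IsElderBasis W Q) {i : ℕ} {x : BarRep n} (hx : x ∈ aliveAt Q i) :
    x.rep ∈ W i := by
  have hi : i ≤ n := by
    obtain ⟨h1, _, h2⟩ := mem_aliveAt.1 hx
    exact h2.trans (h.bar x h1).2
  rw [← h.span_eq i hi]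
  exact Submodule.mem_sup_right (mem_spanL (rep_mem_reps hx))

/-- Bars dying at `d` account for new relations: coboundaries of `K_d` that do not come from
coboundaries of `K_{d+1}`. -/
theorem finrank_death (h : F.IsElderBasis W Q) {d : ℕ} (hd : d < n) :
    Module.finrank (ZMod 2) (F.Bc (d + 1)) + (Q.filter fun x => x.death = d).length ≤
      Module.finrank (ZMod 2) (F.Bc d) := by
  set L := aliveAt Q (d + 1) with hL
  set A := L.filter fun x => decide (x.death < d) with hA
  have hD : (L.filter fun x => !decide (x.death < d)) = Q.filter fun x => x.death = d := by
    rw [hL, aliveAt, List.filter_filter]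
    refine List.filter_congr fun x hx => ?_
    have := (h.bar x hx).1
    rw [Bool.eq_iff_iff]
    simp only [Bool.and_eq_true, Bool.not_eq_true', decide_eq_false_iff_not, decide_eq_true_eq]
    change ¬ x.death < d ∧ (x.death < d + 1 ∧ d + 1 ≤ x.birth) ↔ x.death = d
    omega
  have hperm := List.filter_append_perm (fun x : BarRep n => decide (x.death < d)) L
  rw [hD] at hperm
  have h1 : IndepMod (F.Bc (d + 1)) (reps (A ++ Q.filter fun x => x.death = d)) :=
    (indepMod_perm (hperm.map BarRep.rep)).2 (h.indep (d + 1) hd)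
  have h2 : F.Bc (d + 1) ⊔ spanL (ZMod 2) (reps (A ++ Q.filter fun x => x.death = d)) ≤
      F.Bc d ⊔ spanL (ZMod 2) (reps A) := by
    refine sup_le ((F.Bc_anti (Nat.le_succ d)).trans le_sup_left) (spanL_le.2 fun v hv => ?_)
    rw [reps_append, List.mem_append] at hv
    rcases hv with hv | hv
    · exact Submodule.mem_sup_right (mem_spanL hv)
    · obtain ⟨x, hx, rfl⟩ := mem_reps.1 hv
      obtain ⟨hxQ, hxd⟩ := List.mem_filter.1 hx
      rw [decide_eq_true_iff] at hxd
      have h3 := h.elder x hxQ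
      rw [hxd] at h3
      refine (sup_le_sup_left (Submodule.span_le.2 ?_) _ :
        F.Bc d ⊔ Submodule.span _ _ ≤ F.Bc d ⊔ spanL (ZMod 2) (reps A)) h3
      rintro v ⟨y, hy, hb, rfl⟩
      obtain ⟨hyQ, hy1, hy2⟩ := mem_aliveAt.1 hy
      refine mem_spanL (rep_mem_reps (List.mem_filter.2 ⟨mem_aliveAt.2 ⟨hyQ, ?_, ?_⟩, ?_⟩))
      · omega
      · have := (h.bar x hxQ).1
        omega
      · simpa using hy1
  have h3 := Submodule.finrank_mono h2
  have h4 := finrank_sup_spanL_le (F.Bc d) (reps A)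
  rw [h1, length_reps, List.length_append] at h3
  rw [length_reps] at h4
  omega

/-- There are at most `n` bars: sum up `finrank_death` over the death indices. -/
theorem length_le (h : F.IsElderBasis W Q) : Q.length ≤ n := by
  have key : ∀ m ≤ n, Module.finrank (ZMod 2) (F.Bc m) +
      (Q.filter fun x => x.death < m).length ≤ Module.finrank (ZMod 2) (F.Bc 0) := by
    intro m
    induction m with
    | zero => intro _; simp
    | succ m ih =>
      intro hm
      have h1 := ih (by omega)
      have h2 := h.finrank_death (d := m) hm
      have h3 : (Q.filter fun x => x.death < m + 1).length =
          (Q.filter fun x => x.death < m).length + (Q.filter fun x => x.death = m).length :=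
        length_filter_lt_succ BarRep.death Q m
      omega
  have h1 := key n le_rfl
  have h2 : Q.filter (fun x => x.death < n) = Q := List.filter_eq_self.2 fun x hx => by
    have := h.bar x hx
    simp only [decide_eq_true_eq]
    omega
  have h3 := Submodule.finrank_le (F.Bc 0)
  rw [h2] at h1
  simp at h3
  omega

end IsElderBasis

variable (F)

theorem liftSub_span {i : ℕ} {X : Set (Vec n)} (hX : X ⊆ F.Zc i) :
    F.liftSub i (Submodule.span (ZMod 2) (F.classAt i '' X)) =
      F.Bc i ⊔ Submodule.span (ZMod 2) X := by
  have hXZ : Submodule.span (ZMod 2) X ≤ F.Zc i := Submodule.span_le.2 hX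
  apply le_antisymm
  · have key : Submodule.span (ZMod 2) (F.classAt i '' X) ≤
        ((Submodule.span (ZMod 2) X).comap (F.Zc i).subtype).map (F.cls i) := by
      rw [Submodule.span_le]
      rintro _ ⟨x, hx, rfl⟩
      exact ⟨⟨x, hX hx⟩, Submodule.subset_span hx, (F.classAt_eq_cls _).symm⟩
    intro x hx
    obtain ⟨h1, h2⟩ := F.mem_liftSub.1 hx
    obtain ⟨⟨y, hy⟩, h3, h4⟩ := key h2
    rw [← F.classAt_eq_cls] at h4
    have h5 := (F.classAt_eq_classAt h1 hy).1 h4.symm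
    rw [← sub_add_cancel x y]
    exact Submodule.add_mem_sup h5 h3
  · refine sup_le (F.Bc_le_liftSub i _) (Submodule.span_le.2 fun x hx => ?_)
    exact F.mem_liftSub.2 ⟨hX hx, Submodule.subset_span ⟨x, hx, rfl⟩⟩

theorem liftSub_injective (i : ℕ) : Function.Injective (F.liftSub i) := by
  intro X Y h
  ext c
  obtain ⟨x, hx, rfl⟩ := F.exists_classAt_eq c
  have := SetLike.ext_iff.1 h x
  simpa [mem_liftSub, hx] using this

theorem indepMod_of_finrank {i : ℕ} {l : List (Vec n)}
    {X : Submodule (ZMod 2) (Cohomology (F.complex i))}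
    (hl : F.Bc i ⊔ spanL (ZMod 2) l = F.liftSub i X) :
    IndepMod (F.Bc i) l ↔ l.length = Module.finrank (ZMod 2) X := by
  unfold IndepMod
  rw [hl, finrank_liftSub]
  omega

variable {F}

/-- Replacing each representative by its difference with the older ones that cancel it at its death
gives generators of interval summands. -/
theorem IsElderBasis.exists_interval_reps {W : ℕ → Submodule (ZMod 2) (Vec n)}
    {Q : List (BarRep n)} (h : F.IsElderBasis W Q) :
    ∃ ρ : BarRep n → Vec n, (∀ x ∈ Q, ρ x ∈ F.Bc x.death) ∧
      ∀ i ≤ n, F.Bc i ⊔ Submodule.span (ZMod 2) (ρ '' {x | x ∈ aliveAt Q i}) = W i := by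
  have h1 : ∀ x, ∃ v, x ∈ Q → v ∈ F.Bc x.death ∧ x.rep - v ∈ Submodule.span (ZMod 2)
      {v | ∃ y ∈ aliveAt Q x.death, x.birth ≤ y.birth ∧ v = y.rep} := by
    intro x
    by_cases hx : x ∈ Q
    · obtain ⟨b, hb, s, hs, e⟩ := Submodule.mem_sup.1 (h.elder x hx)
      exact ⟨b, fun _ => ⟨hb, by rwa [← e, add_sub_cancel_left]⟩⟩
    · exact ⟨0, fun h => absurd h hx⟩
  choose ρ hρ using h1
  refine ⟨ρ, fun x hx => (hρ x hx).1, fun i hi => ?_⟩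
  -- a bar that is older than `x` and alive at the death of `x` is alive whenever `x` is
  have older : ∀ x ∈ aliveAt Q i, ∀ y ∈ aliveAt Q x.death, x.birth ≤ y.birth →
      y ∈ aliveAt Q i ∧ y.death < x.death := by
    intro x hx y hy hb
    obtain ⟨-, h2, h3⟩ := mem_aliveAt.1 hx
    obtain ⟨h4, h5, h6⟩ := mem_aliveAt.1 hy
    exact ⟨mem_aliveAt.2 ⟨h4, by omega, by omega⟩, h5⟩
  apply le_antisymm
  · refine sup_le (le_sup_left.trans (h.span_eq i hi).le) (Submodule.span_le.2 ?_)
    rintro _ ⟨x, hx, rfl⟩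
    have hx' : x ∈ aliveAt Q i := hx
    have h2 : x.rep - ρ x ∈ W i := by
      refine Submodule.span_le.2 ?_ (hρ x (mem_aliveAt.1 hx').1).2
      rintro v ⟨y, hy, hb, rfl⟩
      exact h.mem (older x hx' y hy hb).1
    have h3 := sub_mem (h.mem hx') h2
    rwa [sub_sub_cancel] at h3
  · rw [← h.span_eq i hi]
    refine sup_le le_sup_left (spanL_le.2 fun v hv => ?_)
    obtain ⟨x, hx, rfl⟩ := mem_reps.1 hv
    clear hv
    induction hd : x.death using Nat.strong_induction_on generalizing x with
    | _ d ih =>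
      subst hd
      rw [← add_sub_cancel (ρ x) x.rep]
      refine add_mem (Submodule.mem_sup_right (Submodule.subset_span ⟨x, hx, rfl⟩)) ?_
      refine Submodule.span_le.2 ?_ (hρ x (mem_aliveAt.1 hx).1).2
      rintro v ⟨y, hy, hb, rfl⟩
      obtain ⟨h2, h3⟩ := older x hx y hy hb
      exact ih y.death h3 y h2 rfl

/-- A list of bars as in `IsElderBasis` is a barcode of the persistent cup module. -/
theorem IsElderBasis.isBarcode {k : ℕ} {Q : List (BarRep n)}
    (h : F.IsElderBasis (F.Wc k) Q) : IsBarcode (F.kCupModule k) (barsOf Q) := by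
  obtain ⟨ρ, hρ, hspan⟩ := h.exists_interval_reps
  have hlen : (barsOf Q).length = Q.length := List.length_map _
  let q : Fin (barsOf Q).length → BarRep n := fun j => Q.get (j.cast hlen)
  have hq : ∀ j, (barsOf Q).get j = ((q j).death, (q j).birth) := fun j => by
    rw [List.get_eq_getElem]
    exact List.getElem_map _
  have hqQ : ∀ j, q j ∈ Q := fun j => List.get_mem _ _
  have hal : ∀ (i : ℕ) (j : {j : Fin (barsOf Q).length // Alive ((barsOf Q).get j) i}),
      q j.1 ∈ aliveAt Q i := by
    rintro i ⟨j, hj⟩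
    rw [hq j] at hj
    exact mem_aliveAt.2 ⟨hqQ j, hj⟩
  let φ : ∀ i : ℕ, ({j : Fin (barsOf Q).length // Alive ((barsOf Q).get j) i} → ZMod 2) →ₗ[ZMod 2]
      Cohomology (F.complex i) :=
    fun i => Fintype.linearCombination (ZMod 2) fun j => F.classAt i (ρ (q j.1))
  have himg : ∀ i : ℕ, Set.range (fun j : {j : Fin (barsOf Q).length //
      Alive ((barsOf Q).get j) i} => F.classAt i (ρ (q j.1))) =
        F.classAt i '' (ρ '' {x | x ∈ aliveAt Q i}) := by
    intro i
    ext c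
    constructor
    · rintro ⟨j, rfl⟩
      exact ⟨_, ⟨_, hal i j, rfl⟩, rfl⟩
    · rintro ⟨_, ⟨x, hx, rfl⟩, rfl⟩
      obtain ⟨hxQ, hx'⟩ := mem_aliveAt.1 hx
      obtain ⟨j, rfl⟩ := List.get_of_mem hxQ
      refine ⟨⟨j.cast hlen.symm, ?_⟩, rfl⟩
      rw [hq]
      exact hx'
  have hspanV : ∀ i ≤ n, Submodule.span (ZMod 2) (F.classAt i '' (ρ '' {x | x ∈ aliveAt Q i})) =
      kCupSpace (F.complex i) k := by
    intro i hi
    apply F.liftSub_injective i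
    rw [F.liftSub_span, hspan i hi]
    · rfl
    · intro v hv
      have : v ∈ F.Wc k i := by
        rw [← hspan i hi]
        exact Submodule.mem_sup_right (Submodule.subset_span hv)
      exact F.Wc_le_Zc k i this
  have hrange : ∀ i ≤ n, LinearMap.range (φ i) = kCupSpace (F.complex i) k := by
    intro i hi
    rw [Fintype.range_linearCombination, himg, hspanV i hi]
  have hinj : ∀ i ≤ n, Function.Injective (φ i) := by
    intro i hi
    have h1 : LinearIndependent (ZMod 2) fun j : {j : Fin (barsOf Q).length //
        Alive ((barsOf Q).get j) i} => F.classAt i (ρ (q j.1)) := by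
      rw [linearIndependent_iff_card_eq_finrank_span, himg, Set.finrank, hspanV i hi,
        ← (F.indepMod_of_finrank (h.span_eq i hi)).1 (h.indep i hi), length_reps,
        card_subtype_get (barsOf Q) fun b => Alive b i, barsOf, List.filter_map, List.length_map]
      rfl
    rw [← LinearMap.ker_eq_bot, LinearMap.ker_eq_bot']
    intro c hc
    funext j
    exact Fintype.linearIndependent_iff.1 h1 c hc j
  let e : ∀ i : Fin (n + 1), (intervalSum n (barsOf Q)).space i ≃ₗ[ZMod 2]
      kCupSpace (F.complex i.val) k := fun i =>
    (LinearEquiv.ofInjective (φ i.val) (hinj i (Nat.le_of_lt_succ i.2))).trans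
      (LinearEquiv.ofEq _ _ (hrange i (Nat.le_of_lt_succ i.2)))
  refine ⟨?_, fun i => (e i).symm, ?_⟩
  · rintro bar hb
    obtain ⟨x, hx, rfl⟩ := List.mem_map.1 hb
    exact h.bar x hx
  · intro i x
    refine (LinearEquiv.symm_apply_eq (e i.castSucc)).2 ?_
    obtain ⟨c, rfl⟩ := (e i.succ).surjective x
    have hc : (e i.succ).symm (e i.succ c) = c := LinearEquiv.symm_apply_apply _ _
    refine Eq.trans ?_ (congrArg (fun z => e i.castSucc ((intervalSum n (barsOf Q)).map i z)) hc.symm)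
    refine Subtype.ext ?_
    let c' : {j : Fin (barsOf Q).length // Alive ((barsOf Q).get j) (i.val + 1)} → ZMod 2 := c
    change restrictCohomology (F.complex_mono (Nat.le_succ i.val)) (φ (i.val + 1) c') =
      φ i.val fun j => if h' : Alive ((barsOf Q).get j.1) (i.val + 1) then c' ⟨j.1, h'⟩ else 0
    have hφ : ∀ (i : ℕ) c, φ i c = ∑ j, c j • F.classAt i (ρ (q j.1)) := fun i c =>
      Fintype.linearCombination_apply _ _ _
    rw [hφ, hφ, map_sum]
    have hZ : ∀ j : {j : Fin (barsOf Q).length // Alive ((barsOf Q).get j) (i.val + 1)},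
        ρ (q j.1) ∈ F.Zc (i.val + 1) := by
      intro j
      refine F.Wc_le_Zc k _ ?_
      rw [← hspan (i.val + 1) i.2]
      exact Submodule.mem_sup_right (Submodule.subset_span ⟨_, hal _ j, rfl⟩)
    rw [Finset.sum_congr rfl fun j _ => (map_smul _ (c' j) _).trans
      (congrArg (c' j • ·) (F.restrict_classAt (Nat.le_succ i.val) (hZ j))),
      sum_subtype_eq_sum_dite, sum_subtype_eq_sum_dite]
    refine Finset.sum_congr rfl fun j _ => ?_
    by_cases h1 : Alive ((barsOf Q).get j) (i.val + 1)
    · rw [dif_pos h1]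
      by_cases h2 : Alive ((barsOf Q).get j) i.val
      · rw [dif_pos h2, dif_pos h1]
      · rw [dif_neg h2, F.classAt_of_mem_Bc, smul_zero]
        refine F.Bc_anti ?_ (hρ _ (hqQ j))
        have h3 := hq j ▸ h1
        have h4 := hq j ▸ h2
        change i.val ≤ (q j).death
        unfold Alive at h3 h4
        dsimp only at h3 h4
        omega
    · rw [dif_neg h1]
      split_ifs
      · rw [zero_smul]
      · rfl

/-! ### Persistent cohomology bases as certificates -/

theorem classes_alive (F : SimplexwiseFiltration V n) (P : List (BarRep n)) (i : ℕ) :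
    {c | ∃ x ∈ P, Alive (x.death, x.birth) i ∧ c = F.classAt i x.rep} =
      F.classAt i '' {v | v ∈ reps (aliveAt P i)} := by
  ext c
  constructor
  · rintro ⟨x, hx, ha, rfl⟩
    exact ⟨x.rep, rep_mem_reps (mem_aliveAt.2 ⟨hx, ha⟩), rfl⟩
  · rintro ⟨v, hv, rfl⟩
    obtain ⟨x, hx, rfl⟩ := mem_reps.1 hv
    obtain ⟨hxP, ha⟩ := mem_aliveAt.1 hx
    exact ⟨x, hxP, ha, rfl⟩

namespace IsPersistentCohomologyBasis

variable {P : List (BarRep n)}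

theorem rep_mem_Zc (h : F.IsPersistentCohomologyBasis P) {i : ℕ} {x : BarRep n} (hx : x ∈ P)
    (hi : i ≤ x.birth) : x.rep ∈ F.Zc i := F.Zc_anti hi (h.cocycle x hx)

theorem rep_mem_Bc (h : F.IsPersistentCohomologyBasis P) {i : ℕ} {x : BarRep n} (hx : x ∈ P)
    (hi : i ≤ x.death) : x.rep ∈ F.Bc i := by
  rw [← F.classAt_eq_zero (h.rep_mem_Zc hx (hi.trans (h.bar x hx).1.le))]
  exact h.trivial x hx i hi

theorem isElderBasis (h : F.IsPersistentCohomologyBasis P) : F.IsElderBasis F.Zc P := by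
  have hspan : ∀ i ≤ n, F.Bc i ⊔ spanL (ZMod 2) (reps (aliveAt P i)) = F.liftSub i ⊤ := by
    intro i hi
    rw [← h.spanning i hi, F.classes_alive, F.liftSub_span]
    · rfl
    · intro v hv
      obtain ⟨x, hx, rfl⟩ := mem_reps.1 hv
      obtain ⟨hxP, ha⟩ := mem_aliveAt.1 hx
      exact h.rep_mem_Zc hxP ha.2
  refine ⟨h.bar, fun i hi => (hspan i hi).trans (F.liftSub_top i), fun i hi => ?_, fun x hx =>
    Submodule.mem_sup_left (h.rep_mem_Bc hx le_rfl)⟩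
  rw [F.indepMod_of_finrank (hspan i hi), ← h.spanning i hi, length_reps]
  have h1 := linearIndependent_iff_card_eq_finrank_span.1 (h.independent i hi)
  rw [card_subtype_get P fun x => Alive (x.death, x.birth) i] at h1
  rw [aliveAt, h1, Set.finrank]
  rw [range_subtype_get P (fun x => Alive (x.death, x.birth) i) fun x => F.classAt i x.rep]

/-- The bars of positive degree. -/
def _root_.positiveBars (P : List (BarRep n)) : List (BarRep n) := P.filter fun x => 0 < x.deg

theorem _root_.mem_positiveBars {P : List (BarRep n)} {x : BarRep n} :
    x ∈ positiveBars P ↔ x ∈ P ∧ 0 < x.deg := by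
  simp [positiveBars]

theorem span_degree_zero (h : F.IsPersistentCohomologyBasis P) {i : ℕ} {x : Vec n}
    (hx : x ∈ F.Wc 1 i) (hi : i ≤ n) :
    x ∈ F.Bc i ⊔ spanL (ZMod 2) (reps (aliveAt (positiveBars P) i)) := by
  obtain ⟨h1, h2⟩ := F.mem_Wc.1 hx
  -- the part of a vector on the vertices of `K_i`
  let ν : Vec n →ₗ[ZMod 2] Vec n :=
    { toFun := fun v j => if (F.simplex j).card = 1 ∧ j.val < i then v j else 0
      map_add' := by intro v w; funext j; dsimp only [Pi.add_apply]; split_ifs <;> simp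
      map_smul' := by
        intro c v; funext j; dsimp only [Pi.smul_apply, RingHom.id_apply]; split_ifs <;> simp }
  have hνB : F.Bc i ≤ LinearMap.ker ν := by
    intro b hb
    obtain ⟨e, he⟩ := F.mem_Bc.1 hb
    funext j
    change (if (F.simplex j).card = 1 ∧ j.val < i then b j else 0) = 0
    split_ifs with hj
    · rw [sub_mem_tail.1 he j hj.2, dl_apply]
      refine Finset.sum_eq_zero fun k _ => ?_
      rw [coboundaryMatrix_val, if_neg, zero_mul]
      rintro ⟨_, h3⟩
      have := (F.nonempty k).card_pos
      omega
    · rfl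
  -- modulo coboundaries, `x` vanishes on the vertices
  have hνx : ν x = 0 := by
    have key : F.liftSub i (positivePart (F.complex i)) ≤ LinearMap.ker ν := by
      have h3 : positivePart (F.complex i) ≤ Submodule.span (ZMod 2)
          (F.classAt i '' {v | v ∈ F.Zc i ∧ ν v = 0}) := by
        refine Submodule.span_le.2 ?_
        rintro _ ⟨⟨z, hz⟩, hz', rfl⟩
        obtain ⟨v, rfl⟩ := F.toCochainL_surjective i z
        refine Submodule.subset_span ⟨v, ⟨hz, ?_⟩, F.classAt_eq_mk hz⟩
        funext j
        change (if (F.simplex j).card = 1 ∧ j.val < i then v j else 0) = 0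
        split_ifs with hj
        · rw [← F.toCochain_simplex i v (F.simplex_mem hj.2)]
          exact hz' ⟨F.simplex j, F.simplex_mem hj.2⟩ hj.1
        · rfl
      intro y hy
      obtain ⟨h4, h5⟩ := F.mem_liftSub.1 hy
      have h6 := F.mem_liftSub.2 ⟨h4, h3 h5⟩
      rw [F.liftSub_span fun v hv => hv.1] at h6
      exact sup_le hνB (Submodule.span_le.2 fun v hv => hv.2) h6
    refine key (F.mem_liftSub.2 ⟨h1, ?_⟩)
    rwa [kCupSpace_one] at h2
  have h3 : x ∈ F.Bc i ⊔ spanL (ZMod 2) (reps (aliveAt P i)) := by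
    rw [h.isElderBasis.span_eq i hi]; exact h1
  -- split a combination of representatives into its parts of degree zero and of positive degree
  have h4 : spanL (ZMod 2) (reps (aliveAt P i)) ≤
      spanL (ZMod 2) (reps (aliveAt (positiveBars P) i)) ⊔
        spanL (ZMod 2) (reps (aliveAt (P.filter fun x => x.deg = 0) i)) := by
    refine spanL_le.2 fun v hv => ?_
    obtain ⟨y, hy, rfl⟩ := mem_reps.1 hv
    obtain ⟨hyP, ha⟩ := mem_aliveAt.1 hy
    rcases Nat.eq_zero_or_pos y.deg with hd | hd
    · exact Submodule.mem_sup_right (mem_spanL (rep_mem_reps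
        (mem_aliveAt.2 ⟨List.mem_filter.2 ⟨hyP, by simpa using hd⟩, ha⟩)))
    · exact Submodule.mem_sup_left (mem_spanL (rep_mem_reps
        (mem_aliveAt.2 ⟨mem_positiveBars.2 ⟨hyP, hd⟩, ha⟩)))
  obtain ⟨b, hb, s, hs, rfl⟩ := Submodule.mem_sup.1 h3
  obtain ⟨p, hp, z, hz, rfl⟩ := Submodule.mem_sup.1 (h4 hs)
  have hpos : spanL (ZMod 2) (reps (aliveAt (positiveBars P) i)) ≤ LinearMap.ker ν := by
    refine spanL_le.2 fun v hv => ?_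
    obtain ⟨y, hy, rfl⟩ := mem_reps.1 hv
    obtain ⟨hyP, hd⟩ := mem_positiveBars.1 (mem_aliveAt.1 hy).1
    funext j
    change (if (F.simplex j).card = 1 ∧ j.val < i then y.rep j else 0) = 0
    split_ifs with hj
    · by_contra h5
      have := h.homogeneous y hyP j h5
      omega
    · rfl
  have hzero : spanL (ZMod 2) (reps (aliveAt (P.filter fun x => x.deg = 0) i)) ≤
      (LinearMap.ker (LinearMap.id - ν)) ⊔ tail n i := by
    refine spanL_le.2 fun v hv => ?_
    obtain ⟨y, hy, rfl⟩ := mem_reps.1 hv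
    obtain ⟨hyP, hd⟩ := List.mem_filter.1 (mem_aliveAt.1 hy).1
    rw [← add_sub_cancel (ν y.rep) y.rep]
    refine Submodule.add_mem_sup ?_ ?_
    · funext j
      change (if (F.simplex j).card = 1 ∧ j.val < i then y.rep j else 0) -
        (if (F.simplex j).card = 1 ∧ j.val < i then
          (if (F.simplex j).card = 1 ∧ j.val < i then y.rep j else 0) else 0) = 0
      split_ifs <;> simp
    · rw [sub_mem_tail]
      intro j hj
      change y.rep j = if (F.simplex j).card = 1 ∧ j.val < i then y.rep j else 0
      split_ifs with h5
      · rfl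
      · by_contra h6
        have := h.homogeneous y hyP j h6
        have hd' : y.deg = 0 := by simpa using hd
        rw [hd'] at this
        exact h5 ⟨this, hj⟩
  have hz0 : ν z = 0 := by
    have h5 : ν b = 0 := hνB hb
    have h6 : ν p = 0 := hpos hp
    rw [map_add, map_add, h5, h6, zero_add, zero_add] at hνx
    exact hνx
  obtain ⟨z1, hz1, t, ht, rfl⟩ := Submodule.mem_sup.1 (hzero hz)
  have hz1' : z1 - ν z1 = 0 := hz1
  have ht0 : ν t = 0 := hνB (F.tail_le_Bc i ht)
  rw [map_add, ht0, add_zero] at hz0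
  rw [hz0, sub_zero] at hz1'
  rw [hz1', zero_add, add_comm p t, ← add_assoc]
  exact Submodule.add_mem_sup (add_mem hb (F.tail_le_Bc i ht)) hp

/-- The bars of positive degree certify the barcode of the cohomology of positive degree. -/
theorem isElderBasis_positiveBars (h : F.IsPersistentCohomologyBasis P) :
    F.IsElderBasis (F.Wc 1) (positiveBars P) := by
  refine ⟨fun x hx => h.bar x (mem_positiveBars.1 hx).1, fun i hi => ?_, fun i hi => ?_,
    fun x hx => Submodule.mem_sup_left (h.rep_mem_Bc (mem_positiveBars.1 hx).1 le_rfl)⟩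
  · refine le_antisymm (sup_le (F.Bc_le_Wc 1 i) (spanL_le.2 fun v hv => ?_))
      fun x hx => h.span_degree_zero hx hi
    obtain ⟨y, hy, rfl⟩ := mem_reps.1 hv
    obtain ⟨hyP, ha⟩ := mem_aliveAt.1 hy
    obtain ⟨hyP, hd⟩ := mem_positiveBars.1 hyP
    have hz := h.rep_mem_Zc hyP ha.2
    refine F.mem_Wc.2 ⟨hz, ?_⟩
    rw [kCupSpace_one, F.classAt_eq_mk hz]
    refine Submodule.subset_span ⟨_, ?_, rfl⟩
    rintro ⟨s, j, hj, hs⟩ hc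
    subst hs
    change F.toCochain i y.rep ⟨F.simplex j, F.simplex_mem hj⟩ = 0
    rw [toCochain_simplex]
    by_contra h5
    have := h.homogeneous y hyP j h5
    change (F.simplex j).card = 1 at hc
    omega
  · exact (h.isElderBasis.indep i hi).sublist ((List.filter_sublist.filter _).map _)

end IsPersistentCohomologyBasis

end SimplexwiseFiltration

/-! ### Testing products -/

section Head

variable {n : ℕ}

/-- The vectors supported on the simplices of `K_i`. -/
def head (n i : ℕ) : Submodule (ZMod 2) (Vec n) where
  carrier := {x | ∀ j : Fin n, i ≤ j.val → x j = 0}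
  add_mem' hx hy j hj := by rw [Pi.add_apply, hx j hj, hy j hj, add_zero]
  zero_mem' _ _ := rfl
  smul_mem' c x hx j hj := by rw [Pi.smul_apply, hx j hj, smul_zero]

theorem mem_inf_of_head {i : ℕ} {U : Submodule (ZMod 2) (Vec n)} (hU : U ≤ head n i) :
    head n i ⊓ (SimplexwiseFiltration.tail n i ⊔ U) ≤ U := by
  rintro x ⟨hx, hx'⟩
  obtain ⟨t, ht, u, hu, rfl⟩ := Submodule.mem_sup.1 hx'
  have : t = 0 := by
    funext j
    rcases lt_or_ge j.val i with hj | hj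
    · exact ht j hj
    · have h1 := hx j hj
      rw [Pi.add_apply, hU hu j hj, add_zero] at h1
      exact h1
  rwa [this, zero_add]

theorem IndepMod.ne_zero {K E : Type*} [Field K] [AddCommGroup E] [Module K E]
    [FiniteDimensional K E] {B : Submodule K E} {l : List E} (h : IndepMod B l) {x : E}
    (hx : x ∈ l) : x ≠ 0 := by
  rintro rfl
  have := h.sublist (List.singleton_sublist.2 hx)
  exact (indepMod_cons.1 this).1 (zero_mem _)

end Head

namespace SimplexwiseFiltration

variable {V : Type u} [LinearOrder V] {n : ℕ} (F : SimplexwiseFiltration V n)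

/-- The state of the matrix while products are tested at index `l`: the columns `U` of coboundaries,
the older annotated columns `T`, and new nonzero columns whose representatives lie in `W`. -/
structure Testing (l : ℕ) (W : Submodule (ZMod 2) (Vec n)) (U T N : List (Col n)) : Prop where
  reduced : Reduced (U ++ (T ++ N))
  supp : spanL (ZMod 2) (vecs (U ++ (T ++ N))) ≤ head n l
  repr : Represents (F.Bc l) (T ++ N)
  new : ∀ c ∈ N, c.low ≠ none ∧ ∃ x, c.tag = some x ∧ x.death = 0 ∧ x.birth = l ∧ x.rep ∈ W

variable {F}

theorem Testing.length_le {l : ℕ} {W : Submodule (ZMod 2) (Vec n)} {U T N : List (Col n)}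
    (h : F.Testing l W U T N) (hU : U.length = n) (hT : T.length ≤ n) :
    (U ++ (T ++ N)).length ≤ 3 * n := by
  have h1 := h.reduced
  rw [← List.append_assoc] at h1
  have h2 := (h1.indepMod fun c hc => (h.new c hc).1).length_le
  simp only [vecs, List.length_map, Module.finrank_fintype_fun_eq_card, Fintype.card_fin] at h2
  simp only [List.length_append]
  omega

theorem tryProduct_spec {l : ℕ} {W : Submodule (ZMod 2) (Vec n)} {U T N : List (Col n)}
    (h : F.Testing l W U T N) (hU : spanL (ZMod 2) (vecs U) ≤ F.Bc l)
    (x y : BarRep n) (hz : F.cupE l x.rep y.rep ∈ W) :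
    ∃ N', (tryProduct F.faceTable.val l (U ++ (T ++ N)) x y).val = U ++ (T ++ N') ∧
      F.Testing l W U T N' ∧
      spanL (ZMod 2) (vecs (U ++ (T ++ N))) ≤ spanL (ZMod 2) (vecs (U ++ (T ++ N'))) ∧
      F.cupE l x.rep y.rep ∈ spanL (ZMod 2) (vecs (U ++ (T ++ N'))) := by
  set S := U ++ (T ++ N) with hS
  set z := F.cupE l x.rep y.rep with hzdef
  have hval : (tryProduct F.faceTable.val l S x y).val =
      match (lowVec (reduceVec S z).val).val with
      | none => S
      | some r => S ++ [⟨(reduceVec S z).val, some r, some ⟨0, l, x.deg + y.deg, z⟩⟩] := by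
    change (match (lowVec (reduceVec S (cupVec F.faceTable.val l x.rep y.rep).val).val).val with
      | none => pure S
      | some r => pure (S ++ [⟨(reduceVec S (cupVec F.faceTable.val l x.rep y.rep).val).val, some r,
          some ⟨0, l, x.deg + y.deg, (cupVec F.faceTable.val l x.rep y.rep).val⟩⟩]) :
        Timed (List (Col n))).val = _
    rw [F.cupVec_val]
    cases (lowVec (reduceVec S z).val).val <;> rfl
  set w := (reduceVec S z).val with hw
  have hwz : w - z ∈ spanL (ZMod 2) (vecs S) := by
    rw [hw, reduceVec_val]; exact foldl_reduceStep_sub_mem S z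
  cases hr : (lowVec w).val with
  | none =>
    rw [hr] at hval
    refine ⟨N, hval, h, le_rfl, ?_⟩
    rw [lowVec_eq_none.1 hr, zero_sub, neg_mem_iff] at hwz
    exact hwz
  | some r =>
    rw [hr] at hval
    set c : Col n := ⟨w, some r, some ⟨0, l, x.deg + y.deg, z⟩⟩ with hc
    have e : U ++ (T ++ (N ++ [c])) = S ++ [c] := by simp [hS]
    have hzl : z ∈ head n l := fun j hj => F.cupE_support _ _ hj
    have hwl : w ∈ head n l := by
      rw [← sub_add_cancel w z]; exact add_mem (h.supp hwz) hzl
    have hred := h.reduced.append_reduceVec z (some ⟨0, l, x.deg + y.deg, z⟩)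
    rw [← hw, hr] at hred
    refine ⟨N ++ [c], by rw [hval, e], ⟨by rw [e]; exact hred, ?_, ?_, ?_⟩, ?_, ?_⟩
    · rw [e, vecs_append, spanL_append]
      refine sup_le h.supp (spanL_le.2 fun v hv => ?_)
      have : v = w := by simpa [hc] using hv
      rw [this]; exact hwl
    · rw [← List.append_assoc]
      refine h.repr.append (x := ⟨0, l, x.deg + y.deg, z⟩) rfl ?_
      have h1 : spanL (ZMod 2) (vecs S) ≤ F.Bc l ⊔ spanL (ZMod 2) (vecs (T ++ N)) := by
        rw [hS, vecs_append U, spanL_append]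
        exact sup_le (hU.trans le_sup_left) le_sup_right
      exact h1 hwz
    · intro d hd
      rcases List.mem_append.1 hd with hd | hd
      · exact h.new d hd
      · rw [List.mem_singleton.1 hd]
        exact ⟨by simp [hc], _, rfl, rfl, rfl, hz⟩
    · rw [e]
      exact spanL_mono fun v hv => by rw [vecs_append S]; exact List.mem_append_left _ hv
    · rw [e, vecs_append, spanL_append, ← sub_sub_cancel w z]
      exact sub_mem (Submodule.mem_sup_right (mem_spanL (by simp [hc])))
        (Submodule.mem_sup_left hwz)

theorem tryProduct_time_le {l : ℕ} {S : List (Col n)} (hS : S.length ≤ 3 * n) (hn : 0 < n)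
    (x y : BarRep n) : (tryProduct F.faceTable.val l S x y).time ≤ 21 * n ^ 2 := by
  have h1 := F.cupVec_time_le l x.rep y.rep
  set z := (cupVec F.faceTable.val l x.rep y.rep).val with hz
  have h2 := reduceVec_time_le S z
  have h3 := lowVec_time_le (reduceVec S z).val
  have h4 : (tryProduct F.faceTable.val l S x y).time =
      (cupVec F.faceTable.val l x.rep y.rep).time + ((reduceVec S z).time +
        ((lowVec (reduceVec S z).val).time + (n + 1 + 0))) := by
    change _ + (_ + (_ + (_ + (match (lowVec (reduceVec S z).val).val with
      | none => pure S
      | some r => pure (S ++ [⟨(reduceVec S z).val, some r, some ⟨0, l, x.deg + y.deg, z⟩⟩]) :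
        Timed (List (Col n))).time))) = _
    cases (lowVec (reduceVec S z).val).val <;> rfl
  have h5 := Nat.mul_le_mul_right (2 * n + 2) hS
  rw [h4]
  have h6 : n ≤ n ^ 2 := Nat.le_self_pow (by norm_num) n
  have h7 : 1 ≤ n ^ 2 := Nat.one_le_pow _ _ hn
  nlinarith

/-- Testing the products of one representative with all those of a list. -/
theorem foldT_tryProduct_spec {l : ℕ} {W : Submodule (ZMod 2) (Vec n)} {U T N : List (Col n)}
    (h : F.Testing l W U T N) (hU : spanL (ZMod 2) (vecs U) ≤ F.Bc l) (hUn : U.length = n)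
    (hTn : T.length ≤ n) (hn : 0 < n) (x : BarRep n) (L : List (BarRep n))
    (hL : L.length ≤ n) (hz : ∀ y ∈ L, F.cupE l x.rep y.rep ∈ W) :
    ∃ N', (foldT (fun S y => tryProduct F.faceTable.val l S x y) (U ++ (T ++ N)) L).val =
        U ++ (T ++ N') ∧
      F.Testing l W U T N' ∧
      spanL (ZMod 2) (vecs (U ++ (T ++ N))) ≤ spanL (ZMod 2) (vecs (U ++ (T ++ N'))) ∧
      (∀ y ∈ L, F.cupE l x.rep y.rep ∈ spanL (ZMod 2) (vecs (U ++ (T ++ N')))) ∧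
      (foldT (fun S y => tryProduct F.faceTable.val l S x y) (U ++ (T ++ N)) L).time ≤
        22 * n ^ 3 := by
  obtain ⟨⟨N', h1, h2, h3, h4⟩, h5⟩ := foldT_induction
    (f := fun S y => tryProduct F.faceTable.val l S x y) (l := L) (b := U ++ (T ++ N))
    (fun done S => ∃ N', S = U ++ (T ++ N') ∧ F.Testing l W U T N' ∧
      spanL (ZMod 2) (vecs (U ++ (T ++ N))) ≤ spanL (ZMod 2) (vecs (U ++ (T ++ N'))) ∧
      ∀ y ∈ done, F.cupE l x.rep y.rep ∈ spanL (ZMod 2) (vecs (U ++ (T ++ N'))))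
    (fun _ => 21 * n ^ 2) ⟨N, rfl, h, le_rfl, by simp⟩ (by
      rintro done y rest e _ ⟨N1, rfl, h1, h2, h3⟩
      obtain ⟨N2, h4, h5, h6, h7⟩ := tryProduct_spec h1 hU x y (hz y (by simp [e]))
      refine ⟨⟨N2, h4, h5, h2.trans h6, ?_⟩,
        tryProduct_time_le (h1.length_le hUn hTn) hn x y⟩
      intro y' hy'
      rcases List.mem_append.1 hy' with hy' | hy'
      · exact h6 (h3 y' hy')
      · rw [List.mem_singleton.1 hy']; exact h7)
  refine ⟨N', h1, h2, h3, h4, h5.trans ?_⟩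
  rw [List.map_const', List.sum_replicate, smul_eq_mul]
  refine (Nat.mul_le_mul_right _ hL).trans ?_
  have h7 : n ≤ n ^ 3 := Nat.le_self_pow (by norm_num) n
  nlinarith

/-! ### The lists of live representatives -/

/-- The list `H` consists of the representatives of the bars of `P` that are born at `b` or above,
up to entries that do not matter in `K_l`; bars with death index at least `l` may be missing. -/
structure Tracks (P H : List (BarRep n)) (b l : ℕ) : Prop where
  sound : ∀ y ∈ H, ∃ p ∈ P, b ≤ p.birth ∧ y.rep - p.rep ∈ tail n l ∧ y.death = p.death
  complete : ∀ p ∈ P, p.death < l → b ≤ p.birth →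
    ∃ y ∈ H, y.rep - p.rep ∈ tail n l ∧ y.death = p.death
  length : H.length ≤ (P.filter fun x => b ≤ x.birth).length

theorem Tracks.length_le {P H : List (BarRep n)} {b l : ℕ} (h : Tracks P H b l) :
    H.length ≤ P.length := h.length.trans (List.length_filter_le _ _)

theorem Tracks.append {P H : List (BarRep n)} {l : ℕ} (h : Tracks P H (min (l + 1) n) l)
    (hl : l < n) : Tracks P (H ++ P.filter fun x => x.birth = l) l l := by
  rw [min_eq_left hl] at h
  refine ⟨fun y hy => ?_, fun p hp h1 h2 => ?_, ?_⟩
  · rcases List.mem_append.1 hy with hy | hy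
    · obtain ⟨p, h1, h2, h3⟩ := h.sound y hy
      exact ⟨p, h1, by omega, h3⟩
    · obtain ⟨h1, h2⟩ := List.mem_filter.1 hy
      rw [decide_eq_true_iff] at h2
      exact ⟨y, h1, h2.ge, by rw [sub_self]; exact zero_mem _, rfl⟩
  · rcases h2.eq_or_lt with h2 | h2
    · exact ⟨p, List.mem_append_right _ (List.mem_filter.2 ⟨hp, by simp [h2]⟩),
        by rw [sub_self]; exact zero_mem _, rfl⟩
    · obtain ⟨y, h3, h4⟩ := h.complete p hp h1 h2
      exact ⟨y, List.mem_append_left _ h3, h4⟩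
  · have h1 := h.length
    have h2 : (P.filter fun x => l ≤ x.birth).length =
        (P.filter fun x => l + 1 ≤ x.birth).length + (P.filter fun x => x.birth = l).length := by
      simp only [← List.countP_eq_length_filter]
      clear h h1
      induction P with
      | nil => rfl
      | cons x P ih =>
        simp only [List.countP_cons, ih, decide_eq_true_eq]
        split_ifs <;> omega
    rw [List.length_append, h2]
    omega

theorem Tracks.restrict {P H : List (BarRep n)} {b l : ℕ} (h : Tracks P H b l)
    {f : BarRep n → BarRep n} (h1 : ∀ x, (f x).rep - x.rep ∈ tail n l)
    (h2 : ∀ x, (f x).death = x.death) : Tracks P (H.map f) b l := by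
  refine ⟨fun y hy => ?_, fun p hp h3 h4 => ?_, by simpa using h.length⟩
  · obtain ⟨x, hx, rfl⟩ := List.mem_map.1 hy
    obtain ⟨p, h3, h4, h5, h6⟩ := h.sound x hx
    refine ⟨p, h3, h4, ?_, (h2 x).trans h6⟩
    rw [← sub_add_sub_cancel _ x.rep]
    exact add_mem (h1 x) h5
  · obtain ⟨y, h5, h6, h7⟩ := h.complete p hp h3 h4
    refine ⟨f y, List.mem_map.2 ⟨y, h5, rfl⟩, ?_, (h2 y).trans h7⟩
    rw [← sub_add_sub_cancel _ y.rep]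
    exact add_mem (h1 y) h6

theorem Tracks.filter {P H : List (BarRep n)} {b l : ℕ} (h : Tracks P H b (l + 1))
    {p : BarRep n → Bool} (hp : ∀ y, y.death ≠ l + 1 → p y = true) :
    Tracks P (H.filter p) b l := by
  refine ⟨fun y hy => ?_, fun x hx h3 h4 => ?_, (List.length_filter_le _ _).trans h.length⟩
  · obtain ⟨x, h3, h4, h5, h6⟩ := h.sound y (List.mem_filter.1 hy).1
    exact ⟨x, h3, h4, tail_anti (Nat.le_succ l) h5, h6⟩
  · obtain ⟨y, h5, h6, h7⟩ := h.complete x hx (by omega) h4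
    exact ⟨y, List.mem_filter.2 ⟨h5, hp y (by omega)⟩, tail_anti (Nat.le_succ l) h6, h7⟩

theorem tracks_initial {P : List (BarRep n)} (hP : ∀ x ∈ P, x.birth ≤ n) :
    Tracks P (P.filter fun x => x.birth = n) n n := by
  refine ⟨fun y hy => ?_, fun p hp _ h2 => ?_, le_of_eq (congrArg _ ?_)⟩
  · obtain ⟨h1, h2⟩ := List.mem_filter.1 hy
    rw [decide_eq_true_iff] at h2
    exact ⟨y, h1, h2.ge, by rw [sub_self]; exact zero_mem _, rfl⟩
  · exact ⟨p, List.mem_filter.2 ⟨hp, by simpa using le_antisymm (hP p hp) h2⟩,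
      by rw [sub_self]; exact zero_mem _, rfl⟩
  · refine List.filter_congr fun x hx => ?_
    have := hP x hx
    rw [decide_eq_decide]
    omega

theorem IsElderBasis.mem_of_le {k : ℕ} {Q : List (BarRep n)} (h : F.IsElderBasis (F.Wc k) Q)
    {i : ℕ} {x : BarRep n} (hx : x ∈ Q) (hi : i ≤ x.birth) : x.rep ∈ F.Wc k i :=
  F.Wc_anti k hi (h.mem (mem_aliveAt.2 ⟨hx, (h.bar x hx).1, le_rfl⟩))

theorem Tracks.mem_Wc {k : ℕ} {Q R : List (BarRep n)} {b l : ℕ} (h : Tracks Q R b l)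
    (hQ : F.IsElderBasis (F.Wc k) Q) (hb : l ≤ b) {y : BarRep n} (hy : y ∈ R) :
    y.rep ∈ F.Wc k l := by
  obtain ⟨p, h1, h2, h3, -⟩ := h.sound y hy
  rw [← sub_add_cancel y.rep p.rep]
  exact add_mem (F.Bc_le_Wc k l (F.tail_le_Bc l h3)) (hQ.mem_of_le h1 (hb.trans h2))

theorem cupE_mem_Wc_swap {k l : ℕ} (hk : 1 ≤ k) {x y : Vec n} (hx : x ∈ F.Wc 1 l)
    (hy : y ∈ F.Wc k l) : F.cupE l y x ∈ F.Wc (k + 1) l := by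
  rw [← sub_add_cancel (F.cupE l y x) (F.cupE l x y)]
  exact add_mem (F.Bc_le_Wc _ l (F.cupE_comm (F.Wc_le_Zc k l hy) (F.Wc_le_Zc 1 l hx)))
    (F.cupE_mem_Wc hk hx hy)

/-- New products in `K_l` are products in which at least one factor is new. -/
theorem Wc_succ_le {k l : ℕ} (hk : 1 ≤ k) (hl : l ≤ n) {P Q : List (BarRep n)}
    (hP : F.IsElderBasis (F.Wc 1) P) (hQ : F.IsElderBasis (F.Wc k) Q)
    {X : Submodule (ZMod 2) (Vec n)} (hB : F.Bc l ≤ X)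
    (hprev : l < n → F.Wc (k + 1) (l + 1) ≤ X)
    (hnew : ∀ p ∈ P, ∀ q ∈ Q, p.death < l → q.death < l → l ≤ p.birth → l ≤ q.birth →
      p.birth = l ∨ q.birth = l → F.cupE l p.rep q.rep ∈ X) : F.Wc (k + 1) l ≤ X := by
  rw [F.Wc_succ_eq_span hk (hP.span_eq l hl) (hQ.span_eq l hl)]
  refine sup_le hB (Submodule.span_le.2 ?_)
  rintro _ ⟨_, hx, _, hy, rfl⟩
  obtain ⟨p, hp, rfl⟩ := mem_reps.1 hx
  obtain ⟨q, hq, rfl⟩ := mem_reps.1 hy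
  obtain ⟨hp1, hp2, hp3⟩ := mem_aliveAt.1 hp
  obtain ⟨hq1, hq2, hq3⟩ := mem_aliveAt.1 hq
  by_cases h : p.birth = l ∨ q.birth = l
  · exact hnew p hp1 q hq1 hp2 hq2 hp3 hq3 h
  · rw [not_or] at h
    have h1 := (hP.bar p hp1).2
    have h2 : F.cupE (l + 1) p.rep q.rep ∈ X := hprev (by omega) (F.cupE_mem_Wc hk
      (hP.mem_of_le hp1 (by omega)) (hQ.mem_of_le hq1 (by omega)))
    have h3 := hB (F.tail_le_Bc l (F.cupE_restrict (Nat.le_succ l) p.rep q.rep))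
    have h4 := sub_mem h2 h3
    rwa [sub_sub_cancel] at h4

end SimplexwiseFiltration

/-! ### The main loop -/

namespace SimplexwiseFiltration

variable {V : Type u} [LinearOrder V] {n : ℕ} {F : SimplexwiseFiltration V n}

/-- A partial certificate, for the indices from `m` on: `O` are the bars that have been output, `L`
the bars that have not died yet (with provisional death index `0`), oldest first. -/
structure Certified (F : SimplexwiseFiltration V n) (W : ℕ → Submodule (ZMod 2) (Vec n)) (m : ℕ)
    (O L : List (BarRep n)) : Prop where
  live : ∀ x ∈ L, x.death = 0 ∧ m ≤ x.birth ∧ x.birth ≤ n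
  sorted : L.Pairwise fun x y => y.birth ≤ x.birth
  dead : ∀ x ∈ O, m ≤ x.death ∧ x.death < x.birth ∧ x.birth ≤ n
  span_eq : ∀ i, m ≤ i → i ≤ n → F.Bc i ⊔ spanL (ZMod 2) (reps (aliveAt (O ++ L) i)) = W i
  indep : ∀ i, m ≤ i → i ≤ n → IndepMod (F.Bc i) (reps (aliveAt (O ++ L) i))
  elder : ∀ x ∈ O, x.rep ∈ F.Bc x.death ⊔ Submodule.span (ZMod 2)
    {v | ∃ y ∈ aliveAt (O ++ L) x.death, x.birth ≤ y.birth ∧ v = y.rep}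

namespace Certified

variable {W : ℕ → Submodule (ZMod 2) (Vec n)} {m : ℕ} {O L : List (BarRep n)}

theorem aliveAt_eq (h : Certified F W m O L) (hm : 0 < m) : aliveAt (O ++ L) m = L := by
  have h1 : aliveAt O m = [] := List.filter_eq_nil_iff.2 fun x hx => by
    have := (h.dead x hx).1
    rw [decide_eq_true_iff]
    rintro ⟨h2, -⟩
    exact absurd h2 (not_lt.2 this)
  have h2 : aliveAt L m = L := List.filter_eq_self.2 fun x hx => by
    have := h.live x hx
    rw [decide_eq_true_iff]
    exact ⟨by change x.death < m; omega, this.2.1⟩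
  rw [aliveAt_append, h1, h2, List.nil_append]

theorem span_live (h : Certified F W m O L) (hm : 0 < m) (hmn : m ≤ n) :
    F.Bc m ⊔ spanL (ZMod 2) (reps L) = W m := by
  rw [← h.span_eq m le_rfl hmn, h.aliveAt_eq hm]

theorem indep_live (h : Certified F W m O L) (hm : 0 < m) : IndepMod (F.Bc m) (reps L) := by
  rcases le_or_gt m n with hmn | hmn
  · have := h.indep m le_rfl hmn
    rwa [h.aliveAt_eq hm] at this
  · have : L = [] := by
      cases L with
      | nil => rfl
      | cons x L =>
        have := h.live x (by simp)
        omega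
    rw [this]
    exact indepMod_nil _

theorem length_live_le (h : Certified F W m O L) (hm : 0 < m) : L.length ≤ n := by
  have := (h.indep_live hm).length_le
  simpa using this

theorem rep_mem (h : Certified F W m O L) (hm : 0 < m) {x : BarRep n} (hx : x ∈ L) :
    x.rep ∈ W m := by
  have h1 := h.live x hx
  rw [← h.span_live hm (h1.2.1.trans h1.2.2)]
  exact Submodule.mem_sup_right (mem_spanL (rep_mem_reps hx))

/-- Passing from index `l + 1` to index `l`: the annotated columns `T` that have been zeroed out are
output with death index `l`. The representatives `L` alive at `l + 1` and the new ones `M` generate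
`W l` modulo `Bc l`, the columns that remain are independent, and the elder rule accounts for the
others. -/
theorem step {l : ℕ} (h : Certified F W (l + 1) O L) (hl : 0 < l) (hln : l ≤ n)
    (hWB : ∀ i, F.Bc i ≤ W i) (hWa : ∀ i, W (i + 1) ≤ W i) {T : List (Col n)}
    {M : List (BarRep n)} (hT : Represents (F.Bc l) T) (htags : tags T = L ++ M)
    (hM : ∀ x ∈ M, x.death = 0 ∧ x.birth = l ∧ x.rep ∈ W l)
    (hW : ∀ X, F.Bc l ≤ X → (l < n → W (l + 1) ≤ X) → spanL (ZMod 2) (vecs T) ≤ X → W l ≤ X)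
    {z : Col n → Bool} (hz : ∀ c ∈ T, z c = true ↔ c.vec = 0)
    (hzM : ∀ c ∈ T, c.vec = 0 → ∀ x, c.tag = some x → l < x.birth)
    (hind : IndepMod (F.Bc l) (vecs (T.filter fun c => !z c))) :
    Certified F W l (O ++ (tags (T.filter z)).map fun x => { x with death := l })
      (tags (T.filter fun c => !z c)) := by
  set Z := tags (T.filter z) with hZ
  set K := tags (T.filter fun c => !z c) with hK
  set D := Z.map (fun x : BarRep n => ({ x with death := l } : BarRep n)) with hD
  have hLM : ∀ x ∈ L ++ M, x.death = 0 ∧ l ≤ x.birth ∧ x.birth ≤ n ∧ x.rep ∈ W l := by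
    intro x hx
    rcases List.mem_append.1 hx with hx | hx
    · have := h.live x hx
      exact ⟨this.1, by omega, this.2.2, hWa l (h.rep_mem l.succ_pos hx)⟩
    · have := hM x hx
      exact ⟨this.1, by omega, by omega, this.2.2⟩
  have hperm : (Z ++ K).Perm (L ++ M) := by
    rw [← htags, hZ, hK, ← tags_append]
    exact (List.filter_append_perm z T).filterMap _
  have hKsub : K.Sublist (L ++ M) := by
    rw [← htags]; exact List.filter_sublist.filterMap _
  have hsorted : (L ++ M).Pairwise fun x y => y.birth ≤ x.birth := by
    rw [List.pairwise_append]
    refine ⟨h.sorted, ?_, fun x hx y hy => ?_⟩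
    · rw [List.pairwise_iff_forall_sublist]
      intro x y hxy
      have h1 := hM x (hxy.subset (by simp))
      have h2 := hM y (hxy.subset (by simp))
      omega
    · have h1 := h.live x hx
      have h2 := hM y hy
      omega
  have hZmem : ∀ x ∈ Z, ∃ c ∈ T, c.vec = 0 ∧ c.tag = some x := by
    intro x hx
    obtain ⟨c, hc, hcx⟩ := mem_tags.1 hx
    obtain ⟨h1, h2⟩ := List.mem_filter.1 hc
    exact ⟨c, h1, (hz c h1).1 h2, hcx⟩
  have hZL : ∀ x ∈ Z, x.death = 0 ∧ l < x.birth ∧ x.birth ≤ n := by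
    intro x hx
    obtain ⟨c, hc, h0, hcx⟩ := hZmem x hx
    have := hLM x (hperm.subset (List.mem_append_left _ hx))
    exact ⟨this.1, hzM c hc h0 x hcx, this.2.2.1⟩
  -- from index `l + 1` on, the bars alive are the same as before
  have hDi : ∀ i, l + 1 ≤ i → reps (aliveAt D i) = reps (aliveAt Z i) := by
    intro i hi
    rw [hD, aliveAt, List.filter_map, reps, List.map_map, aliveAt]
    have e : Z.filter ((fun x : BarRep n => decide (Alive (x.death, x.birth) i)) ∘
        fun x => ({ x with death := l } : BarRep n)) =
        Z.filter fun x => decide (Alive (x.death, x.birth) i) := by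
      refine List.filter_congr fun x hx => ?_
      have := hZL x hx
      rw [Function.comp_apply, decide_eq_decide]
      change (l < i ∧ i ≤ x.birth) ↔ (x.death < i ∧ i ≤ x.birth)
      omega
    rw [e]
    rfl
  have hMi : ∀ i, l + 1 ≤ i → aliveAt M i = [] := fun i hi =>
    List.filter_eq_nil_iff.2 fun x hx => by
      have := hM x hx
      rw [decide_eq_true_iff]
      rintro ⟨-, h2⟩
      have : i ≤ x.birth := h2
      omega
  have halive : ∀ i, l + 1 ≤ i →
      (reps (aliveAt ((O ++ D) ++ K) i)).Perm (reps (aliveAt (O ++ L) i)) := by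
    intro i hi
    rw [List.append_assoc, aliveAt_append, aliveAt_append, reps_append, reps_append, hDi i hi,
      aliveAt_append O L, reps_append]
    refine List.Perm.append_left _ ?_
    have h1 := ((hperm.filter fun x => decide (Alive (x.death, x.birth) i)).map BarRep.rep)
    change (reps (aliveAt (Z ++ K) i)).Perm (reps (aliveAt (L ++ M) i)) at h1
    rwa [aliveAt_append L M, hMi i hi, List.append_nil, aliveAt_append, reps_append] at h1
  -- at index `l`, they are the columns that remain
  have hl' : aliveAt ((O ++ D) ++ K) l = K := by
    have h1 : aliveAt O l = [] := List.filter_eq_nil_iff.2 fun x hx => by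
      have := h.dead x hx
      rw [decide_eq_true_iff]
      rintro ⟨h2, -⟩
      have : x.death < l := h2
      omega
    have h2 : aliveAt D l = [] := List.filter_eq_nil_iff.2 fun x hx => by
      obtain ⟨y, -, rfl⟩ := List.mem_map.1 hx
      rw [decide_eq_true_iff]
      rintro ⟨h2, -⟩
      exact absurd h2 (lt_irrefl l)
    have h3 : aliveAt K l = K := List.filter_eq_self.2 fun x hx => by
      have := hLM x (hKsub.subset hx)
      rw [decide_eq_true_iff]
      exact ⟨by change x.death < l; omega, this.2.1⟩
    rw [aliveAt_append, aliveAt_append, h1, h2, h3]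
    rfl
  have hrepK : Represents (F.Bc l) (T.filter fun c => !z c) := hT.filter fun c hc h0 =>
    (hz c hc).1 (by simpa using h0)
  have hspanK : F.Bc l ⊔ spanL (ZMod 2) (reps K) = F.Bc l ⊔ spanL (ZMod 2) (reps (L ++ M)) := by
    rw [hK, hrepK.span_eq, ← htags, hT.span_eq]
    apply le_antisymm
    · exact sup_le_sup_left (spanL_mono fun v hv => by
        obtain ⟨c, hc, rfl⟩ := mem_vecs.1 hv
        exact vec_mem_vecs (List.mem_filter.1 hc).1) _
    · refine sup_le le_sup_left (spanL_le.2 fun v hv => ?_)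
      obtain ⟨c, hc, rfl⟩ := mem_vecs.1 hv
      by_cases h0 : c.vec = 0
      · rw [h0]; exact zero_mem _
      · refine Submodule.mem_sup_right (mem_spanL (vec_mem_vecs (List.mem_filter.2 ⟨hc, ?_⟩)))
        have := mt (hz c hc).1 h0
        simpa using this
  have hspan : F.Bc l ⊔ spanL (ZMod 2) (reps K) = W l := by
    rw [hspanK]
    apply le_antisymm
    · refine sup_le (hWB l) (spanL_le.2 fun v hv => ?_)
      obtain ⟨x, hx, rfl⟩ := mem_reps.1 hv
      exact (hLM x hx).2.2.2
    · refine hW _ le_sup_left (fun hlt => ?_) ?_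
      · rw [← h.span_live l.succ_pos hlt]
        refine sup_le ((F.Bc_anti (Nat.le_succ l)).trans le_sup_left) (le_sup_of_le_right ?_)
        rw [reps_append, spanL_append]
        exact le_sup_left
      · rw [← htags, hT.span_eq]
        exact le_sup_right
  refine ⟨fun x hx => ?_, hsorted.sublist hKsub, fun x hx => ?_, fun i hi hin => ?_,
    fun i hi hin => ?_, fun x hx => ?_⟩
  · have := hLM x (hKsub.subset hx)
    exact ⟨this.1, this.2.1, this.2.2.1⟩
  · rcases List.mem_append.1 hx with hx | hx
    · have := h.dead x hx
      omega
    · obtain ⟨y, hy, rfl⟩ := List.mem_map.1 hx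
      have := hZL y hy
      exact ⟨le_rfl, this.2⟩
  · rcases hi.eq_or_lt with rfl | hi
    · rw [hl', hspan]
    · rw [spanL_perm (halive i hi), h.span_eq i hi hin]
  · rcases hi.eq_or_lt with rfl | hi
    · rw [hl']
      exact hrepK.indepMod_iff.2 hind
    · exact (indepMod_perm (halive i hi)).2 (h.indep i hi hin)
  · rcases List.mem_append.1 hx with hx | hx
    · have hd := (h.dead x hx).1
      refine (sup_le_sup_left (Submodule.span_mono ?_) _ :
        F.Bc x.death ⊔ Submodule.span _ _ ≤ F.Bc x.death ⊔ Submodule.span _ _) (h.elder x hx)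
      rintro v ⟨y, hy, hb, rfl⟩
      rw [aliveAt_append] at hy
      rcases List.mem_append.1 hy with hy | hy
      · exact ⟨y, by rw [List.append_assoc, aliveAt_append]; exact List.mem_append_left _ hy, hb,
          rfl⟩
      · obtain ⟨hyL, hy1, hy2⟩ := mem_aliveAt.1 hy
        rcases List.mem_append.1 (hperm.mem_iff.2 (List.mem_append_left M hyL)) with hyZ | hyK
        · refine ⟨{ y with death := l }, mem_aliveAt.2 ⟨List.mem_append_left _
            (List.mem_append_right _ (List.mem_map.2 ⟨y, hyZ, rfl⟩)), ?_, hy2⟩, hb, rfl⟩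
          change l < x.death
          omega
        · exact ⟨y, mem_aliveAt.2 ⟨List.mem_append_right _ hyK, hy1, hy2⟩, hb, rfl⟩
    · obtain ⟨y, hy, rfl⟩ := List.mem_map.1 hx
      obtain ⟨c, hc, h0, hcy⟩ := hZmem y hy
      have h1 := hT.elder (by rw [htags]; exact hsorted) hc h0 hcy
      refine (sup_le_sup_left (Submodule.span_mono ?_) _ :
        F.Bc l ⊔ Submodule.span _ _ ≤ F.Bc l ⊔ Submodule.span _ _) h1
      rintro v ⟨d, hd, hd0, x, hdx, hb, rfl⟩
      refine ⟨x, ?_, hb, rfl⟩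
      change x ∈ aliveAt ((O ++ D) ++ K) l
      rw [hl']
      refine mem_tags.2 ⟨d, List.mem_filter.2 ⟨hd, ?_⟩, hdx⟩
      have := mt (hz d hd).1 hd0
      simpa using this

/-- At the end of the loop all bars have died. -/
theorem isElderBasis (h : Certified F W 1 O L) (hWB : ∀ i, F.Bc i ≤ W i)
    (hW1 : W 1 ≤ F.Bc 1) : F.IsElderBasis W O := by
  have hL : L = [] := by
    have := (h.indep_live one_pos).eq_nil fun v hv => by
      obtain ⟨x, hx, rfl⟩ := mem_reps.1 hv
      exact hW1 (h.rep_mem one_pos hx)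
    simpa [reps] using this
  subst hL
  refine ⟨fun x hx => (h.dead x hx).2, fun i hi => ?_, fun i hi => ?_, fun x hx => ?_⟩
  · rcases Nat.eq_zero_or_pos i with rfl | h0
    · have := hWB 0
      rw [F.Bc_zero] at this ⊢
      rw [top_sup_eq, top_le_iff.1 this]
    · simpa using h.span_eq i h0 hi
  · rcases Nat.eq_zero_or_pos i with rfl | h0
    · have : aliveAt O 0 = [] := List.filter_eq_nil_iff.2 fun x _ => by
        rw [decide_eq_true_iff]
        rintro ⟨h2, -⟩
        exact absurd h2 (Nat.not_lt_zero _)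
      rw [this]
      exact indepMod_nil _
    · simpa using h.indep i h0 hi
  · simpa using h.elder x hx

end Certified

/-! ### One round of the loop -/

theorem restrictState_val (l : ℕ) (st : CupState n) : (restrictState l st).val =
    { H := st.H.map fun x => { x with rep := (zeroRow l x.rep).val }
      R := st.R.map fun x => { x with rep := (zeroRow l x.rep).val }
      S := (reduceMatrix (st.S.map fun c => { c with vec := (zeroRow l c.vec).val })).val
      out := st.out } := by
  unfold restrictState
  simp only [Timed.val_bind, Timed.val_pure, mapT_val]

theorem zeroRow_sub_mem_tail (l : ℕ) (x : Vec n) : (zeroRow l x).val - x ∈ tail n l := by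
  rw [sub_mem_tail, zeroRow_val]
  intro j hj
  exact if_neg hj.ne

theorem restrictState_time_le {l : ℕ} {st : CupState n} (hH : st.H.length ≤ n)
    (hR : st.R.length ≤ n) (hS : st.S.length ≤ 2 * n) (hn : 0 < n) :
    (restrictState l st).time ≤ 40 * n ^ 3 := by
  have h1 := mapT_time_le (f := fun x : BarRep n => do
    let v ← zeroRow l x.rep
    pure { x with rep := v }) (l := st.H) 1 fun _ _ => le_rfl
  have h2 := mapT_time_le (f := fun x : BarRep n => do
    let v ← zeroRow l x.rep
    pure { x with rep := v }) (l := st.R) 1 fun _ _ => le_rfl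
  have h3 := mapT_time_le (f := fun c : Col n => do
    let v ← zeroRow l c.vec
    pure { c with vec := v }) (l := st.S) 1 fun _ _ => le_rfl
  have h4 : (mapT (fun c : Col n => do
    let v ← zeroRow l c.vec
    pure { c with vec := v }) st.S).val.length ≤ 2 * n := by
    rw [mapT_val, List.length_map]; exact hS
  have h5 := reduceMatrix_time_le h4
  have e : (restrictState l st).time = (mapT (fun x : BarRep n => do
      let v ← zeroRow l x.rep
      pure { x with rep := v }) st.H).time + ((mapT (fun x : BarRep n => do
      let v ← zeroRow l x.rep
      pure { x with rep := v }) st.R).time + ((mapT (fun c : Col n => do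
      let v ← zeroRow l c.vec
      pure { c with vec := v }) st.S).time + ((reduceMatrix (mapT (fun c : Col n => do
      let v ← zeroRow l c.vec
      pure { c with vec := v }) st.S).val).time + 0))) := rfl
  rw [e]
  have h6 : n ≤ n ^ 3 := Nat.le_self_pow (by norm_num) n
  have h7 : n ^ 2 ≤ n ^ 3 := Nat.pow_le_pow_right hn (by norm_num)
  nlinarith

theorem foldT_tags_val (l : ℕ) (Z : List (Col n)) (O : List (BarRep n)) :
    (foldT (fun acc c => do
      tick 1
      match c.tag with
      | none => pure acc
      | some x => pure (acc ++ [{ x with death := l }])) O Z).val =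
        O ++ (tags Z).map fun x => { x with death := l } := by
  rw [foldT_val]
  induction Z generalizing O with
  | nil => simp [tags]
  | cons c Z ih =>
    rw [List.foldl_cons, ih]
    change (match c.tag with
      | none => pure O
      | some x => pure (O ++ [{ x with death := l }]) : Timed (List (BarRep n))).val ++ _ = _
    unfold tags
    cases hc : c.tag with
    | none =>
      rw [List.filterMap_cons_none hc]
      rfl
    | some x =>
      rw [List.filterMap_cons_some hc]
      simp

/-- The test for columns that are output. Columns of coboundaries may vanish as well, but they carry no
annotation and stay. -/
def zeroed (c : Col n) : Bool := c.low.isNone && c.tag.isSome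

theorem deathStep_val_of_nil {P : List (BarRep n)} {l : ℕ} {st : CupState n}
    (h : ∀ x ∈ positiveBars P, x.death ≠ l) : (deathStep P l st).val = st := by
  have h1 : (filterT (fun x : BarRep n => decide (x.death = l ∧ 0 < x.deg)) P).val = [] := by
    rw [filterT_val, List.filter_eq_nil_iff]
    intro x hx
    rw [decide_eq_true_iff]
    rintro ⟨h2, h3⟩
    exact h x (mem_positiveBars.2 ⟨hx, h3⟩) h2
  unfold deathStep
  rw [Timed.val_bind, h1]
  rfl

theorem deathStep_val_of_reduced {P : List (BarRep n)} {l : ℕ} {st : CupState n}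
    (h : ∃ x ∈ positiveBars P, x.death = l) (hS : Reduced st.S) : (deathStep P l st).val =
      { H := st.H.filter fun x => x.death ≠ l
        R := st.R.filter fun x => x.death ≠ l
        S := st.S.filter fun c => !zeroed c
        out := st.out ++ (tags (st.S.filter zeroed)).map fun x => { x with death := l } } := by
  have h1 : (filterT (fun x : BarRep n => decide (x.death = l ∧ 0 < x.deg)) P).val.isEmpty =
      false := by
    obtain ⟨x, hx, hd⟩ := h
    obtain ⟨hx, hpos⟩ := mem_positiveBars.1 hx
    rw [filterT_val]
    refine Bool.eq_false_iff.2 fun h2 => ?_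
    have := List.filter_eq_nil_iff.1 (List.isEmpty_iff.1 h2) x hx
    exact this (by simp [hd, hpos])
  unfold deathStep
  rw [Timed.val_bind, h1]
  simp only [Bool.false_eq_true, if_false, Timed.val_bind, Timed.val_pure, filterT_val,
    hS.reduceMatrix_val]
  exact congrArg (fun o => (⟨_, _, _, o⟩ : CupState n))
    (foldT_tags_val l (st.S.filter zeroed) st.out)

theorem deathStep_time_le {P : List (BarRep n)} {l : ℕ} {st : CupState n} (hP : P.length ≤ n)
    (hH : st.H.length ≤ n) (hR : st.R.length ≤ n) (hS : st.S.length ≤ 3 * n) (hn : 0 < n) :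
    (deathStep P l st).time ≤ 90 * n ^ 3 := by
  have h6 : n ≤ n ^ 3 := Nat.le_self_pow (by norm_num) n
  have h7 : n ^ 2 ≤ n ^ 3 := Nat.pow_le_pow_right hn (by norm_num)
  unfold deathStep
  rw [Timed.time_bind, filterT_time]
  split_ifs
  · rw [Timed.time_pure]
    omega
  · have h1 := reduceMatrix_time_le hS
    have h2 : (reduceMatrix st.S).val.length ≤ 3 * n := by
      rw [(reduceMatrix_colEquiv st.S).length_eq]; exact hS
    have h4 := List.length_filter_le (fun c : Col n => c.low.isNone && c.tag.isSome)
      (reduceMatrix st.S).val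
    have h5 : (reduceMatrix st.S).time ≤ 45 * n ^ 3 := by
      refine h1.trans (le_trans (b := 18 * n ^ 3 + 24 * n ^ 2 + 3 * n) (le_of_eq (by ring)) ?_)
      omega
    simp only [Timed.time_bind, Timed.time_pure, filterT_time, filterT_val]
    refine le_trans (Nat.add_le_add_left (Nat.add_le_add_left (Nat.add_le_add_left
      (Nat.add_le_add_left (Nat.add_le_add_right (foldT_time_le _ 1 fun acc c _ => ?_) _) _) _) _) _)
      ?_
    · cases c.tag <;> exact le_rfl
    · omega

/-- The state of the loop before index `l` is treated: `U` are the columns of coboundaries, `T` the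
annotated columns. The lists `H` and `R` hold the bars that are born above `l`, except that those born
at `n` are there from the start; this is the reason for `min (l + 1) n`. -/
structure LoopInv (F : SimplexwiseFiltration V n) (W : ℕ → Submodule (ZMod 2) (Vec n))
    (P Q : List (BarRep n)) (l : ℕ) (st : CupState n) (U T : List (Col n)) : Prop where
  matrix : st.S = U ++ T
  length_eq : U.length = n
  untagged : ∀ c ∈ U, c.tag = none
  supp : spanL (ZMod 2) (vecs (U ++ T)) ≤ head n (l + 1)
  span_eq : tail n (l + 1) ⊔ spanL (ZMod 2) (vecs U) = F.Bc (l + 1)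
  repr : Represents (F.Bc (l + 1)) T
  certified : Certified F W (l + 1) st.out (tags T)
  tracksH : Tracks P st.H (min (l + 1) n) l
  tracksR : Tracks Q st.R (min (l + 1) n) l

/-- What is needed of the part of the loop that tests products: it adds products until the matrix
generates `W l`, together with what comes from index `l + 1`, and it takes at most `t l` steps. The
list `N` holds the columns that it appends. -/
def StageSpec (F : SimplexwiseFiltration V n) (W : ℕ → Submodule (ZMod 2) (Vec n))
    (P Q : List (BarRep n)) (stage : ℕ → CupState n → Timed (CupState n)) (t : ℕ → ℕ) : Prop :=
  ∀ (l : ℕ) (st : CupState n) (U T : List (Col n)), 0 < l → l ≤ n → U.length = n →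
    T.length ≤ n → spanL (ZMod 2) (vecs U) ≤ F.Bc l → st.S = U ++ T →
    F.Testing l (W l) U T [] → Tracks P st.H (min (l + 1) n) l →
    Tracks Q st.R (min (l + 1) n) l →
    ∃ N, (stage l st).val.S = U ++ (T ++ N) ∧ F.Testing l (W l) U T N ∧
      Tracks P (stage l st).val.H l l ∧ Tracks Q (stage l st).val.R l l ∧
      (stage l st).val.out = st.out ∧
      (∀ X, F.Bc l ≤ X → (l < n → W (l + 1) ≤ X) →
        spanL (ZMod 2) (vecs (U ++ (T ++ N))) ≤ X → W l ≤ X) ∧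
      (stage l st).time ≤ t l

/-- Without a bar of positive degree that dies at `l`, no class of positive degree dies. Hence there
is nothing to be done at the indices at which the matrix is not searched for zero columns. -/
theorem Wc_one_inf_Bc_le {P : List (BarRep n)} (hP : F.IsElderBasis (F.Wc 1) P) {l : ℕ}
    (hln : l < n) (h : ∀ x ∈ P, x.death ≠ l) :
    F.Wc 1 (l + 1) ⊓ F.Bc l ≤ F.Bc (l + 1) := by
  rintro x ⟨hx, hxB⟩
  change x ∈ F.Wc 1 (l + 1) at hx
  rw [← hP.span_eq (l + 1) hln] at hx
  obtain ⟨b, hb, s, hs, rfl⟩ := Submodule.mem_sup.1 hx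
  have h1 : spanL (ZMod 2) (reps (aliveAt P (l + 1))) ≤ spanL (ZMod 2) (reps (aliveAt P l)) := by
    refine spanL_mono fun v hv => ?_
    obtain ⟨y, hy, rfl⟩ := mem_reps.1 hv
    obtain ⟨hy1, hy2, hy3⟩ := mem_aliveAt.1 hy
    have := h y hy1
    exact rep_mem_reps (mem_aliveAt.2 ⟨hy1, by omega, by omega⟩)
  have h2 : s ∈ F.Bc l := by
    have := sub_mem hxB (F.Bc_anti (Nat.le_succ l) hb)
    rwa [add_sub_cancel_left] at this
  have h3 := Submodule.disjoint_def.1 (hP.indep l hln.le).disjoint s h2 (h1 hs)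
  rw [h3, add_zero]
  exact hb

theorem filter_zeroed {U T : List (Col n)} (hU : ∀ c ∈ U, c.tag = none) :
    (U ++ T).filter zeroed = T.filter zeroed := by
  rw [List.filter_append, List.filter_eq_nil_iff.2, List.nil_append]
  intro c hc
  simp [zeroed, hU c hc]

theorem filter_not_zeroed {U T : List (Col n)} (hU : ∀ c ∈ U, c.tag = none) :
    ((U ++ T).filter fun c => !zeroed c) = U ++ T.filter fun c => !zeroed c := by
  rw [List.filter_append, List.filter_eq_self.2]
  intro c hc
  simp [zeroed, hU c hc]

/-- One round of the loop preserves the invariant. -/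
theorem loop_round {W : ℕ → Submodule (ZMod 2) (Vec n)} {P Q : List (BarRep n)}
    {stage : ℕ → CupState n → Timed (CupState n)} {t : ℕ → ℕ}
    (hWB : ∀ i, F.Bc i ≤ W i) (hWa : ∀ i, W (i + 1) ≤ W i) (hWp : ∀ i, W i ≤ F.Wc 1 i)
    (hPn : P.length ≤ n) (hQn : Q.length ≤ n) (hP : F.IsElderBasis (F.Wc 1) (positiveBars P))
    (hstage : StageSpec F W (positiveBars P) Q stage t) {l : ℕ} (hln : l < n) {st : CupState n}
    {U T : List (Col n)} (h : LoopInv F W (positiveBars P) Q (l + 1) st U T) :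
    (∃ U' T', LoopInv F W (positiveBars P) Q l (deathStep P (l + 1)
      (stage (l + 1) (restrictState (l + 1) st).val).val).val U' T') ∧
    (restrictState (l + 1) st).time + (stage (l + 1) (restrictState (l + 1) st).val).time +
      (deathStep P (l + 1) (stage (l + 1) (restrictState (l + 1) st).val).val).time ≤
        130 * n ^ 3 + t (l + 1) := by
  set m := l + 1 with hm
  have hmpos : 0 < m := l.succ_pos
  have hmn : m ≤ n := hln
  have hn : 0 < n := hmpos.trans_le hmn
  have hP'n : (positiveBars P).length ≤ n := (List.length_filter_le _ _).trans hPn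
  have hTn : T.length ≤ n := by
    rw [← h.repr.length_tags]; exact h.certified.length_live_le m.succ_pos
  have htime1 := restrictState_time_le (l := m) (h.tracksH.length_le.trans hP'n)
    (h.tracksR.length_le.trans hQn)
    (by rw [h.matrix, List.length_append, h.length_eq]; omega) hn
  -- restriction to `K_m`
  set f : Col n → Col n := fun c => { c with vec := (zeroRow m c.vec).val } with hf
  have hr := restrictState_val m st
  set st1 := (restrictState m st).val with hst1
  have hce1 : ColEquiv (tail n m) st.S (st.S.map f) :=
    ColEquiv.map (fun _ => rfl) fun c _ => zeroRow_sub_mem_tail m c.vec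
  have hce2 : ColEquiv ⊥ (st.S.map f) st1.S := by
    rw [hr]; exact reduceMatrix_colEquiv _
  have hred : Reduced st1.S := by
    rw [hr]; exact reduceMatrix_reduced _
  rw [h.matrix] at hce1 hce2
  obtain ⟨U1, T1, e1, hU1, hT1⟩ := hce1.split
  rw [e1] at hce2
  obtain ⟨U2, T2, e2, hU2, hT2⟩ := hce2.split
  have hU2' : ColEquiv (tail n m) U1 U2 := hU2.mono bot_le
  have hspanU : tail n m ⊔ spanL (ZMod 2) (vecs U2) = F.Bc m := by
    rw [hU2'.span_eq, hU1.span_eq, ← F.Bc_sup_tail (Nat.le_succ m), ← h.span_eq, sup_assoc,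
      sup_comm (spanL _ _), ← sup_assoc, sup_eq_right.2 (tail_anti (Nat.le_succ m))]
  have hUB : spanL (ZMod 2) (vecs U2) ≤ F.Bc m := le_sup_right.trans hspanU.le
  have hrepr : Represents (F.Bc m) T2 := by
    have h1 := h.repr.mono (F.Bc_anti (Nat.le_succ m))
    have h2 : tail n m ⊔ spanL (ZMod 2) (vecs U) ≤ F.Bc m := by
      rw [← hspanU, hU2'.span_eq, hU1.span_eq]
    have h3 := h1.colEquiv (hT1.mono h2)
    refine h3.colEquiv (hT2.mono ?_)
    rw [bot_sup_eq, ← hspanU, hU2'.span_eq]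
    exact le_sup_right
  have hsupp : spanL (ZMod 2) (vecs (U2 ++ T2)) ≤ head n m := by
    have h1 := hce2.span_eq
    rw [bot_sup_eq, bot_sup_eq, e2] at h1
    rw [h1, ← e1, spanL_le]
    intro v hv
    obtain ⟨c, hc, rfl⟩ := mem_vecs.1 hv
    obtain ⟨d, hd, rfl⟩ := List.mem_map.1 hc
    intro j hj
    change (if j.val = m then 0 else d.vec j) = 0
    split_ifs with hjm
    · rfl
    · exact h.supp (mem_spanL (vec_mem_vecs hd)) j (by omega)
  have htags : tags T2 = tags T := hT2.tags_eq.trans hT1.tags_eq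
  have hU2n : U2.length = n := by rw [hU2.length_eq, hU1.length_eq, h.length_eq]
  have hT2n : T2.length ≤ n := by rw [hT2.length_eq, hT1.length_eq]; exact hTn
  have hU2tag : ∀ c ∈ U2, c.tag = none := by
    intro c hc
    have h1 : c.tag ∈ U2.map Col.tag := List.mem_map.2 ⟨c, hc, rfl⟩
    rw [hU2.tag_eq, hU1.tag_eq] at h1
    obtain ⟨d, hd, hdc⟩ := List.mem_map.1 h1
    rw [← hdc, h.untagged d hd]
  have htest : F.Testing m (W m) U2 T2 [] := by
    refine ⟨?_, ?_, ?_, by simp⟩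
    · rw [List.append_nil, ← e2]; exact hred
    · rw [List.append_nil]; exact hsupp
    · rw [List.append_nil]; exact hrepr
  have hH1 : Tracks (positiveBars P) st1.H (min (m + 1) n) m := by
    rw [hr]
    exact h.tracksH.restrict (fun x => zeroRow_sub_mem_tail m x.rep) fun _ => rfl
  have hR1 : Tracks Q st1.R (min (m + 1) n) m := by
    rw [hr]
    exact h.tracksR.restrict (fun x => zeroRow_sub_mem_tail m x.rep) fun _ => rfl
  have hout1 : st1.out = st.out := by rw [hr]
  -- testing
  obtain ⟨N, hS3, htest3, hH3, hR3, hout3, hgen, htime2⟩ :=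
    hstage m st1 U2 T2 hmpos hmn hU2n hT2n hUB e2 htest hH1 hR1
  set st3 := (stage m st1).val with hst3
  have hS3n : st3.S.length ≤ 3 * n := by
    rw [hS3]; exact htest3.length_le hU2n hT2n
  have htime3 := deathStep_time_le (l := m) hPn (hH3.length_le.trans hP'n)
    (hR3.length_le.trans hQn) hS3n hn
  refine ⟨?_, by omega⟩
  have hred3 : Reduced st3.S := by rw [hS3]; exact htest3.reduced
  -- which columns have been zeroed out
  have hz : ∀ c ∈ T2 ++ N, zeroed c = true ↔ c.vec = 0 := by
    intro c hc
    obtain ⟨x, hx⟩ := htest3.repr.tag_isSome hc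
    rw [← htest3.reduced.low_eq_none_iff (List.mem_append_right _ hc)]
    simp [zeroed, hx]
  have hzM : ∀ c ∈ T2 ++ N, c.vec = 0 → ∀ x, c.tag = some x → m < x.birth := by
    intro c hc h0 x hx
    rcases List.mem_append.1 hc with hc' | hc'
    · have : x ∈ tags T := by rw [← htags]; exact mem_tags.2 ⟨c, hc', hx⟩
      have := (h.certified.live x this).2.1
      omega
    · exact absurd ((htest3.reduced.low_eq_none_iff (List.mem_append_right _ hc)).2 h0)
        (htest3.new c hc').1
  have hind : IndepMod (F.Bc m) (vecs ((T2 ++ N).filter fun c => !zeroed c)) := by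
    have h1 : Reduced (U2 ++ (T2 ++ N).filter fun c => !zeroed c) :=
      htest3.reduced.sublist (List.filter_sublist.append_left _)
    have h2 := h1.indepMod fun c hc h0 => by
      obtain ⟨h3, h4⟩ := List.mem_filter.1 hc
      obtain ⟨x, hx⟩ := htest3.repr.tag_isSome h3
      simp [zeroed, hx, h0] at h4
    refine h2.of_inf_le (W := head n m) (fun v hv => ?_) ?_
    · obtain ⟨c, hc, rfl⟩ := mem_vecs.1 hv
      exact htest3.supp (mem_spanL (vec_mem_vecs
        (List.mem_append_right _ (List.mem_filter.1 hc).1)))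
    · rw [← hspanU]
      refine mem_inf_of_head ((spanL_mono fun v hv => ?_).trans hsupp)
      rw [vecs_append]
      exact List.mem_append_left _ hv
  have hcert := h.certified.step hmpos hmn hWB hWa (T := T2 ++ N) (M := tags N) htest3.repr
    (by rw [tags_append, htags]) (by
      intro x hx
      obtain ⟨c, hc, hcx⟩ := mem_tags.1 hx
      obtain ⟨-, y, hy, h1, h2, h3⟩ := htest3.new c hc
      obtain rfl : x = y := Option.some_injective _ (hcx.symm.trans hy)
      exact ⟨h1, h2, h3⟩) (by
      intro X hX1 hX2 hX3
      refine hgen X hX1 hX2 ?_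
      rw [vecs_append, spanL_append]
      exact sup_le (hUB.trans hX1) hX3) hz hzM hind
  by_cases hdie : ∃ x ∈ positiveBars P, x.death = m
  · rw [deathStep_val_of_reduced hdie hred3]
    refine ⟨U2, (T2 ++ N).filter fun c => !zeroed c, ?_, hU2n, hU2tag, ?_, hspanU, ?_, ?_, ?_, ?_⟩
    · dsimp only
      rw [hS3, filter_not_zeroed hU2tag]
    · refine (spanL_mono fun v hv => ?_).trans htest3.supp
      obtain ⟨c, hc, rfl⟩ := mem_vecs.1 hv
      refine vec_mem_vecs ?_
      rcases List.mem_append.1 hc with hc | hc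
      · exact List.mem_append_left _ hc
      · exact List.mem_append_right _ (List.mem_filter.1 hc).1
    · exact htest3.repr.filter fun c hc h0 => (hz c hc).1 (by simpa using h0)
    · dsimp only
      rw [hS3, filter_zeroed hU2tag, hout3, hout1]
      exact hcert
    · rw [min_eq_left hmn]
      exact hH3.filter fun y hy => by simpa using hy
    · rw [min_eq_left hmn]
      exact hR3.filter fun y hy => by simpa using hy
  · have hdie' : ∀ x ∈ positiveBars P, x.death ≠ m := fun x hx hd => hdie ⟨x, hx, hd⟩
    rw [deathStep_val_of_nil hdie']
    have hnz : ∀ c ∈ T2 ++ N, zeroed c = false := by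
      intro c hc
      refine Bool.eq_false_iff.2 fun h0 => ?_
      rw [hz c hc] at h0
      rcases List.mem_append.1 hc with hc' | hc'
      · obtain ⟨x, hx⟩ := hrepr.tag_isSome hc'
        have hxT : x ∈ tags T := by rw [← htags]; exact mem_tags.2 ⟨c, hc', hx⟩
        have hlt : m < n := by
          have := h.certified.live x hxT
          omega
        have h1 := (h.certified.indep_live m.succ_pos).of_inf_le (W := F.Wc 1 (m + 1))
          (B' := F.Bc m) (fun v hv => by
            obtain ⟨y, hy, rfl⟩ := mem_reps.1 hv
            exact hWp _ (h.certified.rep_mem m.succ_pos hy))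
          (Wc_one_inf_Bc_le hP hlt hdie')
        rw [← htags, hrepr.indepMod_iff] at h1
        exact h1.ne_zero (vec_mem_vecs hc') h0
      · exact (htest3.new c hc').1
          ((htest3.reduced.low_eq_none_iff (List.mem_append_right _ hc)).2 h0)
    rw [List.filter_eq_nil_iff.2 fun c hc => by simp [hnz c hc],
      List.filter_eq_self.2 fun c hc => by simp [hnz c hc]] at hcert
    refine ⟨U2, T2 ++ N, hS3, hU2n, hU2tag, htest3.supp, hspanU, htest3.repr, ?_, ?_, ?_⟩
    · rw [hout3, hout1]
      simpa [tags] using hcert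
    · rw [min_eq_left hmn]
      have := hH3.filter (p := fun _ => true) fun _ _ => rfl
      rwa [List.filter_eq_self.2 fun _ _ => rfl] at this
    · rw [min_eq_left hmn]
      have := hR3.filter (p := fun _ => true) fun _ _ => rfl
      rwa [List.filter_eq_self.2 fun _ _ => rfl] at this

end SimplexwiseFiltration

/-! ### The two versions of the main loop -/

section Counting

variable {n : ℕ}

theorem length_descending (n : ℕ) : (descending n).length = n := by
  simp [descending]

/-- Each bar is born only once. -/
theorem sum_births_le (P : List (BarRep n)) (m : ℕ) :
    ((descending m).map fun l => (P.filter fun x => x.birth = l).length).sum ≤ P.length := by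
  suffices h : ((descending m).map fun l => (P.filter fun x => x.birth = l).length).sum ≤
      (P.filter fun x => x.birth ≤ m).length from h.trans (List.length_filter_le _ _)
  induction m with
  | zero => exact Nat.zero_le _
  | succ m ih =>
    rw [descending_succ, List.map_cons, List.sum_cons]
    have e : (P.filter fun x => x.birth ≤ m + 1).length =
        (P.filter fun x => x.birth ≤ m).length + (P.filter fun x => x.birth = m + 1).length := by
      simp only [← List.countP_eq_length_filter]
      clear ih
      induction P with
      | nil => rfl
      | cons x P ih =>
        simp only [List.countP_cons, ih, decide_eq_true_eq]
        split_ifs <;> omega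
    omega

theorem initialMatrix_val (D : Fin n → Vec n) : (initialMatrix D).val =
    (List.finRange n).map fun j => ⟨D j, (lowVec (D j)).val, none⟩ := by
  unfold initialMatrix
  rw [mapT_val]
  rfl

theorem initialMatrix_time_le (D : Fin n → Vec n) : (initialMatrix D).time ≤ n * (2 * n + 1) := by
  have := mapT_time_le (f := fun j => do
    let r ← lowVec (D j)
    pure (⟨D j, r, none⟩ : Col n)) (l := List.finRange n) (2 * n) fun j _ => lowVec_time_le (D j)
  rwa [List.length_finRange] at this

end Counting

namespace SimplexwiseFiltration

variable {V : Type u} [LinearOrder V] {n : ℕ} {F : SimplexwiseFiltration V n}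

/-- The number of steps allowed for testing products at index `l`: each bar that is born is tested
against at most `n` others, in `O(n ^ 2)` steps each. -/
def stageBound (P Q : List (BarRep n)) (l : ℕ) : ℕ :=
  6 * n ^ 3 + 25 * n ^ 3 * ((P.filter fun x => x.birth = l).length +
    (Q.filter fun x => x.birth = l).length)

theorem sum_stageBound_le {P Q : List (BarRep n)} (hP : P.length ≤ n) (hQ : Q.length ≤ n) :
    ((descending n).map fun l => 130 * n ^ 3 + stageBound P Q l + 1).sum ≤ 187 * n ^ 4 := by
  have e : ((descending n).map fun l => 130 * n ^ 3 + stageBound P Q l + 1) =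
      (descending n).map fun l => (136 * n ^ 3 + 1) + 25 * n ^ 3 *
        ((P.filter fun x => x.birth = l).length + (Q.filter fun x => x.birth = l).length) := by
    refine List.map_congr_left fun l _ => ?_
    unfold stageBound
    ring
  have h5 : n * (136 * n ^ 3 + 1) = 136 * n ^ 4 + n := by ring
  rw [e]
  generalize 136 * n ^ 3 + 1 = c at h5 ⊢
  rw [ List.sum_map_add, List.sum_map_mul_left, List.sum_map_add, List.map_const',
    List.sum_replicate, length_descending, smul_eq_mul]
  have h1 := sum_births_le P n
  have h2 := sum_births_le Q n
  have h3 := Nat.mul_le_mul_left (25 * n ^ 3) (Nat.add_le_add (h1.trans hP) (h2.trans hQ))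
  have h4 : n ≤ n ^ 4 := Nat.le_self_pow (by norm_num) n
  have h6 : 25 * n ^ 3 * (n + n) = 50 * n ^ 4 := by ring
  omega

theorem spanL_initialMatrix :
    spanL (ZMod 2) (vecs (initialMatrix F.coboundaryMatrix.val).val) = LinearMap.range F.dl := by
  have h1 : ∀ j : Fin n, F.dl (Pi.single j 1) = F.coboundaryMatrix.val j := by
    intro j
    funext i
    rw [dl_apply, Finset.sum_eq_single j]
    · rw [Pi.single_eq_same, mul_one]
    · intro k _ hk
      rw [Pi.single_eq_of_ne hk, mul_zero]
    · intro h
      exact absurd (Finset.mem_univ j) h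
  rw [initialMatrix_val]
  apply le_antisymm
  · refine spanL_le.2 fun v hv => ?_
    obtain ⟨c, hc, rfl⟩ := mem_vecs.1 hv
    obtain ⟨j, -, rfl⟩ := List.mem_map.1 hc
    exact ⟨_, h1 j⟩
  · rintro _ ⟨x, rfl⟩
    have hx : F.dl x = ∑ j, x j • F.coboundaryMatrix.val j := by
      funext i
      rw [dl_apply, Finset.sum_apply]
      exact Finset.sum_congr rfl fun j _ => mul_comm _ _
    rw [hx]
    refine Submodule.sum_mem _ fun j _ => Submodule.smul_mem _ _ (mem_spanL ?_)
    exact mem_vecs.2 ⟨_, List.mem_map.2 ⟨j, List.mem_finRange j, rfl⟩, rfl⟩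

theorem loopInv_initial {W : ℕ → Submodule (ZMod 2) (Vec n)} {P Q : List (BarRep n)}
    (hP : ∀ x ∈ P, x.birth ≤ n) (hQ : ∀ x ∈ Q, x.birth ≤ n) :
    LoopInv F W P Q n ⟨P.filter fun x => x.birth = n, Q.filter fun x => x.birth = n,
      (initialMatrix F.coboundaryMatrix.val).val, []⟩
      (initialMatrix F.coboundaryMatrix.val).val [] where
  matrix := (List.append_nil _).symm
  length_eq := by rw [initialMatrix_val, List.length_map, List.length_finRange]
  untagged c hc := by
    rw [initialMatrix_val] at hc
    obtain ⟨j, -, rfl⟩ := List.mem_map.1 hc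
    rfl
  supp _ _ j hj := absurd j.isLt (by omega)
  span_eq := by rw [spanL_initialMatrix, Bc_eq, sup_comm]
  repr := trivial
  certified := by
    refine ⟨by simp [tags], List.Pairwise.nil, by simp, fun i h1 h2 => absurd h2 (by omega),
      fun i h1 h2 => absurd h2 (by omega), by simp⟩
  tracksH := by
    rw [min_eq_right (Nat.le_succ n)]
    exact tracks_initial hP
  tracksR := by
    rw [min_eq_right (Nat.le_succ n)]
    exact tracks_initial hQ

/-- The loop over all indices computes a certified barcode. -/
theorem loop_spec {W : ℕ → Submodule (ZMod 2) (Vec n)} {P Q : List (BarRep n)}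
    {stage : ℕ → CupState n → Timed (CupState n)} {f : CupState n → ℕ → Timed (CupState n)}
    (hWB : ∀ i, F.Bc i ≤ W i) (hWa : ∀ i, W (i + 1) ≤ W i) (hWp : ∀ i, W i ≤ F.Wc 1 i)
    (hPn : P.length ≤ n) (hQn : Q.length ≤ n) (hP : F.IsElderBasis (F.Wc 1) (positiveBars P))
    (hQ : ∀ x ∈ Q, x.birth ≤ n)
    (hstage : StageSpec F W (positiveBars P) Q stage (stageBound (positiveBars P) Q))
    (hval : ∀ st l, (f st l).val =
      (deathStep P l (stage l (restrictState l st).val).val).val)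
    (htime : ∀ st l, (f st l).time = (restrictState l st).time +
      (stage l (restrictState l st).val).time +
      (deathStep P l (stage l (restrictState l st).val).val).time) :
    F.IsElderBasis W (foldT f ⟨(positiveBars P).filter fun x => x.birth = n,
      Q.filter fun x => x.birth = n, (initialMatrix F.coboundaryMatrix.val).val, []⟩
        (descending n)).val.out ∧
    (foldT f ⟨(positiveBars P).filter fun x => x.birth = n,
      Q.filter fun x => x.birth = n, (initialMatrix F.coboundaryMatrix.val).val, []⟩
        (descending n)).time ≤ 187 * n ^ 4 := by
  obtain ⟨⟨U, T, h1⟩, h2⟩ := foldT_descending (f := f)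
    (fun l st => ∃ U T, LoopInv F W (positiveBars P) Q l st U T)
    (fun l => 130 * n ^ 3 + stageBound (positiveBars P) Q l) n
    ⟨(positiveBars P).filter fun x => x.birth = n,
      Q.filter fun x => x.birth = n, (initialMatrix F.coboundaryMatrix.val).val, []⟩
    ⟨_, _, loopInv_initial (fun x hx => (hP.bar x hx).2) hQ⟩ (by
      rintro l hl st ⟨U, T, h⟩
      rw [hval, htime]
      exact loop_round hWB hWa hWp hPn hQn hP hstage hl h)
  exact ⟨h1.certified.isElderBasis hWB ((hWp 1).trans F.Wc_one_one_le),
    h2.trans (sum_stageBound_le ((List.length_filter_le _ _).trans hPn) hQn)⟩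

/-- Testing products at index `l` in CupPers. -/
def cupStage (F : SimplexwiseFiltration V n) (P : List (BarRep n)) (l : ℕ) (st : CupState n) :
    Timed (CupState n) := do
  let born ← filterT (fun x => x.birth = l ∧ 0 < x.deg) P
  foldT (fun (st : CupState n) x => do
      let H := if l = n then st.H else st.H ++ [x]
      tick (n + 1)
      let S ← foldT (fun S y => tryProduct F.faceTable.val l S x y) st.S H
      pure { st with H := H, S := S }) st born

/-- Testing products at index `l` in OrderkCupPers, for `k ≥ 3`. -/
def nextCupStage (F : SimplexwiseFiltration V n) (P Q : List (BarRep n)) (l : ℕ)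
    (st : CupState n) : Timed (CupState n) := do
  let born ← filterT (fun x => x.birth = l ∧ l ≠ n ∧ 0 < x.deg) P
  let st ← foldT (fun (st : CupState n) x => do
    tick (n + 1)
    let S ← foldT (fun S y => tryProduct F.faceTable.val l S x y) st.S st.R
    pure { st with H := st.H ++ [x], S := S }) st born
  let born' ← filterT (fun x => x.birth = l) Q
  foldT (fun (st : CupState n) y => do
    tick (n + 1)
    let R := if l = n then st.R else st.R ++ [y]
    let S ← foldT (fun S x => tryProduct F.faceTable.val l S y x) st.S st.H
    pure { st with R := R, S := S }) st born'

/-- The list of live representatives once those that are born at `l` have been appended. -/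
theorem Tracks.append_born {P H : List (BarRep n)} {l : ℕ}
    (h : Tracks P H (min (l + 1) n) l) (hln : l ≤ n) :
    Tracks P (if l = n then H else H ++ P.filter fun x => x.birth = l) l l := by
  split_ifs with hl
  · subst hl
    rwa [min_eq_right (Nat.le_succ l)] at h
  · exact h.append (by omega)

theorem cup_swap_mem {l : ℕ} {x y : Vec n} (hx : x ∈ F.Zc l) (hy : y ∈ F.Zc l)
    {X : Submodule (ZMod 2) (Vec n)} (hX : F.Bc l ≤ X) (h : F.cupE l x y ∈ X) :
    F.cupE l y x ∈ X := by
  rw [← sub_add_cancel (F.cupE l y x) (F.cupE l x y)]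
  exact add_mem (hX (F.cupE_comm hy hx)) h

theorem stageSpec_cupStage {P : List (BarRep n)} (hPn : P.length ≤ n)
    (hP : F.IsElderBasis (F.Wc 1) (positiveBars P)) :
    StageSpec F (F.Wc 2) (positiveBars P) [] (cupStage F P) (stageBound (positiveBars P) []) := by
  intro l st U T hl hln hUn hTn hU hS htest hH hR
  have hn : 0 < n := hl.trans_le hln
  set B := (positiveBars P).filter fun x => x.birth = l with hB
  have hborn : (filterT (fun x : BarRep n => decide (x.birth = l ∧ 0 < x.deg)) P).val = B := by
    rw [filterT_val, hB, positiveBars, List.filter_filter]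
    refine List.filter_congr fun x _ => ?_
    simp
  set Hn : List (BarRep n) → List (BarRep n) := fun done => if l = n then st.H else st.H ++ done
    with hHn
  have htr : Tracks (positiveBars P) (Hn B) l l := hH.append_born hln
  have hHlen : (Hn B).length ≤ n :=
    htr.length_le.trans ((List.length_filter_le _ _).trans hPn)
  have hHW : ∀ y ∈ Hn B, y.rep ∈ F.Wc 1 l := fun y hy => htr.mem_Wc hP le_rfl hy
  have hBW : ∀ x ∈ B, x.rep ∈ F.Wc 1 l := fun x hx => by
    obtain ⟨h1, h2⟩ := List.mem_filter.1 hx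
    rw [decide_eq_true_iff] at h2
    exact hP.mem_of_le h1 h2.ge
  obtain ⟨⟨N, h1, h2, h3, h4, h5, h6⟩, h7⟩ := foldT_induction
    (f := fun (st : CupState n) x => do
      let H := if l = n then st.H else st.H ++ [x]
      tick (n + 1)
      let S ← foldT (fun S y => tryProduct F.faceTable.val l S x y) st.S H
      pure { st with H := H, S := S }) (l := B) (b := st)
    (fun done st' => ∃ N, st'.S = U ++ (T ++ N) ∧ F.Testing l (F.Wc 2 l) U T N ∧
      st'.H = Hn done ∧ st'.R = st.R ∧ st'.out = st.out ∧
      ∀ x ∈ done, ∀ y ∈ Hn done,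
        F.cupE l x.rep y.rep ∈ F.Bc l ⊔ spanL (ZMod 2) (vecs (U ++ (T ++ N))))
    (fun _ => n + 1 + 22 * n ^ 3)
    ⟨[], by rw [hS, List.append_nil], htest, by simp [hHn], rfl, rfl, by simp⟩ (by
      rintro done x rest e st' ⟨N, h1, h2, h3, h4, h5, h6⟩
      have hsub : ∀ y ∈ Hn (done ++ [x]), y ∈ Hn B := by
        intro y hy
        simp only [hHn] at hy ⊢
        split_ifs at hy ⊢
        · exact hy
        · rw [e]
          simp only [List.mem_append, List.mem_cons] at hy ⊢
          tauto
      have hlen : (Hn (done ++ [x])).length ≤ n := by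
        refine le_trans ?_ hHlen
        simp only [hHn]
        split_ifs
        · exact le_rfl
        · rw [e]; simp
      have hHx : (if l = n then st'.H else st'.H ++ [x]) = Hn (done ++ [x]) := by
        rw [h3]
        simp only [hHn]
        split_ifs
        · rfl
        · rw [List.append_assoc]
      have hxB : x ∈ B := by rw [e]; simp
      obtain ⟨N', h8, h9, h10, h11, h12⟩ := foldT_tryProduct_spec h2 hU hUn hTn hn x
        (Hn (done ++ [x])) hlen fun y hy =>
          F.cupE_mem_Wc le_rfl (hBW x hxB) (hHW y (hsub y hy))
      rw [← hHx, ← h1] at h8 h12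
      refine ⟨⟨N', h8, h9, hHx, h4, h5, ?_⟩, by
        change n + 1 + (_ + 0) ≤ _
        omega⟩
      have hmono : F.Bc l ⊔ spanL (ZMod 2) (vecs (U ++ (T ++ N))) ≤
          F.Bc l ⊔ spanL (ZMod 2) (vecs (U ++ (T ++ N'))) := sup_le_sup_left h10 _
      intro x' hx' y hy
      rcases List.mem_append.1 hx' with hx1 | hx1
      · have hy' : y ∈ Hn done ∨ l ≠ n ∧ y = x := by
          simp only [hHn] at hy ⊢
          split_ifs at hy ⊢ with hl'
          · exact Or.inl hy
          · simp only [List.mem_append, List.mem_singleton] at hy ⊢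
            tauto
        rcases hy' with hy' | ⟨hl', rfl⟩
        · exact hmono (h6 x' hx1 y hy')
        · refine cup_swap_mem (F.Wc_le_Zc 1 l (hBW y hxB)) (F.Wc_le_Zc 1 l (hBW x' ?_))
            le_sup_left (Submodule.mem_sup_right (h11 x' ?_))
          · rw [e]; simp [hx1]
          · simp only [hHn]
            rw [if_neg hl']
            simp [hx1]
      · rw [List.mem_singleton.1 hx1]
        exact Submodule.mem_sup_right (h11 y hy))
  have hv : (cupStage F P l st).val = (foldT (fun (st : CupState n) x => do
      let H := if l = n then st.H else st.H ++ [x]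
      tick (n + 1)
      let S ← foldT (fun S y => tryProduct F.faceTable.val l S x y) st.S H
      pure { st with H := H, S := S }) st B).val := by
    rw [← hborn]; rfl
  have ht : (cupStage F P l st).time = 3 * P.length + (foldT (fun (st : CupState n) x => do
      let H := if l = n then st.H else st.H ++ [x]
      tick (n + 1)
      let S ← foldT (fun S y => tryProduct F.faceTable.val l S x y) st.S H
      pure { st with H := H, S := S }) st B).time := by
    rw [← hborn, ← filterT_time]; rfl
  rw [hv, ht]
  refine ⟨N, h1, h2, by rw [h3]; exact htr, ?_, h5, ?_, ?_⟩
  · rw [h4]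
    simpa using hR.append_born hln
  · intro X hX1 hX2 hX3
    have hle : F.Bc l ⊔ spanL (ZMod 2) (vecs (U ++ (T ++ N))) ≤ X := sup_le hX1 hX3
    have key : ∀ p ∈ positiveBars P, ∀ q ∈ positiveBars P, q.death < l → l ≤ q.birth →
        p.birth = l → F.cupE l p.rep q.rep ∈ X := by
      intro p hp q hq hq1 hq2 hpl
      obtain ⟨y, hy, hyq, -⟩ := htr.complete q hq hq1 hq2
      have := hle (h6 p (List.mem_filter.2 ⟨hp, by simpa using hpl⟩) y hy)
      rwa [F.cupE_congr (x := p.rep) (x' := p.rep) (by rw [sub_self]; exact zero_mem _) hyq]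
        at this
    refine Wc_succ_le le_rfl hln hP hP hX1 hX2 fun p hp q hq hp1 hq1 hp2 hq2 h => ?_
    rcases h with h | h
    · exact key p hp q hq hq1 hq2 h
    · exact cup_swap_mem (F.Wc_le_Zc 1 l (hP.mem_of_le hq hq2))
        (F.Wc_le_Zc 1 l (hP.mem_of_le hp hp2)) hX1 (key q hq p hp hp1 hp2 h)
  · rw [List.map_const', List.sum_replicate, smul_eq_mul] at h7
    have h8 : n ≤ n ^ 3 := Nat.le_self_pow (by norm_num) n
    have h9 : B.length * (n + 1 + 22 * n ^ 3 + 1) ≤ B.length * (25 * n ^ 3) :=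
      Nat.mul_le_mul_left _ (by omega)
    have h10 : B.length * (25 * n ^ 3) = 25 * n ^ 3 * B.length := mul_comm _ _
    unfold stageBound
    rw [← hB, List.filter_nil, List.length_nil, Nat.add_zero B.length]
    omega

theorem stageSpec_nextCupStage {k : ℕ} (hk : 1 ≤ k) {P Q : List (BarRep n)} (hPn : P.length ≤ n)
    (hQn : Q.length ≤ n) (hP : F.IsElderBasis (F.Wc 1) (positiveBars P))
    (hQ : F.IsElderBasis (F.Wc k) Q) :
    StageSpec F (F.Wc (k + 1)) (positiveBars P) Q (nextCupStage F P Q)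
      (stageBound (positiveBars P) Q) := by
  intro l st U T hl hln hUn hTn hU hS htest hH hR
  have hn : 0 < n := hl.trans_le hln
  set B := (positiveBars P).filter fun x => x.birth = l with hB
  set B1 := if l = n then [] else B with hB1
  set B2 := Q.filter fun x => x.birth = l with hB2
  have hborn : (filterT (fun x : BarRep n => decide (x.birth = l ∧ l ≠ n ∧ 0 < x.deg)) P).val =
      B1 := by
    rw [filterT_val, hB1]
    split_ifs with h
    · exact List.filter_eq_nil_iff.2 fun x _ => by simp [h]
    · rw [hB, positiveBars, List.filter_filter]
      exact List.filter_congr fun x _ => by simp [h]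
  have hborn' : (filterT (fun x : BarRep n => decide (x.birth = l)) Q).val = B2 := filterT_val _ _
  have hHB : st.H ++ B1 = if l = n then st.H else st.H ++ B := by
    rw [hB1]; split_ifs <;> simp
  have htr : Tracks (positiveBars P) (st.H ++ B1) l l := by
    rw [hHB]; exact hH.append_born hln
  have hHlen : (st.H ++ B1).length ≤ n :=
    htr.length_le.trans ((List.length_filter_le _ _).trans hPn)
  have hHW : ∀ y ∈ st.H ++ B1, y.rep ∈ F.Wc 1 l := fun y hy => htr.mem_Wc hP le_rfl hy
  have hRlen : st.R.length ≤ n := hR.length_le.trans hQn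
  have hRW : ∀ y ∈ st.R, y.rep ∈ F.Wc k l := fun y hy => hR.mem_Wc hQ (by omega) hy
  have hB2W : ∀ y ∈ B2, y.rep ∈ F.Wc k l := fun x hx => by
    obtain ⟨h1, h2⟩ := List.mem_filter.1 hx
    rw [decide_eq_true_iff] at h2
    exact hQ.mem_of_le h1 h2.ge
  obtain ⟨⟨N, h1, h2, h3, h4, h5, h6⟩, h7⟩ := foldT_induction
    (f := fun (st : CupState n) x => do
      tick (n + 1)
      let S ← foldT (fun S y => tryProduct F.faceTable.val l S x y) st.S st.R
      pure { st with H := st.H ++ [x], S := S }) (l := B1) (b := st)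
    (fun done st' => ∃ N, st'.S = U ++ (T ++ N) ∧ F.Testing l (F.Wc (k + 1) l) U T N ∧
      st'.H = st.H ++ done ∧ st'.R = st.R ∧ st'.out = st.out ∧
      ∀ x ∈ done, ∀ y ∈ st.R,
        F.cupE l x.rep y.rep ∈ spanL (ZMod 2) (vecs (U ++ (T ++ N))))
    (fun _ => n + 1 + 22 * n ^ 3)
    ⟨[], by rw [hS, List.append_nil], htest, by simp, rfl, rfl, by simp⟩ (by
      rintro done x rest e st' ⟨N, h1, h2, h3, h4, h5, h6⟩
      have hxW : x.rep ∈ F.Wc 1 l := hHW x (by rw [e]; simp)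
      obtain ⟨N', h8, h9, h10, h11, h12⟩ := foldT_tryProduct_spec h2 hU hUn hTn hn x
        st.R hRlen fun y hy => F.cupE_mem_Wc hk hxW (hRW y hy)
      rw [← h4, ← h1] at h8 h12
      refine ⟨⟨N', h8, h9, ?_, h4, h5, ?_⟩, by
        change n + 1 + (_ + 0) ≤ _
        omega⟩
      · change st'.H ++ [x] = _
        rw [h3, List.append_assoc]
      · intro x' hx' y hy
        rcases List.mem_append.1 hx' with hx' | hx'
        · exact h10 (h6 x' hx' y hy)
        · rw [List.mem_singleton.1 hx']
          exact h11 y hy)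
  set st1 := (foldT (fun (st : CupState n) x => do
      tick (n + 1)
      let S ← foldT (fun S y => tryProduct F.faceTable.val l S x y) st.S st.R
      pure { st with H := st.H ++ [x], S := S }) st B1).val with hst1
  obtain ⟨⟨N', g1, g2, g3, g4, g5, g8, g6⟩, g7⟩ := foldT_induction
    (f := fun (st : CupState n) y => do
      tick (n + 1)
      let R := if l = n then st.R else st.R ++ [y]
      let S ← foldT (fun S x => tryProduct F.faceTable.val l S y x) st.S st.H
      pure { st with R := R, S := S }) (l := B2) (b := st1)
    (fun done st' => ∃ N', st'.S = U ++ (T ++ N') ∧ F.Testing l (F.Wc (k + 1) l) U T N' ∧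
      st'.H = st.H ++ B1 ∧ st'.R = (if l = n then st.R else st.R ++ done) ∧ st'.out = st.out ∧
      spanL (ZMod 2) (vecs (U ++ (T ++ N))) ≤ spanL (ZMod 2) (vecs (U ++ (T ++ N'))) ∧
      ∀ y ∈ done, ∀ x ∈ st.H ++ B1,
        F.cupE l y.rep x.rep ∈ spanL (ZMod 2) (vecs (U ++ (T ++ N'))))
    (fun _ => n + 1 + 22 * n ^ 3)
    ⟨N, h1, h2, h3, by simp [h4], h5, le_rfl, by simp⟩ (by
      rintro done y rest e st' ⟨N1, g1, g2, g3, g4, g5, g8, g6⟩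
      have hyW : y.rep ∈ F.Wc k l := hB2W y (by rw [e]; simp)
      obtain ⟨N2, g9, g10, g11, g12, g13⟩ := foldT_tryProduct_spec g2 hU hUn hTn hn y
        (st.H ++ B1) hHlen fun x hx => cupE_mem_Wc_swap hk (hHW x hx) hyW
      rw [← g3, ← g1] at g9 g13
      refine ⟨⟨N2, g9, g10, g3, ?_, g5, g8.trans g11, ?_⟩, by
        change n + 1 + (_ + 0) ≤ _
        omega⟩
      · change (if l = n then st'.R else st'.R ++ [y]) = _
        rw [g4]
        split_ifs <;> simp
      · intro x' hx' y' hy'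
        rcases List.mem_append.1 hx' with hx' | hx'
        · exact g11 (g6 x' hx' y' hy')
        · rw [List.mem_singleton.1 hx']
          exact g12 y' hy')
  have hv : (nextCupStage F P Q l st).val = (foldT (fun (st : CupState n) y => do
      tick (n + 1)
      let R := if l = n then st.R else st.R ++ [y]
      let S ← foldT (fun S x => tryProduct F.faceTable.val l S y x) st.S st.H
      pure { st with R := R, S := S }) st1 B2).val := by
    rw [hst1, ← hborn, ← hborn']; rfl
  have ht : (nextCupStage F P Q l st).time = 3 * P.length + ((foldT (fun (st : CupState n) x => do
      tick (n + 1)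
      let S ← foldT (fun S y => tryProduct F.faceTable.val l S x y) st.S st.R
      pure { st with H := st.H ++ [x], S := S }) st B1).time + (3 * Q.length +
      (foldT (fun (st : CupState n) y => do
      tick (n + 1)
      let R := if l = n then st.R else st.R ++ [y]
      let S ← foldT (fun S x => tryProduct F.faceTable.val l S y x) st.S st.H
      pure { st with R := R, S := S }) st1 B2).time)) := by
    rw [hst1, ← hborn, ← hborn', ← filterT_time, ← filterT_time (fun x => decide (x.birth = l))]
    rfl
  rw [hv, ht]
  refine ⟨N', g1, g2, by rw [g3]; exact htr, by rw [g4]; exact hR.append_born hln, g5, ?_, ?_⟩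
  · intro X hX1 hX2 hX3
    refine Wc_succ_le hk hln hP hQ hX1 hX2 fun p hp q hq hp1 hq1 hp2 hq2 h => ?_
    by_cases hql : q.birth = l
    · obtain ⟨x, hx, hxp, -⟩ := htr.complete p hp hp1 hp2
      have h8 := hX3 (g6 q (List.mem_filter.2 ⟨hq, by simpa using hql⟩) x hx)
      rw [F.cupE_congr (x := q.rep) (x' := q.rep) (by rw [sub_self]; exact zero_mem _) hxp]
        at h8
      exact cup_swap_mem (F.Wc_le_Zc k l (hQ.mem_of_le hq hq2))
        (F.Wc_le_Zc 1 l (hP.mem_of_le hp hp2)) hX1 h8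
    · have hpl : p.birth = l := h.resolve_right hql
      have hqn := (hQ.bar q hq).2
      have hl' : l ≠ n := by omega
      obtain ⟨y, hy, hyq, -⟩ := hR.complete q hq hq1 (by omega)
      have h8 := hX3 (g8 (h6 p (by
        rw [hB1, if_neg hl']
        exact List.mem_filter.2 ⟨hp, by simpa using hpl⟩) y hy))
      rwa [F.cupE_congr (x := p.rep) (x' := p.rep) (by rw [sub_self]; exact zero_mem _) hyq]
        at h8
  · rw [List.map_const', List.sum_replicate, smul_eq_mul] at h7 g7
    have h8 : n ≤ n ^ 3 := Nat.le_self_pow (by norm_num) n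
    have h9 : B1.length * (n + 1 + 22 * n ^ 3 + 1) ≤ B.length * (25 * n ^ 3) := by
      refine Nat.mul_le_mul ?_ (by omega)
      rw [hB1]
      split_ifs <;> simp
    have g9 : B2.length * (n + 1 + 22 * n ^ 3 + 1) ≤ B2.length * (25 * n ^ 3) :=
      Nat.mul_le_mul_left _ (by omega)
    have h10 : 25 * n ^ 3 * (B.length + B2.length) =
      B.length * (25 * n ^ 3) + B2.length * (25 * n ^ 3) := by ring
    unfold stageBound
    rw [← hB, ← hB2, h10]
    omega

/-- CupPers computes a certified barcode of the persistent 2-cup module. -/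
theorem cupPers_spec {P : List (BarRep n)} (hPn : P.length ≤ n)
    (hP : F.IsElderBasis (F.Wc 1) (positiveBars P)) :
    F.IsElderBasis (F.Wc 2) (cupPers F.faceTable.val F.coboundaryMatrix.val P).val ∧
      (cupPers F.faceTable.val F.coboundaryMatrix.val P).time ≤ 200 * n ^ 4 := by
  set H := (filterT (fun x : BarRep n => decide (x.birth = n ∧ 0 < x.deg)) P).val with hHdef
  have hH : H = (positiveBars P).filter fun x => x.birth = n := by
    rw [hHdef, filterT_val, positiveBars, List.filter_filter]
    exact List.filter_congr fun x _ => by simp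
  have regroup : ∀ a b c d : ℕ, a + (b + (c + d)) = a + (b + c) + d := by omega
  obtain ⟨h1, h2⟩ := loop_spec (F := F) (W := F.Wc 2) (P := P) (Q := [])
    (stage := cupStage F P) (f := fun st l => do
      let st ← restrictState l st
      let born ← filterT (fun x => x.birth = l ∧ 0 < x.deg) P
      let st ← foldT (fun (st : CupState n) x => do
        let H := if l = n then st.H else st.H ++ [x]
        tick (n + 1)
        let S ← foldT (fun S y => tryProduct F.faceTable.val l S x y) st.S H
        pure { st with H := H, S := S }) st born
      deathStep P l st)
    (F.Bc_le_Wc 2) (fun i => F.Wc_anti 2 (Nat.le_succ i)) (F.Wc_le_Wc_one (by norm_num)) hPn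
    (Nat.zero_le _) hP (by simp) (stageSpec_cupStage hPn hP) (fun _ _ => rfl)
    (fun _ _ => regroup _ _ _ _)
  have h3 := initialMatrix_time_le F.coboundaryMatrix.val
  have h4 : H.length ≤ n := by
    rw [hH]
    exact (List.length_filter_le _ _).trans ((List.length_filter_le _ _).trans hPn)
  rw [List.filter_nil, ← hH] at h1 h2
  refine ⟨h1, ?_⟩
  have h5 := Nat.add_le_add_left (Nat.add_le_add_left (Nat.add_le_add h3
    (Nat.add_le_add_right h2 0)) (n * H.length)) (3 * P.length)
  rw [← filterT_time (fun x : BarRep n => decide (x.birth = n ∧ 0 < x.deg))] at h5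
  refine le_trans h5 ?_
  rw [filterT_time]
  have h6 := Nat.mul_le_mul_left n h4
  have h7 : n ≤ n ^ 4 := Nat.le_self_pow (by norm_num) n
  have h8 : n * n ≤ n ^ 4 := by
    rw [← pow_two]
    rcases Nat.eq_zero_or_pos n with rfl | hn
    · exact le_rfl
    · exact Nat.pow_le_pow_right hn (by norm_num)
  have h9 : n * (2 * n + 1) = 2 * (n * n) + n := by ring
  omega

/-- From a certified barcode of the persistent `k`-cup module, the loop of OrderkCupPers computes
one of the persistent `(k + 1)`-cup module. -/
theorem nextCupPers_spec {k : ℕ} (hk : 1 ≤ k) {P Q : List (BarRep n)} (hPn : P.length ≤ n)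
    (hP : F.IsElderBasis (F.Wc 1) (positiveBars P)) (hQ : F.IsElderBasis (F.Wc k) Q) :
    F.IsElderBasis (F.Wc (k + 1)) (nextCupPers F.faceTable.val F.coboundaryMatrix.val P Q).val ∧
      (nextCupPers F.faceTable.val F.coboundaryMatrix.val P Q).time ≤ 200 * n ^ 4 := by
  have hQn := hQ.length_le
  set H := (filterT (fun x : BarRep n => decide (x.birth = n ∧ 0 < x.deg)) P).val with hHdef
  have hH : H = (positiveBars P).filter fun x => x.birth = n := by
    rw [hHdef, filterT_val, positiveBars, List.filter_filter]
    exact List.filter_congr fun x _ => by simp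
  set R := (filterT (fun x : BarRep n => decide (x.birth = n)) Q).val with hRdef
  have hR : R = Q.filter fun x => x.birth = n := filterT_val _ _
  have regroup : ∀ a b c d e f : ℕ,
      a + (b + (c + (d + (e + f)))) = a + (b + (c + (d + e))) + f := by omega
  obtain ⟨h1, h2⟩ := loop_spec (F := F) (W := F.Wc (k + 1)) (P := P) (Q := Q)
    (stage := nextCupStage F P Q) (f := fun st l => do
      let st ← restrictState l st
      let born ← filterT (fun x => x.birth = l ∧ l ≠ n ∧ 0 < x.deg) P
      let st ← foldT (fun (st : CupState n) x => do
        tick (n + 1)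
        let S ← foldT (fun S y => tryProduct F.faceTable.val l S x y) st.S st.R
        pure { st with H := st.H ++ [x], S := S }) st born
      let born' ← filterT (fun x => x.birth = l) Q
      let st ← foldT (fun (st : CupState n) y => do
        tick (n + 1)
        let R := if l = n then st.R else st.R ++ [y]
        let S ← foldT (fun S x => tryProduct F.faceTable.val l S y x) st.S st.H
        pure { st with R := R, S := S }) st born'
      deathStep P l st)
    (F.Bc_le_Wc (k + 1)) (fun i => F.Wc_anti (k + 1) (Nat.le_succ i))
    (F.Wc_le_Wc_one (Nat.le_add_left 1 k)) hPn hQn hP (fun x hx => (hQ.bar x hx).2)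
    (stageSpec_nextCupStage hk hPn hQn hP hQ) (fun _ _ => rfl)
    (fun _ _ => regroup _ _ _ _ _ _)
  have h3 := initialMatrix_time_le F.coboundaryMatrix.val
  have h4 : H.length ≤ n := by
    rw [hH]
    exact (List.length_filter_le _ _).trans ((List.length_filter_le _ _).trans hPn)
  have h4' : R.length ≤ n := by
    rw [hR]
    exact (List.length_filter_le _ _).trans hQn
  rw [← hH, ← hR] at h1 h2
  refine ⟨h1, ?_⟩
  have h5 := Nat.add_le_add_left (Nat.add_le_add_left (Nat.add_le_add_left (Nat.add_le_add h3
    (Nat.add_le_add_right h2 0)) (n * (H.length + R.length))) (3 * Q.length)) (3 * P.length)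
  rw [← filterT_time (fun x : BarRep n => decide (x.birth = n ∧ 0 < x.deg)) P,
    ← filterT_time (fun x : BarRep n => decide (x.birth = n)) Q] at h5
  refine le_trans h5 ?_
  rw [filterT_time, filterT_time]
  have h6 := Nat.mul_le_mul_left n (Nat.add_le_add h4 h4')
  have h7 : n ≤ n ^ 4 := Nat.le_self_pow (by norm_num) n
  have h8 : n * n ≤ n ^ 4 := by
    rw [← pow_two]
    rcases Nat.eq_zero_or_pos n with rfl | hn
    · exact le_rfl
    · exact Nat.pow_le_pow_right hn (by norm_num)
  have h9 : n * (2 * n + 1) = 2 * (n * n) + n := by ring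
  have h10 : n * (n + n) = 2 * (n * n) := by ring
  omega

end SimplexwiseFiltration

/-! ### The persistent cohomology algorithm -/

namespace SimplexwiseFiltration

variable {V : Type u} [LinearOrder V] {n : ℕ} (F : SimplexwiseFiltration V n)

theorem evalCoboundary_val (i : Fin n) (x : Vec n) :
    (evalCoboundary F.coboundaryMatrix.val i x).val = F.dl x i := by
  unfold evalCoboundary
  rw [foldT_val]
  change (List.finRange n).foldl (fun acc j => acc + F.coboundaryMatrix.val j i * x j) 0 = _
  rw [foldl_add_eq, zero_add, dl_apply, Fin.sum_univ_def]

theorem evalCoboundary_time_le (D : Fin n → Vec n) (i : Fin n) (x : Vec n) :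
    (evalCoboundary D i x).time ≤ 3 * n := by
  have := foldT_time_le (f := fun (acc : ZMod 2) j => do
    tick 2
    pure (acc + D j i * x j)) (l := List.finRange n) 0 2 fun _ _ _ => le_rfl
  rw [List.length_finRange] at this
  unfold evalCoboundary
  omega

theorem tail_eq_span_sup (i : Fin n) :
    tail n i.val = (ZMod 2) ∙ (Pi.single i 1 : Vec n) ⊔ tail n (i.val + 1) := by
  apply le_antisymm
  · intro x hx
    rw [← add_sub_cancel (x i • (Pi.single i 1 : Vec n)) x]
    refine Submodule.add_mem_sup (Submodule.smul_mem _ _ (Submodule.mem_span_singleton_self _)) ?_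
    intro j hj
    rw [Pi.sub_apply, Pi.smul_apply]
    rcases (Nat.lt_succ_iff.1 hj).eq_or_lt with h | h
    · rw [Fin.ext h, Pi.single_eq_same, smul_eq_mul, mul_one, sub_self]
    · rw [hx j h, Pi.single_eq_of_ne (by rintro rfl; exact lt_irrefl _ h), smul_zero, sub_zero]
  · refine sup_le ((Submodule.span_singleton_le_iff_mem _ _).2 fun j hj => ?_)
      (tail_anti (Nat.le_succ _))
    exact Pi.single_eq_of_ne (by rintro rfl; exact lt_irrefl _ hj) _

/-- When a simplex is removed, its indicator becomes a coboundary. -/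
theorem Bc_eq_sup_single (i : Fin n) :
    F.Bc i.val = F.Bc (i.val + 1) ⊔ (ZMod 2) ∙ (Pi.single i 1 : Vec n) := by
  rw [← F.Bc_sup_tail (Nat.le_succ i.val), tail_eq_span_sup, sup_comm ((ZMod 2) ∙ _), ← sup_assoc,
    sup_eq_left.2 (F.tail_le_Bc _)]

theorem mem_Zc_succ {i : Fin n} {x : Vec n} :
    x ∈ F.Zc (i.val + 1) ↔ x ∈ F.Zc i.val ∧ F.dl x i = 0 := by
  rw [mem_Zc, mem_Zc]
  constructor
  · intro h
    exact ⟨fun j hj => h j (by omega), h i (Nat.lt_succ_self _)⟩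
  · rintro ⟨h1, h2⟩ j hj
    rcases (Nat.lt_succ_iff.1 hj).eq_or_lt with h | h
    · rw [Fin.ext h]; exact h2
    · exact h1 j h

theorem Bc_le_Zc_succ (i : Fin n) : F.Bc i.val ≤ F.Zc (i.val + 1) := by
  rw [Bc_eq_sup_single]
  refine sup_le (F.Bc_le_Zc _) ((Submodule.span_singleton_le_iff_mem _ _).2 ?_)
  refine F.mem_Zc.2 fun j hj => F.dl_eq_of_tail fun k hk => ?_
  exact Pi.single_eq_of_ne (by rintro rfl; omega) _

/-- The indicator of simplex `i` is a coboundary of `K_{i+1}` if and only if some cocycle of `K_i`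
does not extend. -/
theorem single_mem_Bc_succ {i : Fin n} :
    (Pi.single i 1 : Vec n) ∈ F.Bc (i.val + 1) ↔ ∃ w ∈ F.Zc i.val, F.dl w i ≠ 0 := by
  constructor
  · intro h
    obtain ⟨w, hw⟩ := F.mem_Bc.1 h
    rw [sub_mem_tail] at hw
    refine ⟨w, F.mem_Zc.2 fun j hj => ?_, ?_⟩
    · rw [← hw j (by omega), Pi.single_eq_of_ne (by rintro rfl; exact lt_irrefl _ hj)]
    · rw [← hw i (Nat.lt_succ_self _), Pi.single_eq_same]
      exact one_ne_zero
  · rintro ⟨w, hw, hwi⟩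
    refine F.mem_Bc.2 ⟨w, sub_mem_tail.2 fun j hj => ?_⟩
    rcases (Nat.lt_succ_iff.1 hj).eq_or_lt with h | h
    · rw [Fin.ext h, Pi.single_eq_same]
      exact ((Fin.eq_one_of_ne_zero _ hwi)).symm
    · rw [F.mem_Zc.1 hw j h, Pi.single_eq_of_ne (by rintro rfl; exact lt_irrefl _ h)]

/-- If the coboundary of a homogeneous cochain does not vanish on a simplex, then the dimension of
this simplex is the degree plus one. -/
theorem card_of_dl_ne_zero {x : BarRep n}
    (hx : ∀ j : Fin n, x.rep j ≠ 0 → (F.simplex j).card = x.deg + 1) {i : Fin n}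
    (h : F.dl x.rep i ≠ 0) : (F.simplex i).card = x.deg + 2 := by
  rw [dl_apply] at h
  obtain ⟨j, -, hj⟩ := Finset.exists_ne_zero_of_sum_ne_zero h
  have h1 := hx j (right_ne_zero_of_mul hj)
  have h2 := left_ne_zero_of_mul hj
  rw [coboundaryMatrix_val] at h2
  have h3 := (ite_ne_right_iff.1 h2).1.2
  omega

/-- The state of the persistent cohomology algorithm after the arrival of the simplices of `K_i`: the
finished bars `O` and the live bars `L` (with provisional birth index `n`), oldest first. -/
structure PCohInv (i : ℕ) (L O : List (BarRep n)) : Prop where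
  live : ∀ x ∈ L, x.death < i ∧ x.birth = n ∧ x.rep ∈ head n i ∧ x.rep ∈ F.Zc i
  sorted : L.Pairwise fun x y => x.death < y.death
  done : ∀ x ∈ O, x.death < x.birth ∧ x.birth < i ∧ x.rep ∈ head n x.birth ∧
    x.rep ∈ F.Zc x.birth ∧ ∃ j : Fin n, j.val = x.birth ∧ F.dl x.rep j ≠ 0
  homogeneous : ∀ x ∈ O ++ L, ∀ j : Fin n, x.rep j ≠ 0 → (F.simplex j).card = x.deg + 1
  trivial : ∀ x ∈ O ++ L, x.rep ∈ F.Bc x.death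
  span_eq : ∀ m ≤ i, F.Bc m ⊔ spanL (ZMod 2) (reps (aliveAt (O ++ L) m)) = F.Zc m
  indep : ∀ m ≤ i, IndepMod (F.Bc m) (reps (aliveAt (O ++ L) m))

variable {F}

/-- A representative that vanishes in cohomology below its death index is, at every index where it is
a cocycle, in the span of the live ones. -/
theorem rep_mem_sup_aliveAt {Q : List (BarRep n)} {x : BarRep n} (hx : x ∈ Q)
    (hB : x.rep ∈ F.Bc x.death) {m : ℕ} (hm : m ≤ x.birth) :
    x.rep ∈ F.Bc m ⊔ spanL (ZMod 2) (reps (aliveAt Q m)) := by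
  rcases lt_or_ge x.death m with h | h
  · exact Submodule.mem_sup_right (mem_spanL (rep_mem_reps (mem_aliveAt.2 ⟨hx, h, hm⟩)))
  · exact Submodule.mem_sup_left (F.Bc_anti h hB)

theorem head_mono {i j : ℕ} (h : i ≤ j) : head n i ≤ head n j :=
  fun _ hx k hk => hx k (h.trans hk)

namespace PCohInv

variable {L O : List (BarRep n)}

theorem aliveAt_done {i : ℕ} (h : F.PCohInv i L O) {m : ℕ} (hm : i ≤ m) : aliveAt O m = [] :=
  List.filter_eq_nil_iff.2 fun x hx => by
    have := (h.done x hx).2.1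
    rw [decide_eq_true_iff]
    rintro ⟨-, h2⟩
    have h3 : m ≤ x.birth := h2
    omega

theorem aliveAt_live {i : ℕ} (h : F.PCohInv i L O) {m : ℕ} (hm : i ≤ m) (hmn : m ≤ n) :
    aliveAt L m = L :=
  List.filter_eq_self.2 fun x hx => by
    have := h.live x hx
    rw [decide_eq_true_iff]
    exact ⟨this.1.trans_le hm, hmn.trans this.2.1.ge⟩

theorem span_live {i : ℕ} (h : F.PCohInv i L O) (hi : i ≤ n) :
    F.Bc i ⊔ spanL (ZMod 2) (reps L) = F.Zc i := by
  rw [← h.span_eq i le_rfl, aliveAt_append, h.aliveAt_done le_rfl, h.aliveAt_live le_rfl hi,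
    List.nil_append]

theorem indep_live {i : ℕ} (h : F.PCohInv i L O) (hi : i ≤ n) :
    IndepMod (F.Bc i) (reps L) := by
  have := h.indep i le_rfl
  rwa [aliveAt_append, h.aliveAt_done le_rfl, h.aliveAt_live le_rfl hi, List.nil_append] at this

theorem length_le {i : ℕ} (h : F.PCohInv i L O) (hi : i ≤ n) : L.length ≤ n := by
  have := (h.indep_live hi).length_le
  simpa using this

/-- If all live cocycles extend over simplex `i`, its indicator is a new cocycle. -/
theorem push {i : Fin n} (h : F.PCohInv i.val L O) (h0 : ∀ x ∈ L, F.dl x.rep i = 0) :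
    F.PCohInv (i.val + 1)
      (L ++ [⟨i.val, n, (F.simplex i).card - 1, Pi.single i 1⟩]) O := by
  set e : BarRep n := ⟨i.val, n, (F.simplex i).card - 1, Pi.single i 1⟩ with he
  have heB : e.rep ∈ F.Bc i.val := by
    rw [Bc_eq_sup_single]
    exact Submodule.mem_sup_right (Submodule.mem_span_singleton_self _)
  have hext : F.Zc i.val ≤ F.Zc (i.val + 1) := by
    rw [← h.span_live i.isLt.le]
    refine sup_le (F.Bc_le_Zc_succ i) (spanL_le.2 fun v hv => ?_)
    obtain ⟨x, hx, rfl⟩ := mem_reps.1 hv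
    exact F.mem_Zc_succ.2 ⟨(h.live x hx).2.2.2, h0 x hx⟩
  have hsupp : e.rep ∈ head n (i.val + 1) := fun j hj =>
    Pi.single_eq_of_ne (by rintro rfl; omega) _
  have hlive : ∀ x ∈ L ++ [e], x.death < i.val + 1 ∧ x.birth = n ∧ x.rep ∈ head n (i.val + 1) ∧
      x.rep ∈ F.Zc (i.val + 1) := by
    intro x hx
    rcases List.mem_append.1 hx with hx | hx
    · obtain ⟨h1, h2, h3, h4⟩ := h.live x hx
      exact ⟨by omega, h2, head_mono (Nat.le_succ _) h3, hext h4⟩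
    · rw [List.mem_singleton.1 hx]
      exact ⟨Nat.lt_succ_self _, rfl, hsupp, F.Bc_le_Zc_succ i heB⟩
  have hm : ∀ m ≤ i.val, aliveAt (O ++ (L ++ [e])) m = aliveAt (O ++ L) m := by
    intro m hm
    rw [← List.append_assoc, aliveAt_append]
    have : aliveAt [e] m = [] := List.filter_eq_nil_iff.2 fun x hx => by
      rw [List.mem_singleton.1 hx, decide_eq_true_iff]
      rintro ⟨h2, -⟩
      exact absurd h2 (not_lt.2 hm)
    rw [this, List.append_nil]
  have hi1 : aliveAt (O ++ (L ++ [e])) (i.val + 1) = L ++ [e] := by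
    rw [aliveAt_append, h.aliveAt_done (Nat.le_succ _), List.nil_append]
    refine List.filter_eq_self.2 fun x hx => ?_
    have := hlive x hx
    rw [decide_eq_true_iff]
    exact ⟨this.1, by rw [this.2.1]; exact i.isLt⟩
  have hei : e.rep ∉ F.Bc (i.val + 1) := by
    intro h1
    obtain ⟨w, hw, hwi⟩ := F.single_mem_Bc_succ.1 h1
    exact hwi (F.mem_Zc_succ.1 (hext hw)).2
  refine ⟨hlive, ?_, fun x hx => ?_, fun x hx => ?_, fun x hx => ?_, fun m hm' => ?_,
    fun m hm' => ?_⟩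
  · rw [List.pairwise_append]
    refine ⟨h.sorted, List.pairwise_singleton _ _, fun x hx y hy => ?_⟩
    rw [List.mem_singleton.1 hy]
    exact (h.live x hx).1
  · obtain ⟨h1, h2, h3⟩ := h.done x hx
    exact ⟨h1, by omega, h3⟩
  · rw [← List.append_assoc] at hx
    rcases List.mem_append.1 hx with hx | hx
    · exact h.homogeneous x hx
    · rw [List.mem_singleton.1 hx]
      intro j hj
      have hji : j = i := by
        by_contra hne
        exact hj (Pi.single_eq_of_ne hne _)
      subst hji
      have := Finset.card_pos.2 (F.nonempty j)
      change _ = (F.simplex j).card - 1 + 1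
      omega
  · rw [← List.append_assoc] at hx
    rcases List.mem_append.1 hx with hx | hx
    · exact h.trivial x hx
    · rw [List.mem_singleton.1 hx]
      exact heB
  · rcases Nat.lt_or_ge i.val m with h1 | h1
    · obtain rfl : m = i.val + 1 := by omega
      rw [hi1]
      apply le_antisymm
      · refine sup_le (F.Bc_le_Zc _) (spanL_le.2 fun v hv => ?_)
        obtain ⟨x, hx, rfl⟩ := mem_reps.1 hv
        exact (hlive x hx).2.2.2
      · refine (F.Zc_anti (Nat.le_succ _)).trans ?_
        rw [← h.span_live i.isLt.le, Bc_eq_sup_single, reps_append, spanL_append, sup_assoc,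
          sup_comm ((ZMod 2) ∙ _)]
        refine sup_le_sup_left (sup_le_sup_left ?_ _) _
        exact (Submodule.span_singleton_le_iff_mem _ _).2 (mem_spanL (by simp [reps, he]))
    · rw [hm m h1]
      exact h.span_eq m h1
  · rcases Nat.lt_or_ge i.val m with h1 | h1
    · obtain rfl : m = i.val + 1 := by omega
      rw [hi1, reps_append]
      change IndepMod _ (reps L ++ [e.rep])
      have h2 := h.indep_live i.isLt.le
      refine indepMod_append_singleton.2 ⟨fun h3 => hei ?_, h2.mono (F.Bc_anti (Nat.le_succ _))⟩
      obtain ⟨b, hb, s, hs, hbs⟩ := Submodule.mem_sup.1 h3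
      have h4 : s ∈ F.Bc i.val := by
        have h5 := sub_mem heB (F.Bc_anti (Nat.le_succ _) hb)
        rwa [← hbs, add_sub_cancel_left] at h5
      have h5 := Submodule.disjoint_def.1 h2.disjoint s h4 hs
      rw [← hbs, h5, add_zero]
      exact hb
    · rw [hm m h1]
      exact h.indep m h1

/-- If some live cocycles do not extend over simplex `i`, the youngest one of them, `y`, is finished
and added to the others. -/
theorem pivot {i : Fin n} {L₁ L₂ : List (BarRep n)} {y : BarRep n}
    (h : F.PCohInv i.val (L₁ ++ y :: L₂) O) (hy : F.dl y.rep i ≠ 0)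
    (hL₂ : ∀ x ∈ L₂, F.dl x.rep i = 0) {g : BarRep n → BarRep n}
    (hg0 : ∀ x, F.dl x.rep i = 0 → g x = x)
    (hg1 : ∀ x, F.dl x.rep i ≠ 0 → g x = { x with rep := x.rep + y.rep }) :
    F.PCohInv (i.val + 1) (L₁.map g ++ L₂) (O ++ [{ y with birth := i.val }]) := by
  set y' : BarRep n := { y with birth := i.val } with hy'
  have hyL : y ∈ L₁ ++ y :: L₂ := by simp
  obtain ⟨hyd, hyb, hyh, hyZ⟩ := h.live y hyL
  have hyB : y.rep ∈ F.Bc y.death := h.trivial y (List.mem_append_right _ hyL)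
  have hL₁y : ∀ x ∈ L₁, x.death < y.death := fun x hx =>
    (List.pairwise_append.1 h.sorted).2.2 x hx y (by simp)
  have hgd : ∀ x, (g x).death = x.death ∧ (g x).birth = x.birth ∧ (g x).deg = x.deg := by
    intro x
    by_cases hx : F.dl x.rep i = 0
    · rw [hg0 x hx]; exact ⟨rfl, rfl, rfl⟩
    · rw [hg1 x hx]; exact ⟨rfl, rfl, rfl⟩
  have hgr : ∀ x, (g x).rep = x.rep ∨ (F.dl x.rep i ≠ 0 ∧ (g x).rep = x.rep + y.rep) := by
    intro x
    by_cases hx : F.dl x.rep i = 0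
    · rw [hg0 x hx]; exact Or.inl rfl
    · rw [hg1 x hx]; exact Or.inr ⟨hx, rfl⟩
  have hgi : ∀ x, F.dl (g x).rep i = 0 := by
    intro x
    by_cases hx : F.dl x.rep i = 0
    · rw [hg0 x hx]; exact hx
    · rw [hg1 x hx, map_add, Pi.add_apply, Fin.eq_one_of_ne_zero _ hx, Fin.eq_one_of_ne_zero _ hy]
      decide
  have hgB : ∀ x ∈ L₁, (g x).rep ∈ F.Bc x.death := by
    intro x hx
    have h1 : x.rep ∈ F.Bc x.death := h.trivial x (by simp [hx])
    rcases hgr x with h2 | ⟨-, h2⟩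
    · rw [h2]; exact h1
    · rw [h2]; exact add_mem h1 (F.Bc_anti (hL₁y x hx).le hyB)
  have hlive : ∀ x ∈ L₁.map g ++ L₂, x.death < i.val ∧ x.birth = n ∧ x.rep ∈ head n i.val ∧
      x.rep ∈ F.Zc (i.val + 1) ∧ x.rep ∈ F.Bc x.death := by
    intro x hx
    rcases List.mem_append.1 hx with hx | hx
    · obtain ⟨z, hz, rfl⟩ := List.mem_map.1 hx
      obtain ⟨h1, h2, h3, h4⟩ := h.live z (by simp [hz])
      rw [(hgd z).1, (hgd z).2.1]
      have h5 : (g z).rep ∈ head n i.val ∧ (g z).rep ∈ F.Zc i.val := by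
        rcases hgr z with h5 | ⟨-, h5⟩
        · rw [h5]; exact ⟨h3, h4⟩
        · rw [h5]; exact ⟨add_mem h3 hyh, add_mem h4 hyZ⟩
      exact ⟨h1, h2, h5.1, F.mem_Zc_succ.2 ⟨h5.2, hgi z⟩, hgB z hz⟩
    · obtain ⟨h1, h2, h3, h4⟩ := h.live x (by simp [hx])
      exact ⟨h1, h2, h3, F.mem_Zc_succ.2 ⟨h4, hL₂ x hx⟩, h.trivial x (by simp [hx])⟩
  -- up to index `i`, the bars are the same and their classes span the same space
  have hsub : ∀ m, aliveAt (O ++ [y'] ++ (L₁.map g ++ L₂)) m =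
      aliveAt O m ++ aliveAt [y'] m ++ (aliveAt (L₁.map g) m ++ aliveAt L₂ m) := fun m => by
    simp only [aliveAt_append]
  have hlen : ∀ m ≤ i.val, (reps (aliveAt (O ++ [y'] ++ (L₁.map g ++ L₂)) m)).length =
      (reps (aliveAt (O ++ (L₁ ++ y :: L₂)) m)).length := by
    intro m hm
    have h1 : (aliveAt (L₁.map g) m).length = (aliveAt L₁ m).length := by
      rw [aliveAt, List.filter_map, List.length_map, aliveAt]
      congr 1
      refine List.filter_congr fun x _ => ?_
      rw [Function.comp_apply, (hgd x).1, (hgd x).2.1]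
    have h2 : (aliveAt [y'] m).length = (aliveAt [y] m).length := by
      rw [aliveAt, aliveAt, ← List.countP_eq_length_filter, ← List.countP_eq_length_filter,
        List.countP_singleton, List.countP_singleton]
      have : Alive (y'.death, y'.birth) m ↔ Alive (y.death, y.birth) m := by
        change (y.death < m ∧ m ≤ i.val) ↔ (y.death < m ∧ m ≤ y.birth)
        have := i.isLt
        omega
      simp only [this]
    have h3 : aliveAt (O ++ (L₁ ++ y :: L₂)) m =
        aliveAt O m ++ (aliveAt L₁ m ++ (aliveAt [y] m ++ aliveAt L₂ m)) := by
      rw [← aliveAt_append, ← aliveAt_append, ← aliveAt_append]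
      rfl
    rw [hsub, h3]
    simp only [length_reps, List.length_append, h1, h2]
    omega
  have hspan : ∀ m ≤ i.val, F.Bc m ⊔ spanL (ZMod 2)
      (reps (aliveAt (O ++ [y'] ++ (L₁.map g ++ L₂)) m)) =
        F.Bc m ⊔ spanL (ZMod 2) (reps (aliveAt (O ++ (L₁ ++ y :: L₂)) m)) := by
    intro m hm
    have hmn : m ≤ n := hm.trans i.isLt.le
    set X' := F.Bc m ⊔ spanL (ZMod 2) (reps (aliveAt (O ++ [y'] ++ (L₁.map g ++ L₂)) m)) with hX'
    set X := F.Bc m ⊔ spanL (ZMod 2) (reps (aliveAt (O ++ (L₁ ++ y :: L₂)) m)) with hX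
    have hyX' : y.rep ∈ X' := rep_mem_sup_aliveAt (x := y') (by simp) hyB hm
    have hyX : y.rep ∈ X := rep_mem_sup_aliveAt (x := y) (by simp) hyB (hmn.trans hyb.ge)
    apply le_antisymm
    · refine sup_le le_sup_left (spanL_le.2 fun v hv => ?_)
      obtain ⟨x, hx, rfl⟩ := mem_reps.1 hv
      obtain ⟨hx, hx1, hx2⟩ := mem_aliveAt.1 hx
      rcases List.mem_append.1 hx with hx | hx
      · rcases List.mem_append.1 hx with hx | hx
        · exact Submodule.mem_sup_right (mem_spanL (rep_mem_reps (mem_aliveAt.2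
            ⟨List.mem_append_left _ hx, hx1, hx2⟩)))
        · rw [List.mem_singleton.1 hx]; exact hyX
      · rcases List.mem_append.1 hx with hx | hx
        · obtain ⟨z, hz, rfl⟩ := List.mem_map.1 hx
          have hzX : z.rep ∈ X := rep_mem_sup_aliveAt (by simp [hz]) (h.trivial z (by simp [hz]))
            (hmn.trans (h.live z (by simp [hz])).2.1.ge)
          rcases hgr z with h5 | ⟨-, h5⟩
          · rw [h5]; exact hzX
          · rw [h5]; exact add_mem hzX hyX
        · exact Submodule.mem_sup_right (mem_spanL (rep_mem_reps (mem_aliveAt.2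
            ⟨by simp [hx], hx1, hx2⟩)))
    · refine sup_le le_sup_left (spanL_le.2 fun v hv => ?_)
      obtain ⟨x, hx, rfl⟩ := mem_reps.1 hv
      obtain ⟨hx, hx1, hx2⟩ := mem_aliveAt.1 hx
      rcases List.mem_append.1 hx with hx | hx
      · exact Submodule.mem_sup_right (mem_spanL (rep_mem_reps (mem_aliveAt.2
          ⟨by simp [hx], hx1, hx2⟩)))
      · rcases List.mem_append.1 hx with hx | hx
        · have hzX : (g x).rep ∈ X' := rep_mem_sup_aliveAt (x := g x)
            (List.mem_append_right _ (List.mem_append_left _ (List.mem_map.2 ⟨x, hx, rfl⟩)))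
            (by rw [(hgd x).1]; exact hgB x hx) (by rw [(hgd x).2.1]; exact hx2)
          rcases hgr x with h5 | ⟨-, h5⟩
          · rwa [h5] at hzX
          · rw [← add_sub_cancel_right x.rep y.rep, ← h5]
            exact sub_mem hzX hyX'
        · rcases List.mem_cons.1 hx with rfl | hx
          · exact hyX'
          · exact Submodule.mem_sup_right (mem_spanL (rep_mem_reps (mem_aliveAt.2
              ⟨by simp [hx], hx1, hx2⟩)))
  -- at index `i + 1`: the coboundary of `y` is the indicator of simplex `i`, so that the spaces of
  -- coboundaries agree, and `y` is the only representative that is lost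
  have hBi : F.Bc i.val = F.Bc (i.val + 1) := by
    rw [Bc_eq_sup_single, sup_eq_left, Submodule.span_singleton_le_iff_mem]
    exact F.single_mem_Bc_succ.2 ⟨y.rep, hyZ, hy⟩
  have halive : ∀ m, i.val ≤ m → m ≤ n → aliveAt (L₁.map g ++ L₂) m = L₁.map g ++ L₂ :=
    fun m hm hmn => List.filter_eq_self.2 fun x hx => by
      have := hlive x hx
      rw [decide_eq_true_iff]
      exact ⟨this.1.trans_le hm, by rw [this.2.1]; exact hmn⟩
  have hai : aliveAt (O ++ [y'] ++ (L₁.map g ++ L₂)) i.val = y' :: (L₁.map g ++ L₂) := by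
    rw [aliveAt_append, aliveAt_append, h.aliveAt_done le_rfl, halive _ le_rfl i.isLt.le]
    have : aliveAt [y'] i.val = [y'] := List.filter_eq_self.2 fun x hx => by
      rw [List.mem_singleton.1 hx, decide_eq_true_iff]
      exact ⟨hyd, le_rfl⟩
    rw [this]
    rfl
  have hai1 : aliveAt (O ++ [y'] ++ (L₁.map g ++ L₂)) (i.val + 1) = L₁.map g ++ L₂ := by
    rw [aliveAt_append, aliveAt_append, h.aliveAt_done (Nat.le_succ _),
      halive _ (Nat.le_succ _) i.isLt]
    have : aliveAt [y'] (i.val + 1) = [] := List.filter_eq_nil_iff.2 fun x hx => by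
      rw [List.mem_singleton.1 hx, decide_eq_true_iff]
      rintro ⟨-, h2⟩
      exact absurd h2 (Nat.not_succ_le_self _)
    rw [this]
    rfl
  refine ⟨fun x hx => ?_, ?_, fun x hx => ?_, fun x hx => ?_, fun x hx => ?_, fun m hm' => ?_,
    fun m hm' => ?_⟩
  · obtain ⟨h1, h2, h3, h4, -⟩ := hlive x hx
    exact ⟨by omega, h2, head_mono (Nat.le_succ _) h3, h4⟩
  · obtain ⟨h1, h2, h3⟩ := List.pairwise_append.1 h.sorted
    rw [List.pairwise_append, List.pairwise_map]
    refine ⟨h1.imp fun {a b} hab => ?_, (List.pairwise_cons.1 h2).2, fun a ha b hb => ?_⟩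
    · rw [(hgd a).1, (hgd b).1]; exact hab
    · obtain ⟨z, hz, rfl⟩ := List.mem_map.1 ha
      rw [(hgd z).1]
      exact h3 z hz b (List.mem_cons_of_mem _ hb)
  · rcases List.mem_append.1 hx with hx | hx
    · obtain ⟨h1, h2, h3⟩ := h.done x hx
      exact ⟨h1, by omega, h3⟩
    · rw [List.mem_singleton.1 hx]
      exact ⟨hyd, Nat.lt_succ_self _, hyh, hyZ, i, rfl, hy⟩
  · have hyhom := h.homogeneous y (List.mem_append_right _ hyL)
    rcases List.mem_append.1 hx with hx | hx
    · rcases List.mem_append.1 hx with hx | hx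
      · exact h.homogeneous x (by simp [hx])
      · rw [List.mem_singleton.1 hx]; exact hyhom
    · rcases List.mem_append.1 hx with hx | hx
      · obtain ⟨z, hz, rfl⟩ := List.mem_map.1 hx
        have hzhom := h.homogeneous z (by simp [hz])
        intro j hj
        rw [(hgd z).2.2]
        rcases hgr z with h5 | ⟨hz0, h5⟩
        · rw [h5] at hj; exact hzhom j hj
        · rw [h5, Pi.add_apply] at hj
          have h6 := F.card_of_dl_ne_zero hzhom hz0
          have h7 := F.card_of_dl_ne_zero hyhom hy
          by_cases h8 : z.rep j = 0
          · rw [h8, zero_add] at hj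
            have := hyhom j hj
            omega
          · exact hzhom j h8
      · exact h.homogeneous x (by simp [hx])
  · rcases List.mem_append.1 hx with hx | hx
    · rcases List.mem_append.1 hx with hx | hx
      · exact h.trivial x (by simp [hx])
      · rw [List.mem_singleton.1 hx]; exact hyB
    · exact (hlive x hx).2.2.2.2
  · rcases Nat.lt_or_ge i.val m with h1 | h1
    · obtain rfl : m = i.val + 1 := by omega
      rw [hai1]
      apply le_antisymm
      · refine sup_le (F.Bc_le_Zc _) (spanL_le.2 fun v hv => ?_)
        obtain ⟨x, hx, rfl⟩ := mem_reps.1 hv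
        exact (hlive x hx).2.2.2.1
      · intro z hz
        obtain ⟨hzi, hz0⟩ := F.mem_Zc_succ.1 hz
        rw [← h.span_eq i.val le_rfl, ← hspan _ le_rfl, hai] at hzi
        change z ∈ F.Bc i.val ⊔ spanL (ZMod 2) (y.rep :: reps (L₁.map g ++ L₂)) at hzi
        rw [spanL_cons, sup_comm ((ZMod 2) ∙ _), ← sup_assoc, hBi] at hzi
        obtain ⟨a, ha, b, hb, rfl⟩ := Submodule.mem_sup.1 hzi
        obtain ⟨c, rfl⟩ := Submodule.mem_span_singleton.1 hb
        have ha0 : F.dl a i = 0 := by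
          have : a ∈ F.Zc (i.val + 1) := by
            refine (sup_le (F.Bc_le_Zc _) (spanL_le.2 fun v hv => ?_) :
              F.Bc (i.val + 1) ⊔ spanL (ZMod 2) (reps (L₁.map g ++ L₂)) ≤ _) ha
            obtain ⟨x, hx, rfl⟩ := mem_reps.1 hv
            exact (hlive x hx).2.2.2.1
          exact (F.mem_Zc_succ.1 this).2
        rw [map_add, Pi.add_apply, ha0, zero_add, map_smul, Pi.smul_apply, smul_eq_mul,
          mul_eq_zero] at hz0
        rw [hz0.resolve_right hy, zero_smul, add_zero]
        exact ha
    · rw [hspan m h1, h.span_eq m h1]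
  · rcases Nat.lt_or_ge i.val m with h1 | h1
    · obtain rfl : m = i.val + 1 := by omega
      have h2 := (indepMod_congr (hspan _ le_rfl) (hlen _ le_rfl)).2 (h.indep _ le_rfl)
      rw [hai, hBi] at h2
      rw [hai1]
      exact h2.sublist (List.sublist_cons_self _ _)
    · exact (indepMod_congr (hspan m h1) (hlen m h1)).2 (h.indep m h1)

/-- When all simplices have arrived, a persistent cohomology basis has been computed. -/
theorem isPersistentCohomologyBasis (h : F.PCohInv n L O) :
    F.IsPersistentCohomologyBasis (O ++ L) := by
  have hmem : ∀ x ∈ O ++ L, x.death < x.birth ∧ x.birth ≤ n ∧ x.rep ∈ head n x.birth ∧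
      x.rep ∈ F.Zc x.birth := by
    intro x hx
    rcases List.mem_append.1 hx with hx | hx
    · obtain ⟨h1, h2, h3, h4, -⟩ := h.done x hx
      exact ⟨h1, h2.le, h3, h4⟩
    · obtain ⟨h1, h2, h3, h4⟩ := h.live x hx
      rw [h2]
      exact ⟨h1, le_rfl, h3, h4⟩
  have hspan : ∀ i ≤ n, Submodule.span (ZMod 2)
      {c | ∃ x ∈ O ++ L, Alive (x.death, x.birth) i ∧ c = F.classAt i x.rep} = ⊤ := by
    intro i hi
    refine F.liftSub_injective i ?_
    rw [F.classes_alive, F.liftSub_span, liftSub_top, ← h.span_eq i hi]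
    · rfl
    · intro v hv
      obtain ⟨x, hx, rfl⟩ := mem_reps.1 hv
      obtain ⟨hx, hx1, hx2⟩ := mem_aliveAt.1 hx
      exact F.Zc_anti hx2 (hmem x hx).2.2.2
  refine ⟨fun x hx => ⟨(hmem x hx).1, (hmem x hx).2.1⟩, fun x hx j hj => ?_, h.homogeneous,
    fun x hx => (hmem x hx).2.2.2, fun x hx hxn hc => ?_, fun x hx i hi =>
    F.classAt_of_mem_Bc (F.Bc_anti hi (h.trivial x hx)), fun i hi => ?_, hspan⟩
  · by_contra hlt
    exact hj ((hmem x hx).2.2.1 j (not_lt.1 hlt))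
  · rcases List.mem_append.1 hx with hx | hx
    · obtain ⟨-, -, -, -, j, hj, hj0⟩ := h.done x hx
      exact hj0 (F.mem_Zc.1 (F.mem_Zc_iff_toCochain.2 hc) j (by omega))
    · exact hxn.ne (h.live x hx).2.1
  · refine linearIndependent_of_top_le_span_of_card_eq_finrank ?_ ?_
    · rw [range_subtype_get (O ++ L) (fun x => Alive (x.death, x.birth) i)
        fun x => F.classAt i x.rep, hspan i hi]
    · rw [card_subtype_get (O ++ L) fun x => Alive (x.death, x.birth) i]
      have h1 := (F.indepMod_of_finrank (X := ⊤) (by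
        rw [liftSub_top]; exact h.span_eq i hi)).1 (h.indep i hi)
      rw [length_reps, finrank_top] at h1
      exact h1

end PCohInv

end SimplexwiseFiltration

namespace SimplexwiseFiltration

variable {V : Type u} [LinearOrder V] {n : ℕ} (F : SimplexwiseFiltration V n)

/-- The live cocycles, paired with the values of their coboundaries on simplex `i`. -/
def extensionTest (i : Fin n) (L : List (BarRep n)) : Timed (List (BarRep n × ZMod 2)) :=
  mapT (fun x => do
    let c ← evalCoboundary F.coboundaryMatrix.val i x.rep
    pure (x, c)) L

/-- The youngest cocycle that does not extend. -/
def findPivot (l : List (BarRep n × ZMod 2)) : Timed (Option (BarRep n)) :=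
  foldT (fun acc p => do
    tick 1
    pure (if p.2 = 0 then acc else some p.1)) none l

/-- Add the pivot `y` to the other cocycles that do not extend, and drop `y` itself; it is recognized by
its death index. The results are appended to `acc`. -/
def addPivot (y : BarRep n) (acc : List (BarRep n)) (l : List (BarRep n × ZMod 2)) :
    Timed (List (BarRep n)) :=
  foldT (fun acc p => do
      tick 2
      if p.2 = 0 then pure (acc ++ [p.1])
      else if p.1.death = y.death then pure acc
      else do
        let z ← addVec p.1.rep y.rep
        pure (acc ++ [{ p.1 with rep := z }])) acc l

theorem extensionTest_val (i : Fin n) (L : List (BarRep n)) :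
    (F.extensionTest i L).val = L.map fun x => (x, F.dl x.rep i) := by
  unfold extensionTest
  rw [mapT_val]
  exact List.map_congr_left fun x _ => congrArg (Prod.mk x) (F.evalCoboundary_val i x.rep)

theorem findPivot_val (l : List (BarRep n × ZMod 2)) :
    (findPivot l).val = (l.reverse.find? fun p => ¬ p.2 = 0).map Prod.fst := by
  unfold findPivot
  rw [foldT_val]
  change l.foldl (fun acc p => if p.2 = 0 then acc else some p.1) none = _
  suffices h : ∀ b : Option (BarRep n), l.foldl (fun acc p => if p.2 = 0 then acc else some p.1) b =
      ((l.reverse.find? fun p => ¬ p.2 = 0).map Prod.fst).or b by rw [h, Option.or_none]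
  induction l with
  | nil => simp
  | cons a l ih =>
    intro b
    rw [List.foldl_cons, ih, List.reverse_cons, List.find?_append]
    by_cases h : a.2 = 0 <;> cases (l.reverse.find? fun p => ¬ p.2 = 0) <;> simp [h]

/-- What becomes of a live cocycle when the pivot is `y`. -/
def pivotStep (y : BarRep n) (p : BarRep n × ZMod 2) : List (BarRep n) :=
  if p.2 = 0 then [p.1]
  else if p.1.death = y.death then []
  else [{ p.1 with rep := p.1.rep + y.rep }]

theorem addPivot_val (y : BarRep n) (acc : List (BarRep n)) (l : List (BarRep n × ZMod 2)) :
    (addPivot y acc l).val = acc ++ l.flatMap (pivotStep y) := by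
  induction l generalizing acc with
  | nil => simp [addPivot, foldT]
  | cons p l ih =>
    rw [addPivot, foldT_val, List.foldl_cons, ← foldT_val]
    refine (ih _).trans ?_
    rw [List.flatMap_cons, ← List.append_assoc]
    congr 1
    unfold pivotStep
    by_cases h1 : p.2 = 0
    · simp [h1]
    · by_cases h2 : p.1.death = y.death
      · simp [h1, h2]
      · simp [h1, h2, addVec_val]

theorem extensionTest_time_le (i : Fin n) (L : List (BarRep n)) :
    (F.extensionTest i L).time ≤ L.length * (3 * n + 1) :=
  mapT_time_le (3 * n) fun x _ => evalCoboundary_time_le _ i x.rep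

theorem findPivot_time_le (l : List (BarRep n × ZMod 2)) : (findPivot l).time ≤ l.length * 2 :=
  foldT_time_le _ 1 fun _ _ _ => le_rfl

theorem addPivot_time_le (y : BarRep n) (acc : List (BarRep n)) (l : List (BarRep n × ZMod 2)) :
    (addPivot y acc l).time ≤ l.length * (2 * n + 3) := by
  refine foldT_time_le _ (2 * n + 2) fun acc p _ => ?_
  have := addVec_time_le p.1.rep y.rep
  by_cases h1 : p.2 = 0
  · simp [h1]
  · by_cases h2 : p.1.death = y.death
    · simp [h1, h2]
    · simp only [h1, h2, if_false, Timed.time_bind, time_tick, Timed.time_pure]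
      omega

theorem pCohRound_eq (i : Fin n) (L O : List (BarRep n)) :
    F.pCohRound F.coboundaryMatrix.val (L, O) i = (do
      let live ← F.extensionTest i L
      let pivot ← findPivot live
      match pivot with
      | none => do
        let e ← tabulateT fun j => do
          tick 1
          pure (if j = i then (1 : ZMod 2) else 0)
        tick 1
        pure (L ++ [⟨i.val, n, (F.simplex i).card - 1, e⟩], O)
      | some y => do
        let live' ← addPivot y [] live
        tick 1
        pure (live', O ++ [{ y with birth := i.val }])) := rfl

/-- One round preserves the invariant. -/
theorem pCohRound_spec {i : Fin n} {L O : List (BarRep n)} (h : F.PCohInv i.val L O) :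
    F.PCohInv (i.val + 1) (F.pCohRound F.coboundaryMatrix.val (L, O) i).val.1
      (F.pCohRound F.coboundaryMatrix.val (L, O) i).val.2 ∧
    (F.pCohRound F.coboundaryMatrix.val (L, O) i).time ≤ 12 * n ^ 2 := by
  have hn : 0 < n := i.pos
  have hL := h.length_le i.isLt.le
  have t1 := F.extensionTest_time_le i L
  have t2 := findPivot_time_le (F.extensionTest i L).val
  have e1 := F.extensionTest_val i L
  have l1 : (F.extensionTest i L).val.length = L.length := by rw [e1, List.length_map]
  have a1 := Nat.mul_le_mul_right (3 * n + 1) hL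
  have a2 : n * (3 * n + 1) = 3 * n ^ 2 + n := by ring
  have a3 : n ≤ n ^ 2 := Nat.le_self_pow (by norm_num) n
  rw [pCohRound_eq]
  simp only [Timed.val_bind, Timed.time_bind]
  cases hp : (findPivot (F.extensionTest i L).val).val with
  | none =>
    have h0 : ∀ x ∈ L, F.dl x.rep i = 0 := by
      rw [findPivot_val, e1, Option.map_eq_none_iff, List.find?_eq_none] at hp
      intro x hx
      simpa using hp (x, F.dl x.rep i) (by simpa using hx)
    refine ⟨?_, ?_⟩
    · have he : (fun j : Fin n => if j = i then (1 : ZMod 2) else 0) = Pi.single i 1 := by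
        funext j
        rw [Pi.single_apply]
      have := h.push h0
      rw [← he] at this
      exact this
    · have t3 := tabulateT_time_le (f := fun j : Fin n => do
        tick 1
        pure (if j = i then (1 : ZMod 2) else 0)) 1 fun _ => le_rfl
      simp only [Timed.time_bind, time_tick, Timed.time_pure] at t3 ⊢
      omega
  | some y =>
    rw [findPivot_val, e1, Option.map_eq_some_iff] at hp
    obtain ⟨⟨y', c⟩, hp, rfl⟩ := hp
    rw [List.find?_eq_some_iff_append] at hp
    obtain ⟨hc, as, bs, hsplit, has⟩ := hp
    obtain ⟨L₁', l₂, hL12, hb, ha⟩ := List.map_eq_append_iff.1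
      (show L.map (fun x => (x, F.dl x.rep i)) = bs.reverse ++ (y', c) :: as.reverse by
        rw [← List.reverse_reverse (L.map _), hsplit]; simp)
    obtain ⟨y, L₂, rfl, hy, hL₂⟩ := List.map_eq_cons_iff.1 ha
    obtain ⟨rfl, rfl⟩ := Prod.mk.inj hy
    have hy0 : F.dl y.rep i ≠ 0 := by simpa using hc
    subst hL12
    have h2 : ∀ x ∈ L₂, F.dl x.rep i = 0 := by
      intro x hx
      have h3 : (x, F.dl x.rep i) ∈ as := by
        rw [← List.mem_reverse, ← hL₂]
        exact List.mem_map.2 ⟨x, hx, rfl⟩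
      simpa using has _ h3
    have hd : ∀ x ∈ L₁', x.death < y.death := fun x hx =>
      (List.pairwise_append.1 h.sorted).2.2 x hx y (by simp)
    refine ⟨?_, ?_⟩
    · have h3 := h.pivot hy0 h2
        (g := fun x => if F.dl x.rep i = 0 then x else { x with rep := x.rep + y.rep })
        (fun x hx => if_pos hx) (fun x hx => if_neg hx)
      have h4 : (addPivot y [] (F.extensionTest i (L₁' ++ y :: L₂)).val).val =
          L₁'.map (fun x => if F.dl x.rep i = 0 then x else { x with rep := x.rep + y.rep }) ++
            L₂ := by
        rw [addPivot_val, List.nil_append, e1, List.map_append, List.flatMap_append, List.map_cons,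
          List.flatMap_cons]
        have h5 : pivotStep y (y, F.dl y.rep i) = [] := by simp [pivotStep, hy0]
        have h6 : (L₂.map fun x => (x, F.dl x.rep i)).flatMap (pivotStep y) = L₂ := by
          rw [List.flatMap_map]
          conv_rhs => rw [← List.flatMap_singleton' L₂]
          exact List.flatMap_congr fun x hx => by simp [pivotStep, h2 x hx]
        have h7 : (L₁'.map fun x => (x, F.dl x.rep i)).flatMap (pivotStep y) =
            L₁'.map fun x => if F.dl x.rep i = 0 then x else { x with rep := x.rep + y.rep } := by
          rw [List.flatMap_map, List.map_eq_flatMap]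
          refine List.flatMap_congr fun x hx => ?_
          have := (hd x hx).ne
          by_cases h8 : F.dl x.rep i = 0 <;> simp [pivotStep, h8, this]
        rw [h5, h6, h7, List.nil_append]
      simp only [Timed.val_bind, Timed.val_pure, h4]
      exact h3
    · have t3 := addPivot_time_le y [] (F.extensionTest i (L₁' ++ y :: L₂)).val
      rw [l1] at t2 t3
      have a4 := Nat.mul_le_mul_right (2 * n + 3) hL
      have a5 : n * (2 * n + 3) = 2 * n ^ 2 + 3 * n := by ring
      simp only [Timed.time_bind, time_tick, Timed.time_pure]
      omega

/-- The standard algorithm computes a persistent cohomology basis in cubic time. -/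
theorem pCoh_spec : F.IsPersistentCohomologyBasis F.pCoh.val ∧ F.pCoh.time ≤ 19 * n ^ 3 := by
  have h0 : F.PCohInv 0 [] [] := by
    refine ⟨by simp, List.Pairwise.nil, by simp, by simp, by simp, fun m hm => ?_, fun m hm => ?_⟩
    · obtain rfl := Nat.le_zero.1 hm
      rw [Bc_zero, top_sup_eq, eq_comm, eq_top_iff, ← Bc_zero F]
      exact F.Bc_le_Zc 0
    · exact indepMod_nil _
  obtain ⟨h1, h2⟩ := foldT_induction (f := F.pCohRound F.coboundaryMatrix.val)
    (l := List.finRange n) (b := ([], []))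
    (fun done st => F.PCohInv done.length st.1 st.2) (fun _ => 12 * n ^ 2) h0 (by
      rintro done i rest e ⟨L, O⟩ h
      have hi : done.length = i.val := by
        have h3 : (List.finRange n)[done.length]? = some i := by
          rw [e, List.getElem?_append_right le_rfl, Nat.sub_self, List.getElem?_cons_zero]
        rw [List.getElem?_eq_some_iff] at h3
        obtain ⟨h4, h5⟩ := h3
        rw [← h5]
        simp
      rw [List.length_append, List.length_singleton, hi]
      rw [hi] at h
      exact F.pCohRound_spec h)
  rw [List.length_finRange] at h1
  rw [List.map_const', List.sum_replicate, List.length_finRange, smul_eq_mul] at h2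
  refine ⟨h1.isPersistentCohomologyBasis, ?_⟩
  have h3 := F.coboundaryMatrix_time_le
  have h4 : F.pCoh.time = F.coboundaryMatrix.time +
    ((foldT (F.pCohRound F.coboundaryMatrix.val) ([], []) (List.finRange n)).time + (n + 0)) := rfl
  have h5 : n * (12 * n ^ 2 + 1) = 12 * n ^ 3 + n := by ring
  have h6 : n ≤ n ^ 3 := Nat.le_self_pow (by norm_num) n
  omega

/-! ### The recursion -/

variable {F}

/-- Recursion level `k + 2` computes the barcode of the persistent `(k + 2)`-cup module, with one loop
for each order. -/
theorem orderkRec_spec {P : List (BarRep n)} (hPn : P.length ≤ n)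
    (hP : F.IsElderBasis (F.Wc 1) (positiveBars P)) (k : ℕ) :
    F.IsElderBasis (F.Wc (k + 2))
      (orderkRec F.faceTable.val F.coboundaryMatrix.val P (k + 2)).val ∧
    (orderkRec F.faceTable.val F.coboundaryMatrix.val P (k + 2)).time ≤
      (k + 1) * (200 * n ^ 4) := by
  induction k with
  | zero =>
    obtain ⟨h1, h2⟩ := cupPers_spec hPn hP
    exact ⟨h1, h2.trans (Nat.le_mul_of_pos_left _ one_pos)⟩
  | succ k ih =>
    obtain ⟨h1, h2⟩ := nextCupPers_spec (Nat.le_add_left 1 _) hPn hP ih.1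
    refine ⟨h1, ?_⟩
    rw [add_mul (k + 1), one_mul]
    exact Nat.add_le_add ih.2 h2

theorem orderkRecAll_spec {P : List (BarRep n)} (hPn : P.length ≤ n)
    (hP : F.IsElderBasis (F.Wc 1) (positiveBars P)) (k : ℕ) :
    (orderkRecAll F.faceTable.val F.coboundaryMatrix.val P (k + 2)).val.length = k + 1 ∧
    (∀ i ≤ k, F.IsElderBasis (F.Wc (i + 2))
      ((orderkRecAll F.faceTable.val F.coboundaryMatrix.val P (k + 2)).val.getD i [])) ∧
    (orderkRecAll F.faceTable.val F.coboundaryMatrix.val P (k + 2)).time ≤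
      (k + 1) * (200 * n ^ 4 + 1) := by
  induction k with
  | zero =>
    obtain ⟨h1, h2⟩ := cupPers_spec hPn hP
    refine ⟨rfl, fun i hi => ?_, ?_⟩
    · obtain rfl := Nat.le_zero.1 hi
      exact h1
    · exact (h2.trans (Nat.le_succ _)).trans (Nat.le_mul_of_pos_left _ one_pos)
  | succ k ih =>
    obtain ⟨h1, h2, h3⟩ := ih
    set Bs := (orderkRecAll F.faceTable.val F.coboundaryMatrix.val P (k + 2)).val with hBs
    have hlast : Bs.getLastD [] = Bs.getD k [] := by
      rw [List.getLastD_eq_getLast?, List.getLast?_eq_getElem?, h1, Nat.add_sub_cancel,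
        List.getD_eq_getElem?_getD]
    obtain ⟨h4, h5⟩ := nextCupPers_spec (Nat.le_add_left 1 _) hPn hP (h2 k le_rfl)
    rw [← hlast] at h4 h5
    have hv : (orderkRecAll F.faceTable.val F.coboundaryMatrix.val P (k + 1 + 2)).val =
        Bs ++ [(nextCupPers F.faceTable.val F.coboundaryMatrix.val P (Bs.getLastD [])).val] := rfl
    rw [hv]
    refine ⟨by rw [List.length_append, h1]; rfl, fun i hi => ?_, ?_⟩
    · rcases hi.eq_or_lt with rfl | hi
      · rw [List.getD_append_right _ _ _ _ h1.le, h1, Nat.sub_self]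
        exact h4
      · rw [List.getD_append _ _ _ _ (by omega)]
        exact h2 i (by omega)
    · rw [add_mul (k + 1), one_mul]
      exact Nat.add_le_add h3 (Nat.add_le_add_right h5 1)

theorem dim_val {V : Type u} {F : SimplexwiseFiltration V n} : ((foldT (fun d j => do
    tick 2
    pure (max d ((F.simplex j).card - 1))) 0 (List.finRange n) : Timed ℕ)).val = F.dim := by
  rw [foldT_val]
  change (List.finRange n).foldl (fun d j => max d ((F.simplex j).card - 1)) 0 = _
  have h1 : ∀ (l : List (Fin n)) (b m : ℕ), l.foldl (fun d j => max d ((F.simplex j).card - 1)) b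
      ≤ m ↔ b ≤ m ∧ ∀ j ∈ l, (F.simplex j).card - 1 ≤ m := by
    intro l
    induction l with
    | nil => simp
    | cons a l ih =>
      intro b m
      rw [List.foldl_cons, ih, max_le_iff, List.forall_mem_cons, and_assoc]
  refine eq_of_forall_ge_iff fun m => ?_
  rw [h1, dim, Finset.sup_le_iff]
  simp

end SimplexwiseFiltration

theorem mainTheorem2 :
    ∃ C : ℕ, ∀ (V : Type u) [LinearOrder V] (n : ℕ) (F : SimplexwiseFiltration V n),
      (∀ P : List (BarRep n), F.IsPersistentCohomologyBasis P → ∀ k : ℕ, 2 ≤ k →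
        IsBarcode (F.kCupModule k) (barsOf (F.orderkCupPers P k).val) ∧
        (F.orderkCupPers P k).time ≤ C * k * n ^ 4) ∧
      (F.IsPersistentCohomologyBasis F.pCoh.val ∧ F.pCoh.time ≤ C * n ^ 3) ∧
      (1 ≤ F.dim →
        F.allCupBarcodes.val.length = F.dim - 1 ∧
        (∀ k : ℕ, 2 ≤ k → k ≤ F.dim →
          IsBarcode (F.kCupModule k) (barsOf (F.allCupBarcodes.val.getD (k - 2) []))) ∧
        F.allCupBarcodes.time ≤ C * F.dim * n ^ 4) := by
  -- pCoh takes `19 n³` steps, the preprocessing `17 n⁴`, and each order at most `200 n⁴ + 1`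
  refine ⟨300, fun V _ n F => ?_⟩
  have h34 : n ^ 3 ≤ n ^ 4 := by
    rcases Nat.eq_zero_or_pos n with rfl | hn
    · exact le_rfl
    · exact Nat.pow_le_pow_right hn (by norm_num)
  have hT := F.faceTable_time_le
  have hD := F.coboundaryMatrix_time_le
  refine ⟨fun P hP k hk => ?_, ?_, fun hd => ?_⟩
  · obtain ⟨k, rfl⟩ := Nat.exists_eq_add_of_le' hk
    obtain ⟨h1, h2⟩ := SimplexwiseFiltration.orderkRec_spec hP.isElderBasis.length_le
      hP.isElderBasis_positiveBars k
    refine ⟨h1.isBarcode, ?_⟩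
    have h3 : (F.orderkCupPers P (k + 2)).time = F.faceTable.time + (F.coboundaryMatrix.time +
      (orderkRec F.faceTable.val F.coboundaryMatrix.val P (k + 2)).time) := rfl
    have h4 : (k + 1) * (200 * n ^ 4) = 200 * (k * n ^ 4) + 200 * n ^ 4 := by ring
    have h5 : 300 * (k + 2) * n ^ 4 = 300 * (k * n ^ 4) + 600 * n ^ 4 := by ring
    omega
  · have h := F.pCoh_spec
    exact ⟨h.1, h.2.trans (Nat.mul_le_mul_right _ (by norm_num))⟩
  · have h := F.pCoh_spec
    -- a complex of dimension at least `1` is not empty, which pays for the constant overhead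
    have hn : 0 < n := by
      rcases Nat.eq_zero_or_pos n with rfl | hn
      · exact absurd hd (by simp [SimplexwiseFiltration.dim])
      · exact hn
    set P := F.pCoh.val with hP
    have hv : F.allCupBarcodes.val =
        (orderkRecAll F.faceTable.val F.coboundaryMatrix.val P F.dim).val := by
      rw [← SimplexwiseFiltration.dim_val]; rfl
    have ht : F.allCupBarcodes.time = F.pCoh.time + (F.faceTable.time + (F.coboundaryMatrix.time +
        ((foldT (fun d j => do
          tick 2
          pure (max d ((F.simplex j).card - 1))) 0 (List.finRange n) : Timed ℕ).time +
        (orderkRecAll F.faceTable.val F.coboundaryMatrix.val P F.dim).time))) := by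
      rw [← SimplexwiseFiltration.dim_val]; rfl
    have h6 := foldT_time_le (f := fun (d : ℕ) (j : Fin n) => do
      tick 2
      pure (max d ((F.simplex j).card - 1))) (l := List.finRange n) 0 2 fun _ _ _ => le_rfl
    rw [List.length_finRange] at h6
    have h7 : n ≤ n ^ 4 := Nat.le_self_pow (by norm_num) n
    rw [hv, ht]
    obtain ⟨d, hdd⟩ := Nat.exists_eq_add_of_le' hd
    rw [hdd]
    cases d with
    | zero =>
      have h8 : orderkRecAll F.faceTable.val F.coboundaryMatrix.val P (0 + 1) = pure [] := rfl
      rw [h8]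
      refine ⟨rfl, fun k h1 h2 => absurd h2 (by omega), ?_⟩
      rw [Timed.time_pure]
      omega
    | succ d =>
      obtain ⟨h8, h9, h10⟩ := SimplexwiseFiltration.orderkRecAll_spec
        h.1.isElderBasis.length_le h.1.isElderBasis_positiveBars d
      refine ⟨h8, fun k h1 h2 => ?_, ?_⟩
      · obtain ⟨k, rfl⟩ := Nat.exists_eq_add_of_le' h1
        exact (h9 k (by omega)).isBarcode
      · change _ + (_ + (_ + (_ + (orderkRecAll F.faceTable.val F.coboundaryMatrix.val P
          (d + 2)).time))) ≤ _
        have h11 : (d + 1) * (200 * n ^ 4 + 1) = 200 * (d * n ^ 4) + d + 200 * n ^ 4 + 1 := by ring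
        have h12 : 300 * (d + 1 + 1) * n ^ 4 = 300 * (d * n ^ 4) + 600 * n ^ 4 := by ring
        have h13 : d ≤ d * n ^ 4 := Nat.le_mul_of_pos_right d (by positivity)
        omega
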